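/- **Theorem (Tractable Fragment).** An *attributed temporal causal hypergraph* $\mathcal H$ consists of a finite set $V$ of vertices; a finite set $\mathcal E$ of hyperedges, each with a non-empty finite array of participants from $V\cup\mathcal E$ (the position is the role of the participant), the nesting of hyperedges being well-founded; finite property lists $\mathcal A_V(v)$, $\mathcal A_E(e)$ of key–value pairs of strings; a valid time $\tau_v(e)$ and a transaction time $\tau_t(e)$, which are non-empty closed intervals of $\mathbb Q$, possibly infinite on either side; a confidence $\kappa(e)\in[0,1]\cap\mathbb Q$; and a strict partial order $\prec$ on $\mathcal E$ (causality). A *query* $Q$ is a finite conjunction of atoms and causal chains, together with a list $x_1,\dots,x_r$ of output variables. Terms are variables or constants naming a vertex or a hyperedge. The atoms are: "$z$ is a hyperedge with participant array $(t_1,\dots,t_k)$"; "$t$ is a participant of the hyperedge $z$"; "the vertex $t$ (the hyperedge $z$) has property $p$"; "$\tau_v(z)$ is contained in / contains / meets $[a,b]$" for a bounded window $[a,b]$, $a\le b$ in $\mathbb Q$; and "$\kappa(z)\ge\theta$", "$\kappa(z)>\theta$" for a threshold $\theta\in\mathbb Q$. A *causal chain* of depth $k$ is a condition $z_0\prec z_1\prec\dots\prec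 z_k$ on hyperedge terms. A *match* of $Q$ in $\mathcal H$ is a map of the variables of $Q$ to vertices and hyperedges of $\mathcal H$ that satisfies all atoms and chains (it need not be injective); the answer set $Q(\mathcal H)$ is the set of the tuples $(\nu(x_1),\dots,\nu(x_r))$ over all matches $\nu$. A finite family of sets is *$\alpha$-acyclic* if it has a join tree (equivalently, a join forest): a forest on the members of the family such that, for every point $x$, the members containing $x$ induce a connected subgraph. For constants $c,d\in\mathbb N$ let $\mathcal Q_{c,d}$ be the class of the queries in which every causal chain has depth at most $d$ and for which one can set aside at most $c$ of the chains so that the variable sets of all atoms and of the remaining chains form an $\alpha$-acyclic family. (So $\mathcal Q_{c,d}$ contains every query whose atoms form an $\alpha$-acyclic pattern and which has at most $c$ chains, each of depth at most $d$, and any number of chains of depth at most $d$ is allowed if they keep the pattern $\alpha$-acyclic.) Then, for all constants $c,d$, query evaluation for $\mathcal Q_{c,d}$ is in PTIME in combined complexity: there is a Turing machine that, given the standard encoding (numbers in binary) of an attributed temporal causal hypergraph $\mathcal H$, a query $Q$ and a tuple $t$, decides in time polynomial in the length of the input whether $Q\in\mathcal Q_{c,d}$ and $t\in Q(\mathcal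 H)$. -/

import Mathlib

/-! Attributed temporal causal hypergraphs, conjunctive queries over them, and a binary encoding. -/

namespace Atch

/-- A property: a key together with its value, both strings over `{0,1}`. -/
abbrev Property := List Bool × List Bool

/-- A non-empty closed interval of time points; an end that is `none` is infinite. -/
structure Interval where
  lower : Option ℚ
  upper : Option ℚ
  ordered : ∀ a ∈ lower, ∀ b ∈ upper, a ≤ b

/-- The time points of an interval. -/
def Interval.points (I : Interval) : Set ℚ :=
  {t | (∀ a ∈ I.lower, a ≤ t) ∧ (∀ b ∈ I.upper, t ≤ b)}

/-- An attributed temporal causal hypergraph. The vertices are `Fin numV`. The hyperedges have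
the identities `Fin numE`; each has a non-empty array of participants (position = role), which are
vertices or other hyperedges, and the nesting of hyperedges is well-founded. -/
structure Hypergraph where
  numV : ℕ
  numE : ℕ
  nodes : Fin numE → List (Fin numV ⊕ Fin numE)
  nodes_nonempty : ∀ e, nodes e ≠ []
  nesting_wf : WellFounded fun f e : Fin numE => Sum.inr f ∈ nodes e
  vertexAttr : Fin numV → List Property
  edgeAttr : Fin numE → List Property
  validTime : Fin numE → Interval
  transTime : Fin numE → Interval
  conf : Fin numE → ℚ
  conf_mem : ∀ e, conf e ∈ Set.Icc (0 : ℚ) 1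
  /-- the causal order: `prec e f` means that `e` is a cause of `f` -/
  prec : Fin numE → Fin numE → Bool
  prec_irrefl : ∀ e, prec e e = false
  prec_trans : ∀ e f g, prec e f = true → prec f g = true → prec e g = true

/-- Names of objects: `inl i` names the `i`-th vertex, `inr j` the `j`-th hyperedge. -/
abbrev Obj := ℕ ⊕ ℕ

/-- The name of a vertex or hyperedge. -/
def Hypergraph.name (H : Hypergraph) : Fin H.numV ⊕ Fin H.numE → Obj :=
  Sum.map Fin.val Fin.val

/-- The set of hyperedges and vertices of `H`, by name. -/
def Hypergraph.objects (H : Hypergraph) : Set Obj := Set.range H.name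

/-- A term of a query is a variable or a constant. -/
inductive Term where
  | var (x : ℕ)
  | const (o : Obj)

def Term.vars : Term → Finset ℕ
  | .var x => {x}
  | .const _ => ∅

def Term.val (ν : ℕ → Obj) : Term → Obj
  | .var x => ν x
  | .const o => o

/-- A bounded time window. -/
structure Window where
  lo : ℚ
  hi : ℚ
  ordered : lo ≤ hi

/-- The range predicates that compare a valid time with a window. -/
inductive RangePred where
  | within
  | covers
  | overlaps

def RangePred.Holds (r : RangePred) (I : Interval) (W : Window) : Prop :=
  match r with
  | .within => I.points ⊆ Set.Icc W.lo W.hi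
  | .covers => Set.Icc W.lo W.hi ⊆ I.points
  | .overlaps => (I.points ∩ Set.Icc W.lo W.hi).Nonempty

/-- Atoms of a query. -/
inductive Atom where
  /-- `z` is a hyperedge whose array of participants is `ts` -/
  | hyperedge (z : Term) (ts : List Term)
  /-- `z` is a hyperedge and `t` is one of its participants -/
  | participant (t z : Term)
  /-- `t` is a vertex with property `p` -/
  | vertexAttr (t : Term) (p : Property)
  /-- `z` is a hyperedge with property `p` -/
  | edgeAttr (z : Term) (p : Property)
  /-- `z` is a hyperedge whose valid time stands in relation `r` to the window `W` -/
  | window (z : Term) (r : RangePred) (W : Window)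
  /-- `z` is a hyperedge of confidence at least `θ` -/
  | confGe (z : Term) (θ : ℚ)
  /-- `z` is a hyperedge of confidence greater than `θ` -/
  | confGt (z : Term) (θ : ℚ)

/-- The set of variables of a list of terms. -/
def termVars (ts : List Term) : Finset ℕ := ts.foldr (fun t s => t.vars ∪ s) ∅

def Atom.vars : Atom → Finset ℕ
  | .hyperedge z ts => z.vars ∪ termVars ts
  | .participant t z => t.vars ∪ z.vars
  | .vertexAttr t _ => t.vars
  | .edgeAttr z _ => z.vars
  | .window z _ _ => z.vars
  | .confGe z _ => z.vars
  | .confGt z _ => z.vars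

def Atom.Holds (H : Hypergraph) (ν : ℕ → Obj) : Atom → Prop
  | .hyperedge z ts =>
      ∃ e : Fin H.numE, z.val ν = H.name (.inr e) ∧ ts.map (Term.val ν) = (H.nodes e).map H.name
  | .participant t z =>
      ∃ e : Fin H.numE, z.val ν = H.name (.inr e) ∧ ∃ o ∈ H.nodes e, t.val ν = H.name o
  | .vertexAttr t p =>
      ∃ v : Fin H.numV, t.val ν = H.name (.inl v) ∧ p ∈ H.vertexAttr v
  | .edgeAttr z p =>
      ∃ e : Fin H.numE, z.val ν = H.name (.inr e) ∧ p ∈ H.edgeAttr e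
  | .window z r W =>
      ∃ e : Fin H.numE, z.val ν = H.name (.inr e) ∧ r.Holds (H.validTime e) W
  | .confGe z θ =>
      ∃ e : Fin H.numE, z.val ν = H.name (.inr e) ∧ θ ≤ H.conf e
  | .confGt z θ =>
      ∃ e : Fin H.numE, z.val ν = H.name (.inr e) ∧ θ < H.conf e

/-- The chain `z₀, …, z_k` holds if the terms denote hyperedges with `z₀ ≺ z₁ ≺ ⋯ ≺ z_k`. -/
def ChainHolds (H : Hypergraph) (ν : ℕ → Obj) (zs : List Term) : Prop :=
  ∃ es : List (Fin H.numE), zs.map (Term.val ν) = es.map (fun e => H.name (.inr e)) ∧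
    es.IsChain (fun e f => H.prec e f = true)

/-- A conjunctive query: atoms, causal chains (each the list of its hyperedge terms) and output
variables. All other variables are existentially quantified. -/
structure Query where
  atoms : List Atom
  chains : List (List Term)
  output : List ℕ

def Query.vars (Q : Query) : Finset ℕ :=
  Q.atoms.foldr (fun a s => a.vars ∪ s) ∅ ∪ Q.chains.foldr (fun c s => termVars c ∪ s) ∅ ∪
    Q.output.toFinset

/-- `ν` is a match of `Q` in `H`. -/
structure Query.IsMatch (Q : Query) (H : Hypergraph) (ν : ℕ → Obj) : Prop where
  objects : ∀ x ∈ Q.vars, ν x ∈ H.objects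
  atoms : ∀ a ∈ Q.atoms, a.Holds H ν
  chains : ∀ zs ∈ Q.chains, ChainHolds H ν zs

/-- The answers of `Q` on `H`. -/
def Query.answers (Q : Query) (H : Hypergraph) : Set (List Obj) :=
  {t | ∃ ν, Q.IsMatch H ν ∧ t = Q.output.map ν}

/-- A finite family of finite sets is α-acyclic if it has a join tree: a forest on the members of
the family in which, for every point `x`, the members that contain `x` are connected. (The
components of such a forest can be linked up to a tree.) -/
def AlphaAcyclic (es : List (Finset ℕ)) : Prop :=
  ∃ T : SimpleGraph (Fin es.length), T.IsAcyclic ∧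
    ∀ x : ℕ, (T.induce {i | x ∈ es.get i}).Preconnected

/-- The tractable class: every causal chain has depth at most `d`, that is, at most `d` links; and
up to at most `c` chains (`free`), which may join the pattern in an arbitrary way, the variable
sets of the atoms and of the chains (`tied`) form an α-acyclic hypergraph. -/
def Query.Tractable (c d : ℕ) (Q : Query) : Prop :=
  (∀ zs ∈ Q.chains, zs.length ≤ d + 1) ∧
    ∃ free tied : List (List Term), Q.chains.Perm (free ++ tied) ∧ free.length ≤ c ∧
      AlphaAcyclic (Q.atoms.map Atom.vars ++ tied.map termVars)

/-- An input of the evaluation problem: a hypergraph, a query and a candidate answer. -/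
structure Instance where
  db : Hypergraph
  query : Query
  tuple : List Obj

open Classical in
/-- The evaluation problem for the tractable class, as a decision problem on all inputs. -/
noncomputable def evaluation (c d : ℕ) (x : Instance) : Bool :=
  decide (x.query.Tractable c d ∧ x.tuple ∈ x.query.answers x.db)

/-! The encoding: numbers are written in binary, everything else by nested brackets. -/

inductive Sym where
  | lpar
  | rpar
  | zero
  | one

def group (parts : List (List Sym)) : List Sym := .lpar :: (parts.flatten ++ [.rpar])

def encBits (l : List Bool) : List Sym := group [l.map fun b => if b then .one else .zero]

def encNat (n : ℕ) : List Sym := encBits n.bits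

def encRat (q : ℚ) : List Sym :=
  group [encBits [decide (q < 0)], encNat q.num.natAbs, encNat q.den]

def encList {α : Type} (f : α → List Sym) (l : List α) : List Sym := group (l.map f)

def encFun {α : Type} {n : ℕ} (f : α → List Sym) (g : Fin n → α) : List Sym :=
  encList f (List.ofFn g)

def encOption {α : Type} (f : α → List Sym) (o : Option α) : List Sym := encList f o.toList

def encObj : Obj → List Sym
  | .inl i => group [encBits [false], encNat i]
  | .inr j => group [encBits [true], encNat j]

def encProperty (p : Property) : List Sym := group [encBits p.1, encBits p.2]

def encInterval (I : Interval) : List Sym :=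
  group [encOption encRat I.lower, encOption encRat I.upper]

def encHypergraph (H : Hypergraph) : List Sym :=
  group [encFun (encList encProperty) H.vertexAttr,
    encFun (encList fun o => encObj (H.name o)) H.nodes,
    encFun (encList encProperty) H.edgeAttr,
    encFun encInterval H.validTime,
    encFun encInterval H.transTime,
    encFun encRat H.conf,
    encFun (fun row => encBits (List.ofFn row)) H.prec]

def encTerm : Term → List Sym
  | .var x => group [encBits [false], encNat x]
  | .const o => group [encBits [true], encObj o]

def encRangePred : RangePred → List Sym
  | .within => encNat 0
  | .covers => encNat 1
  | .overlaps => encNat 2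

def encAtom : Atom → List Sym
  | .hyperedge z ts => group [encNat 0, encTerm z, encList encTerm ts]
  | .participant t z => group [encNat 1, encTerm t, encTerm z]
  | .vertexAttr t p => group [encNat 2, encTerm t, encProperty p]
  | .edgeAttr z p => group [encNat 3, encTerm z, encProperty p]
  | .window z r W =>
      group [encNat 4, encTerm z, encRangePred r, encRat W.lo, encRat W.hi]
  | .confGe z θ => group [encNat 5, encTerm z, encRat θ]
  | .confGt z θ => group [encNat 6, encTerm z, encRat θ]

def encQuery (Q : Query) : List Sym :=
  group [encList encAtom Q.atoms, encList (encList encTerm) Q.chains, encList encNat Q.output]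

def encInstance (x : Instance) : List Sym :=
  group [encHypergraph x.db, encQuery x.query, encList encObj x.tuple]

end Atch

/-!
A query is evaluated by joins over a tree. An atom or a chain is represented by the finite list of
the systems of equations `x = o` on its variables that satisfy it; a chain of depth at most `d`
has only polynomially many of them. One tries all choices of at most `c` chains to set aside and
all ways to satisfy these chains, and then decides whether the remaining variable sets are
`α`-acyclic by removing ears and whether the remaining relations have a common solution by pruning
them until they are pairwise consistent. Pairwise consistency suffices on an acyclic family: all
variables that an ear shares with the rest of the family lie in one other member, so a solution of
the rest extends over the ear.

For the time bound, functions on binary trees that are computed by structured stack programs in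
polynomial time are closed under composition, case distinction and bounded iteration over lists.
Since the algorithm is built by these operations, its machine need not be written down.
-/

/-! ### Structured programs on finitely many stacks -/

open Turing

/-- Structured programs acting on a family of stacks indexed by `K`, where the stack `k` has the
alphabet `Γ k`. A condition `c` of `ite k c` or `loop k c` reads the top of the stack `k`. -/
inductive StackProg {K : Type} (Γ : K → Type) where
  | skip
  | push (k : K) (g : Γ k)
  | pop (k : K)
  | seq (p q : StackProg Γ)
  | ite (k : K) (c : Option (Γ k) → Bool) (p q : StackProg Γ)
  | loop (k : K) (c : Option (Γ k) → Bool) (p : StackProg Γ)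

namespace StackProg

section Semantics

variable {K : Type} {Γ : K → Type} [DecidableEq K]

/-- `Run p S t S'`: started on the stacks `S`, the program `p` stops within `t` steps with the
stacks `S'`. Every elementary command and every test of a condition takes one step. -/
inductive Run : StackProg Γ → (∀ k, List (Γ k)) → ℕ → (∀ k, List (Γ k)) → Prop
  | skip (S) : Run .skip S 1 S
  | push (k g S) : Run (.push k g) S 1 (Function.update S k (g :: S k))
  | pop (k S) : Run (.pop k) S 1 (Function.update S k (S k).tail)
  | seq {p q S t S' t' S''} : Run p S t S' → Run q S' t' S'' → Run (.seq p q) S (t + t') S''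
  | iteTrue {k c p q S t S'} : c (S k).head? = true → Run p S t S' →
      Run (.ite k c p q) S (1 + t) S'
  | iteFalse {k c p q S t S'} : c (S k).head? = false → Run q S t S' →
      Run (.ite k c p q) S (1 + t) S'
  | loopTrue {k c p S t S' t' S''} : c (S k).head? = true → Run p S t S' →
      Run (.loop k c p) S' t' S'' → Run (.loop k c p) S (1 + t + t') S''
  | loopFalse {k c p S} : c (S k).head? = false → Run (.loop k c p) S 1 S
  | mono {p S t t' S'} : Run p S t S' → t ≤ t' → Run p S t' S'

theorem Run.push_of_eq {k : K} {g : Γ k} {S S' : ∀ k, List (Γ k)}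
    (h : Function.update S k (g :: S k) = S') : Run (.push k g) S 1 S' :=
  h ▸ .push k g S

theorem Run.pop_of_eq {k : K} {S S' : ∀ k, List (Γ k)}
    (h : Function.update S k (S k).tail = S') : Run (.pop k) S 1 S' :=
  h ▸ .pop k S

theorem Run.size_le {p : StackProg Γ} {S S' : ∀ k, List (Γ k)} {t : ℕ} (h : Run p S t S')
    (k : K) : (S' k).length ≤ (S k).length + t := by
  induction h with
  | push k' | pop k' =>
    rcases eq_or_ne k k' with rfl | hk
    · simp <;> omega
    · simp [hk]
  | _ => omega

/-- Push the word `w` onto the stack `k`. -/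
def pushWord (k : K) : List (Γ k) → StackProg Γ
  | [] => .skip
  | g :: w => .seq (pushWord k w) (.push k g)

theorem run_pushWord (k : K) (w : List (Γ k)) (S : ∀ k, List (Γ k)) :
    Run (pushWord k w) S (w.length + 1) (Function.update S k (w ++ S k)) := by
  induction w with
  | nil => simpa [pushWord] using Run.skip S
  | cons g w ih => exact (ih.seq (.push_of_eq (by simp))).mono (by simp)

/-- Run the program `p g` if the top of the stack `k` is the symbol `g`, for `g` in the list. -/
def caseTop (k : K) [DecidableEq (Γ k)] (p : Γ k → StackProg Γ) : List (Γ k) → StackProg Γ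
  | [] => .skip
  | g :: l => .ite k (· == some g) (p g) (caseTop k p l)

theorem run_caseTop {k : K} [DecidableEq (Γ k)] {p : Γ k → StackProg Γ} {g : Γ k}
    {l : List (Γ k)} {S S' : ∀ k, List (Γ k)} {t : ℕ} (hg : g ∈ l)
    (htop : (S k).head? = some g) (h : Run (p g) S t S') :
    Run (caseTop k p l) S (l.length + t) S' := by
  induction l with
  | nil => simp at hg
  | cons a l ih =>
    by_cases ha : g = a
    · subst ha
      exact (Run.iteTrue (by simp [htop]) h).mono (by simp)
    · exact (Run.iteFalse (by simpa [htop] using ha)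
        (ih (List.mem_of_ne_of_mem ha hg))).mono (by simp; omega)

/-- Empty the stack `k₀`, pushing the word `f g` onto the stack `k₁` for each of its symbols. -/
noncomputable def transfer (k₀ k₁ : K) [Fintype (Γ k₀)] [DecidableEq (Γ k₀)]
    (f : Γ k₀ → List (Γ k₁)) : StackProg Γ :=
  .loop k₀ Option.isSome
    (.seq (caseTop k₀ (fun g => pushWord k₁ (f g)) Finset.univ.toList) (.pop k₀))

theorem run_transfer {k₀ k₁ : K} [Fintype (Γ k₀)] [DecidableEq (Γ k₀)] (hk : k₀ ≠ k₁)
    {f : Γ k₀ → List (Γ k₁)} {n : ℕ} (hn : ∀ g, (f g).length ≤ n) {l : List (Γ k₀)}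
    {S : ∀ k, List (Γ k)} (hl : S k₀ = l) :
    Run (transfer k₀ k₁ f) S ((Fintype.card (Γ k₀) + n + 3) * l.length + 1)
      (Function.update (Function.update S k₀ []) k₁ (l.reverse.flatMap f ++ S k₁)) := by
  induction l generalizing S with
  | nil =>
    have unchanged : Function.update (Function.update S k₀ []) k₁ (S k₁) = S := by
      rw [← hl, Function.update_eq_self, Function.update_eq_self]
    simpa [unchanged, transfer] using Run.loopFalse (c := Option.isSome) (by simp [hl])
  | cons g l ih =>
    set S₁ := Function.update S k₁ (f g ++ S k₁) with hS₁
    have pushTop : Run (caseTop k₀ (fun g => pushWord k₁ (f g)) Finset.univ.toList) S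
        (Fintype.card (Γ k₀) + (n + 1)) S₁ :=
      (run_caseTop (by simp) (by simp [hl]) (run_pushWord k₁ (f g) S)).mono
        (by simpa [Finset.card_univ] using hn g)
    have popTop : Run (.pop k₀) S₁ 1 (Function.update S₁ k₀ l) :=
      .pop_of_eq (by simp [hS₁, hk, hl])
    have rest := ih (S := Function.update S₁ k₀ l) (by simp)
    have final : Function.update (Function.update (Function.update S₁ k₀ l) k₀ []) k₁
        (l.reverse.flatMap f ++ Function.update S₁ k₀ l k₁) =
        Function.update (Function.update S k₀ []) k₁ ((g :: l).reverse.flatMap f ++ S k₁) := by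
      funext k
      by_cases h₁ : k = k₁
      · subst h₁
        simp [hS₁, hk.symm]
      · by_cases h₀ : k = k₀
        · subst h₀
          simp [hk]
        · simp [hS₁, h₀, h₁]
    rw [final] at rest
    exact (Run.loopTrue (by simp [hl]) (pushTop.seq popTop) rest).mono
      (by simp only [List.length_cons]; ring_nf; omega)

end Semantics

section Compilation

variable {K : Type} {Γ : K → Type}

/-- The control points of a program. -/
def Label : StackProg Γ → Type
  | .skip | .push _ _ | .pop _ => Unit
  | .seq p q => p.Label ⊕ q.Label
  | .ite _ _ p q => Option (p.Label ⊕ q.Label)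
  | .loop _ _ p => Option p.Label

instance finite_label (p : StackProg Γ) : Finite p.Label := by
  induction p <;> unfold Label <;> infer_instance

/-- The control point at which a program starts. -/
def start : (p : StackProg Γ) → p.Label
  | .skip | .push _ _ | .pop _ => ()
  | .seq p _ => Sum.inl p.start
  | .ite _ _ _ _ | .loop _ _ _ => none

variable {Λ : Type}

/-- Continue at the label `l`. The Boolean state of the machine is only used to branch, and is
`false` between two steps. -/
def jump (l : Λ) : TM2.Stmt Γ Λ Bool := .load (fun _ => false) (.goto fun _ => l)

/-- Continue at `l₁` or at `l₂`, depending on the top of the stack `k`. -/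
def branchTo (k : K) (c : Option (Γ k) → Bool) (l₁ l₂ : Λ) : TM2.Stmt Γ Λ Bool :=
  .peek k (fun _ o => c o) (.branch id (jump l₁) (jump l₂))

/-- The machine statement at a control point of a program whose control points are embedded by
`emb` into the labels of a machine and which continues at the label `exit`. -/
def stmt : (p : StackProg Γ) → (p.Label → Λ) → Λ → p.Label → TM2.Stmt Γ Λ Bool
  | .skip, _, exit, _ => jump exit
  | .push k g, _, exit, _ => .push k (fun _ => g) (jump exit)
  | .pop k, _, exit, _ => .pop k (fun v _ => v) (jump exit)
  | .seq p q, emb, exit, l =>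
    match l with
    | .inl l => p.stmt (fun l => emb (.inl l)) (emb (.inr q.start)) l
    | .inr l => q.stmt (fun l => emb (.inr l)) exit l
  | .ite k c p q, emb, exit, l =>
    match l with
    | none => branchTo k c (emb (some (.inl p.start))) (emb (some (.inr q.start)))
    | some (.inl l) => p.stmt (fun l => emb (some (.inl l))) exit l
    | some (.inr l) => q.stmt (fun l => emb (some (.inr l))) exit l
  | .loop k c p, emb, exit, l =>
    match l with
    | none => branchTo k c (emb (some p.start)) exit
    | some l => p.stmt (fun l => emb (some l)) (emb none) l

/-- The code of a program: the machine halts where the program ends. -/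
def code (p : StackProg Γ) : Option p.Label → TM2.Stmt Γ (Option p.Label) Bool
  | none => .halt
  | some l => p.stmt some none l

/-- The machine of a program, with input stack `k₀` and output stack `k₁`. -/
noncomputable def machine [DecidableEq K] [Fintype K] (p : StackProg Γ) (k₀ k₁ : K)
    [Fintype (Γ k₀)] : FinTM2 :=
  haveI : Fintype (Option p.Label) := Fintype.ofFinite _
  { K := K, k₀ := k₀, k₁ := k₁, Γ := Γ, Λ := Option p.Label, main := some p.start, σ := Bool,
    initialState := false, m := p.code }

variable [DecidableEq K] {M : Λ → TM2.Stmt Γ Λ Bool}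

/-- Within `t` steps the machine with code `M` gets from the label `l` and the stacks `S` to the
label `l'` and the stacks `S'`. -/
def Reaches (M : Λ → TM2.Stmt Γ Λ Bool) (l : Λ) (S : ∀ k, List (Γ k)) (t : ℕ) (l' : Λ)
    (S' : ∀ k, List (Γ k)) : Prop :=
  Nonempty (StateTransition.EvalsToInTime (TM2.step M) ⟨some l, false, S⟩
    (some ⟨some l', false, S'⟩) t)

namespace Reaches

variable {l l' l'' : Λ} {S S' S'' : ∀ k, List (Γ k)} {t t' : ℕ}

theorem trans (h : Reaches M l S t l' S') (h' : Reaches M l' S' t' l'' S'') :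
    Reaches M l S (t + t') l'' S'' := by
  obtain ⟨e⟩ := h
  obtain ⟨e'⟩ := h'
  exact ⟨Nat.add_comm t' t ▸ e.trans _ _ _ _ _ _ e'⟩

theorem mono (h : Reaches M l S t l' S') (ht : t ≤ t') : Reaches M l S t' l' S' :=
  h.map fun e => ⟨e.toEvalsTo, e.steps_le_m.trans ht⟩

theorem of_stepAux (h : TM2.stepAux (M l) false S = ⟨some l', false, S'⟩) :
    Reaches M l S 1 l' S' :=
  ⟨⟨⟨1, congrArg some h⟩, le_rfl⟩⟩

theorem branch {k : K} {c : Option (Γ k) → Bool} {l₁ l₂ : Λ} (h : M l = branchTo k c l₁ l₂) :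
    Reaches M l S 1 (bif c (S k).head? then l₁ else l₂) S := by
  refine of_stepAux ?_
  cases hc : c (S k).head? <;> simp [h, branchTo, jump, TM2.stepAux, hc]

theorem branch_true {k : K} {c : Option (Γ k) → Bool} {l₁ l₂ : Λ} (h : M l = branchTo k c l₁ l₂)
    (hc : c (S k).head? = true) : Reaches M l S 1 l₁ S := by
  simpa [hc] using branch (S := S) h

theorem branch_false {k : K} {c : Option (Γ k) → Bool} {l₁ l₂ : Λ}
    (h : M l = branchTo k c l₁ l₂) (hc : c (S k).head? = false) : Reaches M l S 1 l₂ S := by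
  simpa [hc] using branch (S := S) h

end Reaches

theorem Run.reaches {p : StackProg Γ} {S S' : ∀ k, List (Γ k)} {t : ℕ} (h : Run p S t S')
    (emb : p.Label → Λ) (exit : Λ) (hM : ∀ l, M (emb l) = p.stmt emb exit l) :
    Reaches M (emb p.start) S t exit S' := by
  induction h generalizing exit with
  | skip | push | pop =>
    exact .of_stepAux (by simp only [hM, stmt, jump, TM2.stepAux])
  | seq _ _ ih₁ ih₂ =>
    exact (ih₁ (fun l => emb (.inl l)) _ fun l => hM (.inl l)).trans
      (ih₂ (fun l => emb (.inr l)) exit fun l => hM (.inr l))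
  | iteTrue hc _ ih =>
    exact (Reaches.branch_true (hM none) hc).trans
      (ih (fun l => emb (some (.inl l))) exit fun l => hM (some (.inl l)))
  | iteFalse hc _ ih =>
    exact (Reaches.branch_false (hM none) hc).trans
      (ih (fun l => emb (some (.inr l))) exit fun l => hM (some (.inr l)))
  | loopTrue hc _ _ ih₁ ih₂ =>
    exact ((Reaches.branch_true (hM none) hc).trans
      (ih₁ (fun l => emb (some l)) (emb none) fun l => hM (some l))).trans (ih₂ emb exit hM)
  | loopFalse hc => exact .branch_false (hM none) hc
  | mono _ hle ih => exact (ih emb exit hM).mono hle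

theorem Run.evalsToInTime {p : StackProg Γ} {S S' : ∀ k, List (Γ k)} {t : ℕ} (h : Run p S t S') :
    Nonempty (StateTransition.EvalsToInTime (TM2.step p.code) ⟨some (some p.start), false, S⟩
      (some ⟨none, false, S'⟩) (t + 1)) := by
  obtain ⟨e⟩ := h.reaches (M := p.code) some none fun _ => rfl
  exact ⟨Nat.add_comm 1 t ▸ e.trans _ _ _ _ _ _ ⟨⟨1, rfl⟩, le_rfl⟩⟩

end Compilation

end StackProg

/-! ### Binary trees on a stack -/

open scoped BinaryTree

namespace StackProg

/-- The prefix code of a binary tree, by which trees are stored on stacks. -/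
def treeBits : BinaryTree Unit → List Bool
  | .nil => [false]
  | .node _ a b => true :: (treeBits a ++ treeBits b)

/-- The stacks of a program on trees: the data stack holds the codes of a sequence of trees, and
the other stacks serve to copy and exchange trees. -/
inductive Work where
  | data
  | bufA
  | bufB
  | counter
  deriving DecidableEq

instance : Fintype Work :=
  ⟨{.data, .bufA, .bufB, .counter}, fun k => by cases k <;> decide⟩

/-- Programs on trees. -/
abbrev TreeProg := StackProg fun _ : Work => Bool

open Work

/-- The stacks with the given contents. -/
def contents (m a b c : List Bool) : Work → List Bool
  | .data => m
  | .bufA => a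
  | .bufB => b
  | .counter => c

/-- The stacks between two operations on trees: only the data stack is in use. -/
abbrev onData (m : List Bool) : Work → List Bool := contents m [] [] []

section Contents

variable (m a b c x : List Bool)

@[simp] theorem contents_data : contents m a b c data = m := rfl
@[simp] theorem contents_bufA : contents m a b c bufA = a := rfl
@[simp] theorem contents_bufB : contents m a b c bufB = b := rfl
@[simp] theorem contents_counter : contents m a b c counter = c := rfl

@[simp] theorem update_contents_data :
    Function.update (contents m a b c) data x = contents x a b c := by
  funext k; cases k <;> rfl

@[simp] theorem update_contents_bufA :
    Function.update (contents m a b c) bufA x = contents m x b c := by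
  funext k; cases k <;> rfl

@[simp] theorem update_contents_bufB :
    Function.update (contents m a b c) bufB x = contents m a x c := by
  funext k; cases k <;> rfl

@[simp] theorem update_contents_counter :
    Function.update (contents m a b c) counter x = contents m a b x := by
  funext k; cases k <;> rfl

end Contents

/-- Push a bit onto the chosen buffers. -/
def pushBufs (toA toB g : Bool) : TreeProg :=
  .seq (if toA then .push bufA g else .skip) (if toB then .push bufB g else .skip)

theorem run_pushBufs (toA toB g : Bool) (m a b c : List Bool) :
    Run (pushBufs toA toB g) (contents m a b c) 2
      (contents m (if toA then g :: a else a) (if toB then g :: b else b) c) := by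
  refine .seq (t := 1) (t' := 1) (S' := contents m (if toA then g :: a else a) b c) ?_ ?_
  · cases toA
    exacts [.skip _, .push_of_eq (by simp)]
  · cases toB
    exacts [.skip _, .push_of_eq (by simp)]

/-- Move one tree off the data stack for every bit of the counter stack: each inner node pushes a
bit, since it leaves one more tree to be moved, and each leaf pops one. -/
def moveLoop (toA toB : Bool) : TreeProg :=
  .loop counter Option.isSome <|
    .ite data (· == some true)
      (.seq (.pop data) (.seq (pushBufs toA toB true) (.push counter true)))
      (.seq (.pop data) (.seq (pushBufs toA toB false) (.pop counter)))

/-- Move the tree on top of the data stack, with its code reversed, to the chosen buffers. -/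
def moveTree (toA toB : Bool) : TreeProg := .seq (.push counter true) (moveLoop toA toB)

theorem run_moveLoop {toA toB : Bool} {d : BinaryTree Unit} {m a b c : List Bool} {t : ℕ}
    {S : Work → List Bool}
    (h : Run (moveLoop toA toB) (contents m (if toA then (treeBits d).reverse ++ a else a)
      (if toB then (treeBits d).reverse ++ b else b) c) t S) :
    Run (moveLoop toA toB) (contents (treeBits d ++ m) a b (true :: c))
      (6 * (treeBits d).length + t) S := by
  induction d generalizing m a b c t with
  | nil =>
    refine .mono (.loopTrue (t := 5) (t' := t) rfl (.iteFalse (t := 4) rfl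
      (.seq (t := 1) (.pop_of_eq (update_contents_data ..)) (.seq (t := 2) (t' := 1)
        (run_pushBufs ..) (.pop_of_eq (update_contents_counter ..))))) ?_) (by simp [treeBits])
    simpa [treeBits, moveLoop] using h
  | node _ d e ihd ihe =>
    refine .mono (.loopTrue (t := 5)
      (t' := 6 * (treeBits d).length + (6 * (treeBits e).length + t)) rfl (.iteTrue (t := 4) rfl
      (.seq (t := 1) (.pop_of_eq (update_contents_data ..)) (.seq (t := 2) (t' := 1)
        (run_pushBufs ..) (.push_of_eq (update_contents_counter ..))))) ?_)
      (by simp [treeBits]; omega)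
    change Run (moveLoop toA toB) (contents ((treeBits d ++ treeBits e) ++ m) _ _ _) _ _
    rw [List.append_assoc]
    refine ihd (ihe ?_)
    convert h using 2
    · cases toA <;> simp [treeBits]
    · cases toB <;> simp [treeBits]

theorem run_moveTree (toA toB : Bool) (d : BinaryTree Unit) (m a b : List Bool) :
    Run (moveTree toA toB) (contents (treeBits d ++ m) a b []) (6 * (treeBits d).length + 2)
      (contents m (if toA then (treeBits d).reverse ++ a else a)
        (if toB then (treeBits d).reverse ++ b else b) []) :=
  .mono (.seq (t := 1) (.push_of_eq (update_contents_counter ..))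
    (run_moveLoop (.loopFalse rfl))) (by omega)

/-- Empty the stack `w` onto the data stack. -/
noncomputable def flush (w : Work) : TreeProg :=
  transfer (Γ := fun _ : Work => Bool) w data fun g => [g]

theorem run_flush_bufA (m a b c : List Bool) :
    Run (flush bufA) (contents m a b c) (6 * a.length + 1) (contents (a.reverse ++ m) [] b c) := by
  simpa [flush] using run_transfer (Γ := fun _ : Work => Bool) (k₀ := bufA) (k₁ := data) (by decide)
    (f := fun g => [g]) (n := 1) (by simp) (contents_bufA m a b c)

theorem run_flush_bufB (m a b c : List Bool) :
    Run (flush bufB) (contents m a b c) (6 * b.length + 1) (contents (b.reverse ++ m) a [] c) := by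
  simpa [flush] using run_transfer (Γ := fun _ : Work => Bool) (k₀ := bufB) (k₁ := data) (by decide)
    (f := fun g => [g]) (n := 1) (by simp) (contents_bufB m a b c)

/-- Duplicate the tree on top of the data stack. -/
noncomputable def dup : TreeProg := .seq (moveTree true true) (.seq (flush bufA) (flush bufB))

/-- Exchange the two trees on top of the data stack. -/
noncomputable def swap : TreeProg :=
  .seq (moveTree true false) (.seq (moveTree false true) (.seq (flush bufA) (flush bufB)))

/-- Remove the tree on top of the data stack. -/
def drop : TreeProg := moveTree false false

theorem run_dup (d : BinaryTree Unit) (m : List Bool) :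
    Run dup (onData (treeBits d ++ m)) (18 * (treeBits d).length + 4)
      (onData (treeBits d ++ (treeBits d ++ m))) := by
  have toBufs := run_moveTree true true d m [] []
  have fromA := run_flush_bufA m (treeBits d).reverse (treeBits d).reverse []
  have fromB := run_flush_bufB (treeBits d ++ m) [] (treeBits d).reverse []
  simp only [if_true, List.append_nil, List.reverse_reverse, List.length_reverse]
    at toBufs fromA fromB
  exact (toBufs.seq (fromA.seq fromB)).mono (by omega)

theorem run_swap (d e : BinaryTree Unit) (m : List Bool) :
    Run swap (onData (treeBits d ++ (treeBits e ++ m)))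
      (12 * (treeBits d).length + 12 * (treeBits e).length + 6)
      (onData (treeBits e ++ (treeBits d ++ m))) := by
  have toA := run_moveTree true false d (treeBits e ++ m) [] []
  have toB := run_moveTree false true e m (treeBits d).reverse []
  have fromA := run_flush_bufA m (treeBits d).reverse (treeBits e).reverse []
  have fromB := run_flush_bufB (treeBits d ++ m) [] (treeBits e).reverse []
  simp only [if_true, List.append_nil, List.reverse_reverse, List.length_reverse,
    Bool.false_eq_true, if_false] at toA toB fromA fromB
  exact (toA.seq (toB.seq (fromA.seq fromB))).mono (by omega)

theorem run_drop (d : BinaryTree Unit) (m : List Bool) :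
    Run drop (onData (treeBits d ++ m)) (6 * (treeBits d).length + 2) (onData m) :=
  run_moveTree false false d m [] []

end StackProg

/-! ### Polynomial-time functions -/

namespace StackProg

/-- Types whose elements are represented by binary trees. -/
class TreeCode (α : Type) where
  toTree : α → BinaryTree Unit

open TreeCode

instance : TreeCode (BinaryTree Unit) := ⟨id⟩
instance : TreeCode Bool := ⟨fun b => bif b then .nil △ .nil else .nil⟩

section Instances

variable {α β : Type} [TreeCode α] [TreeCode β]

instance : TreeCode (α × β) := ⟨fun x => toTree x.1 △ toTree x.2⟩
instance : TreeCode (List α) := ⟨fun l => l.foldr (fun a d => toTree a △ d) .nil⟩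
instance (p : α → Prop) : TreeCode {x // p x} := ⟨fun x => toTree x.1⟩

@[simp] theorem toTree_tree (x : BinaryTree Unit) : toTree x = x := rfl
@[simp] theorem toTree_true : toTree true = .nil △ .nil := rfl
@[simp] theorem toTree_false : toTree false = .nil := rfl
@[simp] theorem toTree_pair (a : α) (b : β) : toTree (a, b) = toTree a △ toTree b := rfl
@[simp] theorem toTree_nil : toTree ([] : List α) = .nil := rfl
@[simp] theorem toTree_cons (a : α) (l : List α) : toTree (a :: l) = toTree a △ toTree l := rfl

end Instances

variable {α β γ δ : Type} [TreeCode α] [TreeCode β] [TreeCode γ] [TreeCode δ]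

section Size

/-- The length of the code of an element. -/
def size (x : α) : ℕ := (treeBits (toTree x)).length

theorem size_eq (x : α) : size x = size (toTree x) := rfl
@[simp] theorem size_subtype {p : α → Prop} (x : {x // p x}) : size x = size x.1 := rfl
@[simp] theorem size_tree_node (a b : BinaryTree Unit) : size (a △ b) = size a + size b + 1 := by
  simp [size, treeBits]
@[simp] theorem size_true : size true = 3 := rfl
@[simp] theorem size_false : size false = 1 := rfl
theorem size_bool_le (b : Bool) : size b ≤ 3 := by cases b <;> simp
@[simp] theorem size_pair (a : α) (b : β) : size (a, b) = size a + size b + 1 := by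
  simp [size_eq (a, b), ← size_eq]
@[simp] theorem size_nil : size ([] : List α) = 1 := rfl
@[simp] theorem size_cons (a : α) (l : List α) : size (a :: l) = size a + size l + 1 := by
  simp [size_eq (a :: l), ← size_eq]

theorem size_pos (x : α) : 0 < size x := by
  unfold size
  cases toTree x <;> simp [treeBits]

theorem size_append (l l' : List α) : size (l ++ l') + 1 = size l + size l' := by
  induction l with
  | nil => simp [Nat.add_comm]
  | cons a l ih => simp only [List.cons_append, size_cons]; omega

theorem size_le_of_mem {a : α} {l : List α} (h : a ∈ l) : size a ≤ size l := by
  obtain ⟨l₁, l₂, rfl⟩ := List.append_of_mem h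
  have := size_append l₁ (a :: l₂)
  have := size_pos l₁
  simp only [size_cons] at *
  omega

theorem length_le_size (l : List α) : l.length ≤ size l := by
  induction l with
  | nil => simp
  | cons a l ih => simp only [List.length_cons, size_cons]; omega

theorem size_le_of_sublist {l k : List α} (h : l.Sublist k) : size l ≤ size k := by
  induction h with
  | slnil => exact le_rfl
  | cons a _ ih => simp only [size_cons]; omega
  | cons_cons a _ ih => simp only [size_cons]; omega

theorem size_map_le {f : α → α} (hf : ∀ a, size (f a) ≤ size a) (l : List α) :
    size (l.map f) ≤ size l := by
  induction l with
  | nil => exact le_rfl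
  | cons a l ih =>
    simp only [List.map_cons, size_cons]
    have := hf a
    omega

end Size

section PolyBounded

/-- The natural number `t x` is bounded by a polynomial in the size of `x`. -/
@[fun_prop]
def PolyBounded (t : α → ℕ) : Prop := ∃ p : Polynomial ℕ, ∀ x, t x ≤ p.eval (size x)

theorem monotone_eval (p : Polynomial ℕ) : Monotone fun n => p.eval n := by
  intro m n h
  induction p using Polynomial.induction_on' with
  | add p q hp hq => simpa using add_le_add hp hq
  | monomial k a => simpa using Nat.mul_le_mul_left a (Nat.pow_le_pow_left h k)

namespace PolyBounded

variable {s t : α → ℕ}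

theorem mono (h : PolyBounded t) (hle : ∀ x, s x ≤ t x) : PolyBounded s :=
  let ⟨p, hp⟩ := h
  ⟨p, fun x => (hle x).trans (hp x)⟩

@[fun_prop]
theorem const (n : ℕ) : PolyBounded fun _ : α => n := ⟨.C n, by simp⟩

theorem size_self : PolyBounded fun x : α => size x := ⟨.X, by simp⟩

@[fun_prop]
theorem add (hs : PolyBounded s) (ht : PolyBounded t) : PolyBounded fun x => s x + t x :=
  let ⟨p, hp⟩ := hs
  let ⟨q, hq⟩ := ht
  ⟨p + q, fun x => by simpa using add_le_add (hp x) (hq x)⟩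

@[fun_prop]
theorem mul (hs : PolyBounded s) (ht : PolyBounded t) : PolyBounded fun x => s x * t x :=
  let ⟨p, hp⟩ := hs
  let ⟨q, hq⟩ := ht
  ⟨p * q, fun x => by simpa using Nat.mul_le_mul (hp x) (hq x)⟩

@[fun_prop]
theorem eval (p : Polynomial ℕ) (ht : PolyBounded t) : PolyBounded fun x => p.eval (t x) :=
  let ⟨q, hq⟩ := ht
  ⟨p.comp q, fun x => by
    rw [Polynomial.eval_comp]
    exact monotone_eval p (hq x)⟩

theorem comp {u : β → ℕ} {f : α → β} (hu : PolyBounded u) (hf : PolyBounded fun x => size (f x)) :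
    PolyBounded fun x => u (f x) :=
  let ⟨p, hp⟩ := hu
  (eval p hf).mono fun x => hp (f x)

end PolyBounded

end PolyBounded

/-- The stacks with the code of `x` on top of the data `m`. -/
abbrev onTop (x : α) (m : List Bool) : Work → List Bool := onData (treeBits (toTree x) ++ m)

/-- Functions computed by a program that replaces the code of the argument on top of the data
stack by the code of the value, in a number of steps that is polynomial in the size of the
argument. -/
@[fun_prop]
def PolyTime (f : α → β) : Prop :=
  ∃ (P : TreeProg) (t : α → ℕ), PolyBounded t ∧
    ∀ x m, Run P (onTop x m) (t x) (onTop (f x) m)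

@[fun_prop]
theorem PolyTime.size_bounded {f : α → β} (h : PolyTime f) : PolyBounded fun x => size (f x) := by
  obtain ⟨P, t, ht, hP⟩ := h
  refine (PolyBounded.size_self.add ht).mono fun x => ?_
  simpa [size] using (hP x []).size_le .data

/-- Case distinction on a list. -/
def listCase {β γ : Type} (l : List β) (z : γ) (s : β → List β → γ) : γ :=
  match l with
  | [] => z
  | b :: k => s b k

@[simp] theorem listCase_nil {β γ : Type} (z : γ) (s : β → List β → γ) :
    listCase [] z s = z := rfl

@[simp] theorem listCase_cons {β γ : Type} (b : β) (k : List β) (z : γ) (s : β → List β → γ) :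
    listCase (b :: k) z s = s b k := rfl

namespace PolyTime

theorem of_toTree_eq {f : α → β} {g : α → γ} (hg : PolyTime g)
    (h : ∀ x, toTree (f x) = toTree (g x)) : PolyTime f := by
  obtain ⟨P, t, ht, hP⟩ := hg
  exact ⟨P, t, ht, fun x m => by simpa only [onTop, h] using hP x m⟩

@[fun_prop]
theorem id : PolyTime fun x : α => x :=
  ⟨.skip, fun _ => 1, .const 1, fun _ _ => .skip _⟩

@[fun_prop]
theorem comp {f : β → γ} {g : α → β} (hf : PolyTime f) (hg : PolyTime g) :
    PolyTime fun x => f (g x) := by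
  obtain ⟨P, t, ht, hP⟩ := hf
  have htg := ht.comp hg.size_bounded
  obtain ⟨Q, u, hu, hQ⟩ := hg
  exact ⟨.seq Q P, fun x => u x + t (g x), hu.add htg, fun x m => (hQ x m).seq (hP (g x) m)⟩

@[fun_prop]
theorem pair {f : α → β} {g : α → γ} (hf : PolyTime f) (hg : PolyTime g) :
    PolyTime fun x => (f x, g x) := by
  have sizeg := hg.size_bounded
  obtain ⟨P, t, ht, hP⟩ := hf
  obtain ⟨Q, u, hu, hQ⟩ := hg
  refine ⟨.seq dup (.seq Q (.seq swap (.seq P (.push .data true)))), fun x =>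
    (18 * size x + 4) + (u x + ((12 * size (g x) + 12 * size x + 6) + (t x + 1))), by fun_prop,
    fun x m => ?_⟩
  refine (run_dup (toTree x) m).seq ((hQ x _).seq ((run_swap (toTree (g x)) (toTree x) m).seq
    ((hP x _).seq (.push_of_eq ?_))))
  simp [onTop, treeBits]

theorem toTree {f : α → β} (hf : PolyTime f) : PolyTime fun x => toTree (f x) :=
  hf.of_toTree_eq fun _ => rfl

@[fun_prop]
theorem left {f : α → BinaryTree Unit} (hf : PolyTime f) : PolyTime fun x => (f x).left := by
  refine comp (f := BinaryTree.left) ⟨.ite .data (· == some true)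
    (.seq (.pop .data) (.seq swap drop)) .skip, fun d => 24 * size d + 10, by fun_prop,
    fun d m => ?_⟩ hf
  cases d with
  | nil => exact (Run.iteFalse rfl (.skip _)).mono (by simp)
  | node _ a b =>
    have exchange := run_swap a b m
    have remove := run_drop b (treeBits a ++ m)
    refine (Run.iteTrue rfl (.seq (.pop_of_eq ?_) (exchange.seq remove))).mono ?_
    · simp [onTop, treeBits]
    · simp only [size, toTree_tree, treeBits, List.length_cons, List.length_append]; omega

@[fun_prop]
theorem right {f : α → BinaryTree Unit} (hf : PolyTime f) : PolyTime fun x => (f x).right := by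
  refine comp (f := BinaryTree.right) ⟨.ite .data (· == some true) (.seq (.pop .data) drop) .skip,
    fun d => 6 * size d + 4, by fun_prop, fun d m => ?_⟩ hf
  cases d with
  | nil => exact (Run.iteFalse rfl (.skip _)).mono (by simp)
  | node _ a b =>
    refine (Run.iteTrue rfl (.seq (.pop_of_eq ?_) (run_drop a (treeBits b ++ m)))).mono ?_
    · simp [onTop, treeBits]
    · simp only [size, toTree_tree, treeBits, List.length_cons, List.length_append]; omega

@[fun_prop]
theorem fst {f : α → β × γ} (hf : PolyTime f) : PolyTime fun x => (f x).1 :=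
  hf.toTree.left.of_toTree_eq fun _ => rfl

@[fun_prop]
theorem snd {f : α → β × γ} (hf : PolyTime f) : PolyTime fun x => (f x).2 :=
  hf.toTree.right.of_toTree_eq fun _ => rfl

@[fun_prop]
theorem node {f g : α → BinaryTree Unit} (hf : PolyTime f) (hg : PolyTime g) :
    PolyTime fun x => f x △ g x :=
  (hf.pair hg).of_toTree_eq fun _ => rfl

@[fun_prop]
theorem const (b : β) : PolyTime fun _ : α => b := by
  suffices h : ∀ d : BinaryTree Unit, PolyTime fun _ : α => d from
    (h (TreeCode.toTree b)).of_toTree_eq fun _ => rfl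
  intro d
  induction d with
  | nil =>
    exact ⟨.seq drop (.push .data false), fun x => 6 * size x + 3, by fun_prop,
      fun x m => (run_drop (TreeCode.toTree x) m).seq (.push_of_eq (by simp [onTop, treeBits]))⟩
  | node _ a b iha ihb => exact iha.node ihb

@[fun_prop]
theorem cons {f : α → β} {g : α → List β} (hf : PolyTime f) (hg : PolyTime g) :
    PolyTime fun x => f x :: g x :=
  (hf.pair hg).of_toTree_eq fun _ => rfl

@[fun_prop]
theorem tail {f : α → List β} (hf : PolyTime f) : PolyTime fun x => (f x).tail :=
  hf.toTree.right.of_toTree_eq fun x => by cases f x <;> rfl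

@[fun_prop]
theorem head {f : α → List β} (hne : ∀ x, f x ≠ []) (hf : PolyTime f) :
    PolyTime fun x => (f x).head (hne x) :=
  hf.toTree.left.of_toTree_eq fun x => by
    obtain ⟨b, k, h⟩ := List.exists_cons_of_ne_nil (hne x)
    simp [h]

@[fun_prop]
theorem isEmpty {l : α → List β} (hl : PolyTime l) : PolyTime fun x => (l x).isEmpty := by
  refine comp (f := List.isEmpty) ⟨.ite .data (· == some true) (.seq drop (.push .data false))
    (.seq (.push .data false) (.push .data true)), fun x => 6 * size x + 4, by fun_prop,
    fun k m => ?_⟩ hl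
  cases k with
  | nil =>
    refine (Run.iteFalse rfl (.seq (.push_of_eq rfl) (.push_of_eq ?_))).mono (by simp)
    simp [onTop, treeBits]
  | cons a k =>
    refine (Run.iteTrue rfl ((run_drop (TreeCode.toTree (a :: k)) m).seq (.push_of_eq ?_))).mono ?_
    · simp [onTop, treeBits]
    · simp only [← size.eq_def]; omega

theorem dite {c : α → Bool} {f : {x // c x = true} → β} {g : {x // ¬c x = true} → β}
    (hc : PolyTime c) (hf : PolyTime f) (hg : PolyTime g) :
    PolyTime fun x => if h : c x = true then f ⟨x, h⟩ else g ⟨x, h⟩ := by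
  obtain ⟨P, t, ⟨p, hp⟩, hP⟩ := hf
  obtain ⟨Q, u, ⟨q, hq⟩, hQ⟩ := hg
  obtain ⟨R, v, hv, hR⟩ := hc.pair id
  refine ⟨.seq R (.seq (.pop .data) (.ite .data (· == some true) (.seq drop P) (.seq drop Q))),
    fun x => v x + (1 + (1 + (20 + (p.eval (size x) + q.eval (size x))))), by fun_prop,
    fun x m => (hR x m).seq (.seq (S' := onTop (c x) (treeBits (TreeCode.toTree x) ++ m))
      (.pop_of_eq (by simp [onTop, treeBits])) ?_)⟩
  have remove := run_drop (TreeCode.toTree (c x)) (treeBits (TreeCode.toTree x) ++ m)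
  have size_cond := size_bool_le (c x)
  rw [size] at size_cond
  by_cases h : c x = true
  · have time := hp ⟨x, h⟩
    have run := (remove.seq (hP ⟨x, h⟩ m)).mono
      (t' := 20 + (p.eval (size x) + q.eval (size x))) (by simp only [size_subtype] at time; omega)
    simp only [dif_pos h]
    exact .iteTrue (by simp [onTop, treeBits, h]) run
  · have time := hq ⟨x, h⟩
    have run := (remove.seq (hQ ⟨x, h⟩ m)).mono
      (t' := 20 + (p.eval (size x) + q.eval (size x))) (by simp only [size_subtype] at time; omega)
    simp only [dif_neg h]
    exact .iteFalse (by simp [onTop, treeBits, h]) run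

@[fun_prop]
theorem val {p : β → Prop} {f : α → {y // p y}} (hf : PolyTime f) : PolyTime fun x => (f x).1 :=
  hf.of_toTree_eq fun _ => rfl

@[fun_prop]
theorem cond {c : α → Bool} {f g : α → β} (hc : PolyTime c) (hf : PolyTime f) (hg : PolyTime g) :
    PolyTime fun x => bif c x then f x else g x := by
  have h := hc.dite (hf.comp (g := fun x : {x // c x = true} => x.1) (by fun_prop))
    (hg.comp (g := fun x : {x // ¬c x = true} => x.1) (by fun_prop))
  simpa only [dite_eq_ite, ← Bool.cond_eq_ite] using h

@[fun_prop]
theorem listCase {l : α → List β} {f : α → γ} {g : α → β → List β → γ} (hl : PolyTime l)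
    (hf : PolyTime f) (hg : PolyTime fun p : α × β × List β => g p.1 p.2.1 p.2.2) :
    PolyTime fun x => StackProg.listCase (l x) (f x) (g x) := by
  have ne_nil (x : {x // ¬(l x).isEmpty = true}) : l x.1 ≠ [] := by simpa using x.2
  have h := hl.isEmpty.dite (hf.comp (g := fun x : {x // (l x).isEmpty = true} => x.1)
    (by fun_prop)) (hg.comp (g := fun x : {x // ¬(l x).isEmpty = true} =>
      (x.1, (l x.1).head (ne_nil x), (l x.1).tail)) (by fun_prop))
  convert h using 2 with x
  by_cases hx : l x = []
  · simp [hx]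
  · obtain ⟨b, k, hk⟩ := List.exists_cons_of_ne_nil hx
    simp [hk]

end PolyTime

theorem foldl_context {α β γ : Type} (f : α → γ → β → γ) (l : List β) (a : α) (c : γ) :
    l.foldl (fun (y : α × γ) b => (y.1, f y.1 y.2 b)) (a, c) = (a, l.foldl (f a) c) := by
  induction l generalizing c with
  | nil => rfl
  | cons b _ ih => exact ih _

/-- Given a program for one step, fold over a list on top of the state, leaving the final state. -/
def foldLoop (P : TreeProg) : TreeProg :=
  .seq (.loop .data (· == some true) (.seq (.push .data true) (.seq P (.pop .data)))) (.pop .data)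

theorem run_foldLoop {P : TreeProg} {f : γ → β → γ} {t : List β × γ → ℕ} {T : ℕ}
    (hP : ∀ b k c m, Run P (onTop (b :: k, c) m) (t (b :: k, c)) (onTop (k, f c b) m))
    {l : List β} {c : γ} (hT : ∀ l₁ b l₂, l = l₁ ++ b :: l₂ → t (b :: l₂, l₁.foldl f c) ≤ T)
    (m : List Bool) :
    Run (foldLoop P) (onTop l (treeBits (toTree c) ++ m)) (l.length * (T + 3) + 2)
      (onTop (l.foldl f c) m) := by
  refine .mono (t := l.length * (T + 3) + 1 + 1) (.seq (S' := onTop ([] : List β)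
    (treeBits (toTree (l.foldl f c)) ++ m)) ?_ (.pop_of_eq (by simp [onTop, treeBits]))) le_rfl
  induction l generalizing c with
  | nil => exact .mono (.loopFalse rfl) (by simp)
  | cons b k ih =>
    have step : Run (.seq (.push .data true) (.seq P (.pop .data)))
        (onTop (b :: k) (treeBits (toTree c) ++ m)) (1 + (t (b :: k, c) + 1))
        (onTop k (treeBits (toTree (f c b)) ++ m)) :=
      .seq (.push_of_eq (by simp [onTop, treeBits]))
        ((hP b k c m).seq (.pop_of_eq (by simp [onTop, treeBits])))
    have first : t (b :: k, c) ≤ T := hT [] b k rfl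
    have rest := ih (c := f c b) fun l₁ b' l₂ h => hT (b :: l₁) b' l₂ (by simp [h])
    exact (Run.loopTrue rfl step rest).mono (by simp only [List.length_cons]; linarith)

namespace PolyTime

theorem foldl_of_bounded {step : α → γ → β → γ} {l : α → List β} {base : α → γ} (hl : PolyTime l)
    (hbase : PolyTime base) (hstep : PolyTime fun p : α × γ × β => step p.1 p.2.1 p.2.2)
    {s : α → ℕ} (hs : PolyBounded s)
    (hsize : ∀ x k, k <+: l x → size (k.foldl (step x) (base x)) ≤ s x) :
    PolyTime fun x => (l x).foldl (step x) (base x) := by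
  have unload : PolyTime fun y : List β × α × γ =>
      StackProg.listCase y.1 y fun b k => (k, y.2.1, step y.2.1 y.2.2 b) := by
    have := hstep.comp (g := fun q : (List β × α × γ) × β × List β => (q.1.2.1, q.1.2.2, q.2.1))
      (by fun_prop)
    fun_prop
  obtain ⟨P, t, ⟨p, hp⟩, hP⟩ := unload
  have load : PolyTime fun x => (l x, x, base x) := by fun_prop
  obtain ⟨Q, u, hu, hQ⟩ := load
  suffices h : PolyTime fun x =>
      (l x).foldl (fun (y : α × γ) b => (y.1, step y.1 y.2 b)) (x, base x) by
    simpa only [foldl_context] using h.snd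
  refine ⟨.seq Q (.seq (.pop .data) (foldLoop P)), fun x => u x + (1 + (size (l x) *
    (p.eval (size (l x) + (size x + s x + 1) + 1) + 3) + 2)), by fun_prop, fun x m => ?_⟩
  have time : ∀ l₁ b l₂, l x = l₁ ++ b :: l₂ →
      t (b :: l₂, l₁.foldl (fun (y : α × γ) b => (y.1, step y.1 y.2 b)) (x, base x)) ≤
        p.eval (size (l x) + (size x + s x + 1) + 1) := by
    intro l₁ b l₂ h
    refine (hp _).trans (monotone_eval p ?_)
    have stateSize := hsize x l₁ ⟨_, h.symm⟩
    have listSize := size_append l₁ (b :: l₂)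
    have := size_pos l₁
    rw [← h] at listSize
    rw [foldl_context, size_pair, size_pair]
    omega
  refine ((hQ x m).seq (.seq (.pop_of_eq (S' := onTop (l x) (treeBits (TreeCode.toTree
    (x, base x)) ++ m)) (by simp [onTop, treeBits])) (run_foldLoop
      (fun b k c m => hP (b :: k, c) m) time m))).mono ?_
  beta_reduce
  gcongr
  exact length_le_size _

theorem foldl {step : α → γ → β → γ} {l : α → List β} {base : α → γ} (hl : PolyTime l)
    (hbase : PolyTime base) (hstep : PolyTime fun p : α × γ × β => step p.1 p.2.1 p.2.2)
    {t : α × β → ℕ} (ht : PolyBounded t)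
    (hsize : ∀ a s b, size (step a s b) ≤ size s + t (a, b)) :
    PolyTime fun x => (l x).foldl (step x) (base x) := by
  obtain ⟨p, hp⟩ := ht
  have growth (a : α) (M : ℕ) (k : List β) (c : γ) (hk : ∀ b ∈ k, size b ≤ M) :
      size (k.foldl (step a) c) ≤ size c + k.length * p.eval (size a + M + 1) := by
    induction k generalizing c with
    | nil => simp
    | cons b k ih =>
      have first : size (step a c b) ≤ size c + p.eval (size a + M + 1) :=
        (hsize a c b).trans (Nat.add_le_add_left ((hp (a, b)).trans (monotone_eval p
          (by simpa using hk b (by simp)))) _)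
      have rest := ih (step a c b) fun b' hb' => hk b' (by simp [hb'])
      simp only [List.foldl_cons, List.length_cons]
      linarith
  refine foldl_of_bounded hl hbase hstep
    (s := fun x => size (base x) + size (l x) * p.eval (size x + size (l x) + 1))
    (by fun_prop) fun x k hk => ?_
  refine (growth x (size (l x)) k (base x) fun b hb => size_le_of_mem (hk.subset hb)).trans ?_
  gcongr
  exact hk.length_le.trans (length_le_size _)

@[fun_prop]
theorem not {c : α → Bool} (hc : PolyTime c) : PolyTime fun x => !c x := by
  have h : (fun x => !c x) = fun x => bif c x then false else true := by
    funext x; cases c x <;> rfl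
  rw [h]; fun_prop

@[fun_prop]
theorem and {c d : α → Bool} (hc : PolyTime c) (hd : PolyTime d) :
    PolyTime fun x => c x && d x := by
  have h : (fun x => c x && d x) = fun x => bif c x then d x else false := by
    funext x; cases c x <;> rfl
  rw [h]; fun_prop

@[fun_prop]
theorem or {c d : α → Bool} (hc : PolyTime c) (hd : PolyTime d) :
    PolyTime fun x => c x || d x := by
  have h : (fun x => c x || d x) = fun x => bif c x then true else d x := by
    funext x; cases c x <;> rfl
  rw [h]; fun_prop

@[fun_prop]
theorem reverse {l : α → List β} (hl : PolyTime l) : PolyTime fun x => (l x).reverse := by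
  have h : (fun x => (l x).reverse) = fun x => (l x).foldl (fun s b => b :: s) [] := by
    funext x; simp
  rw [h]
  exact foldl (step := fun _ s b => b :: s) hl (by fun_prop) (by fun_prop)
    (t := fun p => size p.2 + 1) (by fun_prop) fun a s b => by simp only [size_cons]; omega

@[fun_prop]
theorem append {l k : α → List β} (hl : PolyTime l) (hk : PolyTime k) :
    PolyTime fun x => l x ++ k x := by
  have h : (fun x => l x ++ k x) = fun x => (l x).reverse.foldl (fun s b => b :: s) (k x) := by
    funext x; simp
  rw [h]
  exact foldl (step := fun _ s b => b :: s) hl.reverse hk (by fun_prop)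
    (t := fun p => size p.2 + 1) (by fun_prop) fun a s b => by simp only [size_cons]; omega

@[fun_prop]
theorem flatMap {l : α → List β} {f : α → β → List γ} (hl : PolyTime l)
    (hf : PolyTime fun p : α × β => f p.1 p.2) : PolyTime fun x => (l x).flatMap (f x) := by
  have h : (fun x => (l x).flatMap (f x)) =
      fun x => (l x).reverse.foldl (fun s b => f x b ++ s) [] := by
    funext x
    rw [List.foldl_reverse]
    induction l x with
    | nil => rfl
    | cons a l ih => rw [List.flatMap_cons, List.foldr_cons, ih]
  rw [h]
  have := hf.comp (g := fun p : α × List γ × β => (p.1, p.2.2)) (by fun_prop)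
  refine foldl (step := fun x s b => f x b ++ s) hl.reverse (by fun_prop) (by fun_prop)
    (t := fun p => size (f p.1 p.2)) hf.size_bounded fun a s b => ?_
  have := size_append (f a b) s
  dsimp only
  omega

@[fun_prop]
theorem map {l : α → List β} {f : α → β → γ} (hl : PolyTime l)
    (hf : PolyTime fun p : α × β => f p.1 p.2) : PolyTime fun x => (l x).map (f x) := by
  have h : (fun x => (l x).map (f x)) = fun x => (l x).flatMap fun b => [f x b] := by
    funext x; exact List.map_eq_flatMap
  rw [h]; fun_prop

@[fun_prop]
theorem filter {l : α → List β} {c : α → β → Bool} (hl : PolyTime l)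
    (hc : PolyTime fun p : α × β => c p.1 p.2) : PolyTime fun x => (l x).filter (c x) := by
  have h : (fun x => (l x).filter (c x)) =
      fun x => (l x).flatMap fun b => bif c x b then [b] else [] := by
    funext x
    induction l x with
    | nil => rfl
    | cons b k ih => cases hb : c x b <;> simp [hb, ih]
  rw [h]; fun_prop

@[fun_prop]
theorem any {l : α → List β} {c : α → β → Bool} (hl : PolyTime l)
    (hc : PolyTime fun p : α × β => c p.1 p.2) : PolyTime fun x => (l x).any (c x) := by
  have h : (fun x => (l x).any (c x)) = fun x => !((l x).filter (c x)).isEmpty := by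
    funext x; rw [Bool.eq_iff_iff]; simp
  rw [h]; fun_prop

@[fun_prop]
theorem all {l : α → List β} {c : α → β → Bool} (hl : PolyTime l)
    (hc : PolyTime fun p : α × β => c p.1 p.2) : PolyTime fun x => (l x).all (c x) := by
  have h : (fun x => (l x).all (c x)) = fun x => !(l x).any fun b => !c x b := by
    funext x; rw [Bool.eq_iff_iff]; simp
  rw [h]; fun_prop

@[fun_prop]
theorem zip {l : α → List β} {k : α → List γ} (hl : PolyTime l) (hk : PolyTime k) :
    PolyTime fun x => (l x).zip (k x) := by
  let step : List γ × List (β × γ) → β → List γ × List (β × γ) := fun s b =>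
    StackProg.listCase s.1 s fun c k => (k, (b, c) :: s.2)
  have h (l : List β) (k : List γ) (r : List (β × γ)) :
      (l.foldl step (k, r)).2 = (l.zip k).reverse ++ r := by
    induction l generalizing k r with
    | nil => simp
    | cons b l ih =>
      cases k with
      | nil => exact (ih [] r).trans (by simp)
      | cons c k => simpa [step] using ih k ((b, c) :: r)
  have zip_eq : (fun x => (l x).zip (k x)) =
      fun x => ((l x).foldl step (k x, [])).2.reverse := by
    funext x; simp [h]
  rw [zip_eq]
  refine (PolyTime.snd (foldl (step := fun _ => step) hl (by fun_prop)
    (by simp only [step]; fun_prop) (t := fun p => size p.2 + 8) (by fun_prop) ?_)).reverse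
  rintro a ⟨_ | ⟨c, k⟩, s⟩ b
  · simp [step]
  · simp only [step, listCase_cons, size_pair, size_cons]; omega

theorem iterate {f : α → β → β} {base : α → β} {l : α → List γ} (hl : PolyTime l)
    (hbase : PolyTime base) (hf : PolyTime fun p : α × β => f p.1 p.2)
    (hsize : ∀ a b, size (f a b) ≤ size b) : PolyTime fun x => (f x)^[(l x).length] (base x) := by
  have h : (fun x => (f x)^[(l x).length] (base x)) =
      fun x => (l x).foldl (fun s _ => f x s) (base x) := by
    funext x; exact (List.foldl_const (f x) (base x) (l x)).symm
  rw [h]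
  exact foldl (step := fun x s _ => f x s) hl hbase
    (hf.comp (g := fun p : α × β × γ => (p.1, p.2.1)) (by fun_prop)) (.const 0)
    fun a s _ => hsize a s

end PolyTime

section Equality

theorem treeBits_append_inj {d e : BinaryTree Unit} {m n : List Bool}
    (h : treeBits d ++ m = treeBits e ++ n) : d = e ∧ m = n := by
  induction d generalizing e m n with
  | nil =>
    cases e with
    | nil => simpa [treeBits] using h
    | node => simp [treeBits] at h
  | node _ a b iha ihb =>
    cases e with
    | nil => simp [treeBits] at h
    | node _ a' b' =>
      simp only [treeBits, List.cons_append, List.append_assoc, List.cons.injEq, true_and] at h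
      obtain ⟨rfl, h'⟩ := iha h
      obtain ⟨rfl, rfl⟩ := ihb h'
      exact ⟨rfl, rfl⟩

theorem decide_tree_eq (d e : BinaryTree Unit) :
    decide (d = e) = (treeBits d).isPrefixOf (treeBits e) := by
  rw [Bool.eq_iff_iff, decide_eq_true_eq, List.isPrefixOf_iff_prefix]
  refine ⟨fun h => h ▸ List.prefix_rfl, fun ⟨m, h⟩ => ?_⟩
  exact (treeBits_append_inj (n := []) (by simpa using h)).1

theorem treeBits_bools (l : List Bool) :
    treeBits (toTree l) = l.flatMap (fun b => true :: treeBits (toTree b)) ++ [false] := by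
  induction l with
  | nil => rfl
  | cons b l ih => simp [treeBits, ih]

/-- Types with an injective representation by trees. -/
class InjTreeCode (α : Type) [TreeCode α] : Prop where
  injective : Function.Injective (toTree : α → BinaryTree Unit)

instance : InjTreeCode (BinaryTree Unit) := ⟨fun _ _ h => h⟩
instance : InjTreeCode Bool := ⟨by rintro (_ | _) (_ | _) h <;> simp at h ⊢⟩

instance [InjTreeCode α] [InjTreeCode β] : InjTreeCode (α × β) :=
  ⟨by
    rintro ⟨a, b⟩ ⟨a', b'⟩ h
    simp only [toTree_pair, BinaryTree.node.injEq, true_and] at h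
    rw [InjTreeCode.injective h.1, InjTreeCode.injective h.2]⟩

instance [InjTreeCode α] : InjTreeCode (List α) :=
  ⟨by
    intro l
    induction l with
    | nil => rintro (_ | ⟨b, k⟩) h <;> simp at h ⊢
    | cons a l ih =>
      rintro (_ | ⟨b, k⟩) h
      · simp at h
      · simp only [toTree_cons, BinaryTree.node.injEq, true_and] at h
        rw [InjTreeCode.injective h.1, ih h.2]⟩

namespace PolyTime

@[fun_prop]
theorem treeBits {f : α → BinaryTree Unit} (hf : PolyTime f) :
    PolyTime fun x => treeBits (f x) := by
  refine comp (f := StackProg.treeBits) ⟨.seq (moveTree true false) (.seq (.push .data false)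
    (transfer (Γ := fun _ : Work => Bool) .bufA .data fun b =>
      true :: StackProg.treeBits (TreeCode.toTree b))), fun d => 15 * size d + 4, by fun_prop,
    fun d m => ?_⟩ hf
  have move := run_moveTree true false d m [] []
  have expand := run_transfer (Γ := fun _ : Work => Bool) (k₀ := .bufA) (k₁ := .data) (by decide)
    (f := fun b => true :: StackProg.treeBits (TreeCode.toTree b)) (n := 4)
    (fun b => Nat.succ_le_succ (size_bool_le b)) (contents_bufA (false :: m)
      (StackProg.treeBits d).reverse [] [])
  refine (move.seq (.seq (.push_of_eq (by simp)) expand)).mono ?_ |> Eq.subst ?_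
  · simp [onTop, treeBits_bools]
  · simp only [Fintype.card_bool, List.length_reverse, size, toTree_tree]; omega

@[fun_prop]
theorem boolEq {b c : α → Bool} (hb : PolyTime b) (hc : PolyTime c) :
    PolyTime fun x => b x == c x := by
  have h : (fun x => b x == c x) = fun x => bif b x then c x else !c x := by
    funext x; cases b x <;> cases c x <;> rfl
  rw [h]; fun_prop

@[fun_prop]
theorem isPrefixOf {l k : α → List Bool} (hl : PolyTime l) (hk : PolyTime k) :
    PolyTime fun x => (l x).isPrefixOf (k x) := by
  let step : List Bool × Bool → Bool → List Bool × Bool := fun s b =>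
    StackProg.listCase s.1 ([], false) fun b' k => (k, s.2 && (b == b'))
  have foldl_step (l k : List Bool) (ok : Bool) :
      (l.foldl step (k, ok)).2 = (ok && l.isPrefixOf k) := by
    induction l generalizing k ok with
    | nil => simp
    | cons b l ih =>
      cases k with
      | nil => simp [step, ih]
      | cons b' k => simp [step, ih, List.isPrefixOf, Bool.and_assoc]
  have isPrefixOf_eq : (fun x => (l x).isPrefixOf (k x)) =
      fun x => ((l x).foldl step (k x, true)).2 := by
    funext x; simp [foldl_step]
  rw [isPrefixOf_eq]
  refine PolyTime.snd (foldl (step := fun _ => step) hl (by fun_prop)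
    (by simp only [step]; fun_prop) (PolyBounded.const 3) ?_)
  rintro _ ⟨_ | ⟨b', k⟩, ok⟩ b
  · simp [step]
  · have := size_bool_le (ok && (b == b'))
    simp only [step, listCase_cons, size_pair, size_cons]; omega

@[fun_prop]
theorem decideEq [InjTreeCode β] [DecidableEq β] {f g : α → β} (hf : PolyTime f)
    (hg : PolyTime g) : PolyTime fun x => decide (f x = g x) := by
  have h : (fun x => decide (f x = g x)) = fun x =>
      (StackProg.treeBits (TreeCode.toTree (f x))).isPrefixOf
        (StackProg.treeBits (TreeCode.toTree (g x))) := by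
    funext x
    simp only [← decide_tree_eq, InjTreeCode.injective.eq_iff]
  rw [h]
  exact hf.toTree.treeBits.isPrefixOf hg.toTree.treeBits

@[fun_prop]
theorem mem [InjTreeCode β] [DecidableEq β] {f : α → β} {l : α → List β} (hf : PolyTime f)
    (hl : PolyTime l) : PolyTime fun x => decide (f x ∈ l x) := by
  have h : (fun x => decide (f x ∈ l x)) = fun x => (l x).any fun b => decide (f x = b) := by
    funext x; rw [Bool.eq_iff_iff]; simp
  rw [h]; fun_prop

end PolyTime

end Equality

end StackProg

/-! ### Binary arithmetic -/

namespace StackProg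

open TreeCode

/-- The number with given binary digits, the least significant one first. -/
def ofBits (l : List Bool) : ℕ := l.foldr Nat.bit 0

@[simp] theorem ofBits_nil : ofBits [] = 0 := rfl
@[simp] theorem ofBits_cons (b : Bool) (l : List Bool) : ofBits (b :: l) = 2 * ofBits l + b.toNat :=
  Nat.bit_val b _

@[simp] theorem ofBits_bits (n : ℕ) : ofBits n.bits = n := by
  induction n using Nat.binaryRec' with
  | zero => simp
  | bit b n h ih => rw [Nat.bits_append_bit _ _ h, ofBits_cons, ih, Nat.bit_val]

theorem ofBits_append_false {β : Type} (l : List Bool) (k : List β) :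
    ofBits (l ++ k.map fun _ => false) = ofBits l := by
  have zeros : ofBits (k.map fun _ => false) = 0 := by
    induction k with
    | nil => rfl
    | cons a k ih => rw [List.map_cons, ofBits_cons, ih]; rfl
  induction l with
  | nil => exact zeros
  | cons b l ih => rw [List.cons_append, ofBits_cons, ofBits_cons, ih]

theorem ofBits_le_of_suffix {k l : List Bool} (h : k <:+ l) : ofBits k ≤ ofBits l := by
  obtain ⟨r, rfl⟩ := h
  induction r with
  | nil => simp
  | cons b r ih => rw [List.cons_append, ofBits_cons]; omega

theorem bits_bit (b : Bool) (n : ℕ) :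
    (Nat.bit b n).bits = bif !b && decide (n = 0) then [] else b :: n.bits := by
  by_cases h : n = 0 → b = true
  · rw [Nat.bits_append_bit _ _ h]
    by_cases hn : n = 0
    · simp [h hn]
    · simp [hn]
  · obtain ⟨rfl, hb⟩ := Classical.not_imp.1 h
    simp [Bool.eq_false_of_not_eq_true hb]

instance : TreeCode ℕ := ⟨fun n => toTree n.bits⟩

theorem toTree_nat (n : ℕ) : toTree n = toTree n.bits := rfl

theorem size_nat (n : ℕ) : size n = size n.bits := rfl

instance : InjTreeCode ℕ := ⟨fun m n h => by
  have bits_eq : m.bits = n.bits := InjTreeCode.injective h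
  rw [← ofBits_bits m, bits_eq, ofBits_bits]⟩

theorem size_bools_le (l : List Bool) : size l ≤ 4 * l.length + 1 := by
  induction l with
  | nil => simp
  | cons b l ih =>
    have := size_bool_le b
    simp only [size_cons, List.length_cons]
    omega

theorem size_nat_le (n : ℕ) : size n ≤ 4 * n.size + 1 := by
  rw [← Nat.size_eq_bits_len]
  exact size_bools_le n.bits

theorem size_nat_le_self (n : ℕ) : size n ≤ 4 * n + 1 := by
  have := size_nat_le n
  have := Nat.size_le.2 (Nat.lt_two_pow_self (n := n))
  omega

theorem natSize_le_size (n : ℕ) : n.size ≤ size n := by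
  rw [← Nat.size_eq_bits_len]
  exact length_le_size n.bits

variable {α β γ : Type} [TreeCode α] [TreeCode β] [TreeCode γ]

namespace PolyTime

@[fun_prop]
theorem bits {f : α → ℕ} (hf : PolyTime f) : PolyTime fun x => (f x).bits :=
  hf.of_toTree_eq fun _ => rfl

@[fun_prop]
theorem natBit {c : α → Bool} {f : α → ℕ} (hc : PolyTime c) (hf : PolyTime f) :
    PolyTime fun x => Nat.bit (c x) (f x) := by
  have h : PolyTime fun x =>
      bif !c x && decide (f x = 0) then [] else c x :: (f x).bits := by fun_prop
  exact h.of_toTree_eq fun x => by rw [toTree_nat, bits_bit]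

@[fun_prop]
theorem ofBits {l : α → List Bool} (hl : PolyTime l) : PolyTime fun x => ofBits (l x) := by
  have h : (fun x => StackProg.ofBits (l x)) =
      fun x => (l x).reverse.foldl (fun n b => Nat.bit b n) 0 := by
    funext x; rw [List.foldl_reverse]; rfl
  rw [h]
  refine foldl (step := fun _ n b => Nat.bit b n) hl.reverse (by fun_prop) (by fun_prop)
    (PolyBounded.const 4) fun _ n b => ?_
  have := size_bool_le b
  rw [size_nat, size_nat n, bits_bit]
  cases !b && decide (n = 0)
  · simp only [cond_false, size_cons]; omega
  · simp only [cond_true, size_nil]; omega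

end PolyTime

/-- The digit-wise pairs of two numbers, padded with zeros. -/
def digitPairs (m n : ℕ) : List (Bool × Bool) :=
  (m.bits ++ n.bits.map fun _ => false).zip (n.bits ++ m.bits.map fun _ => false)

theorem ofBits_map_fst_digitPairs (m n : ℕ) : ofBits ((digitPairs m n).map Prod.fst) = m := by
  rw [digitPairs, List.map_fst_zip (by simp [Nat.add_comm]), ofBits_append_false, ofBits_bits]

theorem ofBits_map_snd_digitPairs (m n : ℕ) : ofBits ((digitPairs m n).map Prod.snd) = n := by
  rw [digitPairs, List.map_snd_zip (by simp [Nat.add_comm]), ofBits_append_false, ofBits_bits]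

/-- One step of the addition of binary numbers: the state holds the carry and the digits of the
sum so far, the last one first. -/
def addStep (s : Bool × List Bool) (p : Bool × Bool) : Bool × List Bool :=
  (bif p.1 then p.2 || s.1 else p.2 && s.1,
    (bif p.1 then (bif p.2 then s.1 else !s.1) else (bif p.2 then !s.1 else s.1)) :: s.2)

theorem foldl_addStep (l : List (Bool × Bool)) (c : Bool) (r : List Bool) : ∃ k,
    (l.foldl addStep (c, r)).2.reverse ++ [(l.foldl addStep (c, r)).1] = r.reverse ++ k ∧
      ofBits k = ofBits (l.map Prod.fst) + ofBits (l.map Prod.snd) + c.toNat := by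
  induction l generalizing c r with
  | nil => exact ⟨[c], by simp⟩
  | cons p l ih =>
    obtain ⟨k, digits_eq, value_eq⟩ := ih (addStep (c, r) p).1 (addStep (c, r) p).2
    refine ⟨(bif p.1 then (bif p.2 then c else !c) else (bif p.2 then !c else c)) :: k, ?_, ?_⟩
    · rw [List.foldl_cons, digits_eq]
      simp [addStep]
    · rw [ofBits_cons, value_eq]
      obtain ⟨a, b⟩ := p
      cases a <;> cases b <;> cases c <;> simp [addStep] <;> omega

theorem add_eq_foldl (m n : ℕ) : m + n = ofBits
    (((digitPairs m n).foldl addStep (false, [])).2.reverse ++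
      [((digitPairs m n).foldl addStep (false, [])).1]) := by
  obtain ⟨k, digits_eq, value_eq⟩ := foldl_addStep (digitPairs m n) false []
  rw [digits_eq, List.reverse_nil, List.nil_append, value_eq, ofBits_map_fst_digitPairs,
    ofBits_map_snd_digitPairs]
  rfl

/-- One step of the comparison of binary numbers: the state is the result for the digits so far. -/
def leStep (r : Bool) (p : Bool × Bool) : Bool :=
  bif p.1 then p.2 && r else p.2 || r

theorem foldl_leStep (l : List (Bool × Bool)) (r : Bool) : l.foldl leStep r = true ↔
    ofBits (l.map Prod.fst) < ofBits (l.map Prod.snd) ∨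
      (ofBits (l.map Prod.fst) = ofBits (l.map Prod.snd) ∧ r = true) := by
  induction l generalizing r with
  | nil => simp
  | cons p l ih =>
    rw [List.foldl_cons, ih]
    obtain ⟨a, b⟩ := p
    cases a <;> cases b <;> cases r <;> simp [leStep] <;> omega

theorem le_eq_foldl (m n : ℕ) : decide (m ≤ n) = (digitPairs m n).foldl leStep true := by
  rw [Bool.eq_iff_iff, foldl_leStep, ofBits_map_fst_digitPairs, ofBits_map_snd_digitPairs,
    decide_eq_true_eq, le_iff_lt_or_eq]
  simp

theorem foldl_double_add (l : List Bool) (n : ℕ) :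
    l.foldl (fun s b => Nat.bit false s + bif b then n else 0) 0 = ofBits l.reverse * n := by
  induction l using List.reverseRecOn with
  | nil => simp
  | append_singleton l b ih =>
    rw [List.foldl_append, ih]
    cases b <;> simp [Nat.bit_val] <;> ring

theorem mul_eq_foldl (m n : ℕ) :
    m * n = m.bits.reverse.foldl (fun s b => Nat.bit false s + bif b then n else 0) 0 := by
  rw [foldl_double_add, List.reverse_reverse, ofBits_bits]

theorem size_mul_le (m n : ℕ) : size (m * n) ≤ 4 * (size m + size n) + 1 := by
  have bound : m * n < 2 ^ (m.size + n.size) := by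
    rw [pow_add]
    exact Nat.mul_lt_mul'' (Nat.lt_size_self m) (Nat.lt_size_self n)
  have := Nat.size_le.2 bound
  have := size_nat_le (m * n)
  have := natSize_le_size m
  have := natSize_le_size n
  omega

theorem size_nat_le_of_le {m n : ℕ} (h : m ≤ n) : size m ≤ 4 * size n + 1 := by
  have := size_nat_le m
  have := Nat.size_le_size h
  have := natSize_le_size n
  omega

theorem size_le_of_forall_size_le {l : List β} {M : ℕ} (h : ∀ b ∈ l, size b ≤ M) :
    size l ≤ l.length * (M + 1) + 1 := by
  induction l with
  | nil => simp
  | cons b l ih =>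
    have first := h b (by simp)
    have rest := ih fun b' hb' => h b' (by simp [hb'])
    simp only [size_cons, List.length_cons]
    linarith

theorem foldl_count {β : Type} (l : List β) :
    l.foldl (fun (s : ℕ × List ℕ) _ => (s.1 + 1, s.1 :: s.2)) (0, []) =
      (l.length, (List.range l.length).reverse) := by
  induction l using List.reverseRecOn with
  | nil => rfl
  | append_singleton l b ih => simp [List.foldl_append, ih, List.range_succ]

namespace PolyTime

@[fun_prop]
theorem digitPairs {f g : α → ℕ} (hf : PolyTime f) (hg : PolyTime g) :
    PolyTime fun x => digitPairs (f x) (g x) := by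
  unfold StackProg.digitPairs
  fun_prop

@[fun_prop]
theorem natAdd {f g : α → ℕ} (hf : PolyTime f) (hg : PolyTime g) :
    PolyTime fun x => f x + g x := by
  have h : PolyTime fun x => (StackProg.digitPairs (f x) (g x)).foldl addStep (false, []) := by
    refine foldl (step := fun _ => addStep) (by fun_prop) (by fun_prop)
      (by unfold addStep; fun_prop) (PolyBounded.const 8) ?_
    rintro _ ⟨c, s⟩ p
    have carry_le := size_bool_le (addStep (c, s) p).1
    have digit_le := size_bool_le ((addStep (c, s) p).2.head (by simp [addStep]))
    simp only [addStep, List.head_cons, size_pair, size_cons] at *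
    omega
  simp only [add_eq_foldl]
  fun_prop

@[fun_prop]
theorem natLe {f g : α → ℕ} (hf : PolyTime f) (hg : PolyTime g) :
    PolyTime fun x => decide (f x ≤ g x) := by
  simp only [le_eq_foldl]
  exact foldl (step := fun _ => leStep) (by fun_prop) (by fun_prop) (by unfold leStep; fun_prop)
    (PolyBounded.const 3) fun _ _ _ => (size_bool_le _).trans (by omega)

@[fun_prop]
theorem natMul {f g : α → ℕ} (hf : PolyTime f) (hg : PolyTime g) :
    PolyTime fun x => f x * g x := by
  simp only [mul_eq_foldl]
  refine foldl_of_bounded (step := fun x s b => Nat.bit false s + bif b then g x else 0)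
    (by fun_prop) (by fun_prop) (by fun_prop)
    (s := fun x => 4 * ((4 * size (f x) + 1) + size (g x)) + 1) (by fun_prop) fun x k hk => ?_
  rw [foldl_double_add]
  have initial_le : StackProg.ofBits k.reverse ≤ f x := by
    simpa using ofBits_le_of_suffix (List.reverse_suffix.2 hk)
  have := size_mul_le (StackProg.ofBits k.reverse) (g x)
  have := size_nat_le_of_le initial_le
  omega

theorem length_range_reverse {l : α → List β} (hl : PolyTime l) :
    PolyTime fun x => ((l x).length, (List.range (l x).length).reverse) := by
  simp only [← foldl_count]
  refine foldl_of_bounded (step := fun _ (s : ℕ × List ℕ) _ => (s.1 + 1, s.1 :: s.2)) hl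
    (by fun_prop) (by fun_prop) (s := fun x => (4 * size (l x) + 1) +
      (size (l x) * (4 * size (l x) + 1 + 1) + 1) + 1) (by fun_prop) fun x k hk => ?_
  have length_le : k.length ≤ size (l x) := hk.length_le.trans (length_le_size _)
  have count_le := size_nat_le_self k.length
  have range_le := size_le_of_forall_size_le (l := (List.range k.length).reverse)
    (M := 4 * size (l x) + 1) fun n hn => (size_nat_le_self n).trans (by
      have := List.mem_range.1 (List.mem_reverse.1 hn)
      omega)
  rw [List.length_reverse, List.length_range] at range_le
  rw [foldl_count, size_pair]
  have := Nat.mul_le_mul_right (4 * size (l x) + 1 + 1) length_le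
  omega

@[fun_prop]
theorem length {l : α → List β} (hl : PolyTime l) : PolyTime fun x => (l x).length :=
  (length_range_reverse hl).fst

theorem range_length {l : α → List β} (hl : PolyTime l) :
    PolyTime fun x => List.range (l x).length := by
  simpa using (length_range_reverse hl).snd.reverse

end PolyTime

theorem decide_rat_le_eq (a b : ℚ) : decide (a ≤ b) =
    bif decide (a < 0) then
      bif decide (b < 0) then decide (b.num.natAbs * a.den ≤ a.num.natAbs * b.den) else true
    else
      bif decide (b < 0) then false else decide (a.num.natAbs * b.den ≤ b.num.natAbs * a.den) := by
  have cross := Rat.le_iff a b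
  have abs_neg {q : ℚ} (h : q < 0) : (q.num.natAbs : ℤ) = -q.num :=
    Int.ofNat_natAbs_of_nonpos (Rat.num_neg.2 h).le
  have abs_nonneg {q : ℚ} (h : ¬q < 0) : (q.num.natAbs : ℤ) = q.num :=
    Int.natAbs_of_nonneg (Rat.num_nonneg.2 (not_lt.1 h))
  by_cases ha : a < 0 <;> by_cases hb : b < 0 <;>
    simp only [ha, hb, decide_true, decide_false, cond_true, cond_false, decide_eq_decide,
      decide_eq_true_eq, decide_eq_false_iff_not]
  · rw [cross, ← Int.ofNat_le, Nat.cast_mul, Nat.cast_mul, abs_neg ha, abs_neg hb]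
    constructor <;> intro h <;> linarith
  · linarith
  · linarith
  · rw [cross, ← Int.ofNat_le, Nat.cast_mul, Nat.cast_mul, abs_nonneg ha, abs_nonneg hb]

instance : TreeCode ℚ :=
  ⟨fun q => toTree [toTree [decide (q < 0)], toTree q.num.natAbs, toTree q.den]⟩

namespace PolyTime

@[fun_prop]
theorem ratNeg {f : α → ℚ} (hf : PolyTime f) : PolyTime fun x => decide (f x < 0) :=
  hf.toTree.left.left.of_toTree_eq fun _ => rfl

@[fun_prop]
theorem ratNum {f : α → ℚ} (hf : PolyTime f) : PolyTime fun x => (f x).num.natAbs :=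
  hf.toTree.right.left.of_toTree_eq fun _ => rfl

@[fun_prop]
theorem ratDen {f : α → ℚ} (hf : PolyTime f) : PolyTime fun x => (f x).den :=
  hf.toTree.right.right.left.of_toTree_eq fun _ => rfl

@[fun_prop]
theorem ratLe {f g : α → ℚ} (hf : PolyTime f) (hg : PolyTime g) :
    PolyTime fun x => decide (f x ≤ g x) := by
  simp only [decide_rat_le_eq]
  fun_prop

end PolyTime

end StackProg

/-! ### Machines for polynomial-time predicates -/

namespace StackProg

open Turing TreeCode

theorem initList_machine {K : Type} {Γ : K → Type} [DecidableEq K] [Fintype K]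
    (p : StackProg Γ) (k₀ k₁ : K) [Fintype (Γ k₀)] (w : List (Γ k₀)) :
    initList (p.machine k₀ k₁) w =
      ⟨some (some p.start), false, Function.update (fun _ => []) k₀ w⟩ := by
  have update_self : Function.update (fun k => ([] : List (Γ k))) k₀ w k₀ = w :=
    Function.update_self ..
  have update_of_ne : ∀ k, k ≠ k₀ → Function.update (fun k => ([] : List (Γ k))) k₀ w k = [] :=
    fun k hk => Function.update_of_ne hk ..
  unfold initList
  congr 1
  funext k
  by_cases hk : k = k₀
  · cases hk
    exact (dif_pos rfl).trans update_self.symm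
  · exact (dif_neg hk).trans (update_of_ne k hk).symm

theorem haltList_machine {K : Type} {Γ : K → Type} [DecidableEq K] [Fintype K]
    (p : StackProg Γ) (k₀ k₁ : K) [Fintype (Γ k₀)] (w : List (Γ k₁)) :
    haltList (p.machine k₀ k₁) w = ⟨none, false, Function.update (fun _ => []) k₁ w⟩ := by
  have update_self : Function.update (fun k => ([] : List (Γ k))) k₁ w k₁ = w :=
    Function.update_self ..
  have update_of_ne : ∀ k, k ≠ k₁ → Function.update (fun k => ([] : List (Γ k))) k₁ w k = [] :=
    fun k hk => Function.update_of_ne hk ..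
  unfold haltList
  congr 1
  funext k
  by_cases hk : k = k₁
  · cases hk
    exact (dif_pos rfl).trans update_self.symm
  · exact (dif_neg hk).trans (update_of_ne k hk).symm

theorem computable_of_run {K : Type} {Γ : K → Type} [DecidableEq K] [Finite K] {k₀ k₁ : K}
    [Finite (Γ k₀)] {α β : Type} {ea : α → List (Γ k₀)} {eb : β → List (Γ k₁)} {f : α → β}
    {p : StackProg Γ} {time : Polynomial ℕ}
    (h : ∀ x, Run p (Function.update (fun _ => []) k₀ (ea x)) (time.eval (ea x).length)
      (Function.update (fun _ => []) k₁ (eb (f x)))) :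
    Nonempty (TM2ComputableInPolyTime ea eb f) := by
  have : Fintype K := Fintype.ofFinite K
  have : Fintype (Γ k₀) := Fintype.ofFinite (Γ k₀)
  refine ⟨{
    tm := p.machine k₀ k₁
    inputAlphabet := Equiv.refl _
    outputAlphabet := Equiv.refl _
    time := time + 1
    outputsFun := fun x => Classical.choice ?_ }⟩
  have outputs : Nonempty (TM2OutputsInTime (p.machine k₀ k₁) (ea x) (some (eb (f x)))
      ((time + 1).eval (ea x).length)) := by
    rw [Polynomial.eval_add, Polynomial.eval_one]
    change Nonempty (StateTransition.EvalsToInTime (TM2.step p.code)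
      (initList (p.machine k₀ k₁) (ea x)) (some (haltList (p.machine k₀ k₁) (eb (f x)))) _)
    rw [initList_machine, haltList_machine]
    exact (h x).evalsToInTime
  exact (congrArg₂ (fun v w => Nonempty (TM2OutputsInTime (p.machine k₀ k₁) v (some w) _))
    (List.map_id _) (List.map_id _)).mpr outputs

section Input

variable {K : Type} {Γ : K → Type} {A : Type}

/-- The alphabets after the addition of an input stack `none` with alphabet `A`. -/
abbrev WithInput (A : Type) (Γ : K → Type) : Option K → Type
  | none => A
  | some k => Γ k

/-- A program as a program on the stacks with an input stack, which it does not use. -/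
def lift (A : Type) : StackProg Γ → StackProg (WithInput A Γ)
  | .skip => .skip
  | .push k g => .push (some k) g
  | .pop k => .pop (some k)
  | .seq p q => .seq (p.lift A) (q.lift A)
  | .ite k c p q => .ite (some k) c (p.lift A) (q.lift A)
  | .loop k c p => .loop (some k) c (p.lift A)

/-- The stacks `S` together with the input stack `w`. -/
def consInput (w : List A) (S : ∀ k, List (Γ k)) : ∀ k, List (WithInput A Γ k)
  | none => w
  | some k => S k

variable [DecidableEq K]

@[simp] theorem update_consInput_none (w v : List A) (S : ∀ k, List (Γ k)) :
    Function.update (consInput w S) none v = consInput v S := by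
  funext k
  cases k <;> simp [consInput, Function.update]

@[simp] theorem update_consInput_some (w : List A) (S : ∀ k, List (Γ k)) (k : K)
    (v : List (Γ k)) :
    Function.update (consInput w S) (some k) v = consInput w (Function.update S k v) := by
  funext k'
  rcases k' with _ | k'
  · simp [consInput]
  · rcases eq_or_ne k' k with rfl | hk
    · simp [consInput]
    · simp [consInput, hk]

theorem Run.lift {p : StackProg Γ} {S S' : ∀ k, List (Γ k)} {t : ℕ} (h : Run p S t S')
    (w : List A) : Run (p.lift A) (consInput w S) t (consInput w S') := by
  induction h with
  | skip S => exact .skip _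
  | push k g S => exact .push_of_eq (update_consInput_some ..)
  | pop k S => exact .pop_of_eq (update_consInput_some ..)
  | seq _ _ ih₁ ih₂ => exact ih₁.seq ih₂
  | iteTrue hc _ ih => exact .iteTrue hc ih
  | iteFalse hc _ ih => exact .iteFalse hc ih
  | loopTrue hc _ _ ih₁ ih₂ => exact .loopTrue hc ih₁ ih₂
  | loopFalse hc => exact .loopFalse hc
  | mono _ hle ih => exact ih.mono hle

end Input

open Work Computability

/-- Replace the code of a Boolean, on an otherwise empty data stack, by this Boolean. -/
def decodeBool : TreeProg :=
  .ite data (· == some true) (.seq (.pop data) (.seq (.pop data) (.seq (.pop data)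
    (.push data true)))) .skip

theorem run_decodeBool (b : Bool) : Run decodeBool (onTop b []) 5 (onData [b]) := by
  cases b
  · exact (Run.iteFalse rfl (.skip _)).mono (by omega)
  · exact .iteTrue rfl (.seq (.pop_of_eq (update_contents_data ..))
      (.seq (.pop_of_eq (update_contents_data ..)) (.seq (.pop_of_eq (update_contents_data ..))
        (.push_of_eq (update_contents_data ..)))))

/-- Translate the input symbol by symbol into bits on the data stack. -/
noncomputable def readInput {A : Type} [Fintype A] [DecidableEq A] (code : A → List Bool) :
    StackProg (WithInput A fun _ : Work => Bool) :=
  .seq (@transfer _ (WithInput A fun _ : Work => Bool) none (some bufA) ‹_› ‹_›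
    fun a => (code a).reverse) ((flush bufA).lift A)

theorem length_flatMap_le {A B : Type} {f : A → List B} {n : ℕ} (hn : ∀ a, (f a).length ≤ n)
    (w : List A) : (w.flatMap f).length ≤ n * w.length := by
  induction w with
  | nil => simp
  | cons a w ih =>
    rw [List.flatMap_cons, List.length_append, List.length_cons]
    linarith [hn a]

theorem run_readInput {A : Type} [Fintype A] [DecidableEq A] {code : A → List Bool} {n : ℕ}
    (hn : ∀ a, (code a).length ≤ n) (w : List A) :
    Run (readInput code) (consInput w (onData [])) ((Fintype.card A + 7 * n + 3) * w.length + 2)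
      (consInput [] (onData (w.flatMap code))) := by
  have translate := @run_transfer _ (WithInput A fun _ : Work => Bool) _ none (some bufA) ‹_› ‹_›
    (by simp) (fun a => (code a).reverse) n (by simpa using hn) w (consInput w (onData [])) rfl
  have bits_eq : w.reverse.flatMap (fun a => (code a).reverse) = (w.flatMap code).reverse := by
    rw [List.reverse_flatMap]; rfl
  have buffer_nil : consInput w (onData []) (some bufA) = [] := rfl
  rw [bits_eq, buffer_nil, List.append_nil, update_consInput_none, update_consInput_some,
    update_contents_bufA] at translate
  have empty := (run_flush_bufA [] (w.flatMap code).reverse [] []).lift ([] : List A)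
  rw [List.reverse_reverse, List.append_nil, List.length_reverse] at empty
  have length_le := length_flatMap_le hn w
  refine (translate.seq empty).mono ?_
  linarith

theorem update_none_eq_consInput {A : Type} (w : List A) :
    Function.update (β := fun k => List (WithInput A (fun _ : Work => Bool) k))
      (fun _ => []) none w = consInput (Γ := fun _ : Work => Bool) w (onData []) := by
  funext k
  rcases k with _ | (_ | _ | _ | _) <;> rfl

theorem update_data_eq_consInput {A : Type} (l : List Bool) :
    Function.update (β := fun k => List (WithInput A (fun _ : Work => Bool) k))
      (fun _ => []) (some data) l =
      consInput (A := A) (Γ := fun _ : Work => Bool) [] (onData l) := by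
  funext k
  rcases k with _ | (_ | _ | _ | _) <;> rfl

/-- The additional first bit in `hea` accounts for encodings by bracketed words, in which an
opening bracket makes a word an entry of a list. -/
theorem PolyTime.computable {α : Type} [TreeCode α] {A : Type} [Finite A]
    {code : A → List Bool} {ea : α → List A}
    (hea : ∀ x, (ea x).flatMap code = true :: StackProg.treeBits (TreeCode.toTree x)) {f : α → Bool}
    (hf : PolyTime f) : Nonempty (TM2ComputableInPolyTime ea encodeBool f) := by
  classical
  have : Fintype A := Fintype.ofFinite A
  obtain ⟨P, t, ⟨p, hp⟩, hP⟩ := hf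
  obtain ⟨n, hn⟩ : ∃ n, ∀ a, (code a).length ≤ n :=
    ⟨Finset.univ.sup fun a => (code a).length, fun a => Finset.le_sup (f := fun a =>
      (code a).length) (Finset.mem_univ a)⟩
  refine computable_of_run (Γ := WithInput A fun _ : Work => Bool) (k₀ := none) (k₁ := some data)
    (p := .seq (readInput code) (lift A (.seq (.pop data) (.seq P decodeBool))))
    (time := .C (Fintype.card A + 7 * n + 3) * .X + .C 2 + (1 + (p.comp (.C n * .X) + 5)))
    fun x => ?_
  have size_le : size x ≤ n * (ea x).length := by
    have := length_flatMap_le hn (ea x)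
    rw [hea, List.length_cons] at this
    exact (Nat.le_succ _).trans this
  have time_le : t x ≤ p.eval (n * (ea x).length) := (hp x).trans (monotone_eval p size_le)
  have compute : Run (.seq (.pop data) (.seq P decodeBool)) (onData ((ea x).flatMap code))
      (1 + (t x + 5)) (onData [f x]) := by
    have dropFirst : Run (.pop data) (onData ((ea x).flatMap code)) 1 (onTop x []) :=
      .pop_of_eq (by simp [hea, onTop])
    exact dropFirst.seq ((hP x []).seq (run_decodeBool _))
  rw [update_none_eq_consInput, update_data_eq_consInput]
  refine ((run_readInput hn _).seq (compute.lift [])).mono ?_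
  simp only [Polynomial.eval_add, Polynomial.eval_mul, Polynomial.eval_comp, Polynomial.eval_C,
    Polynomial.eval_X, Polynomial.eval_one, Polynomial.eval_ofNat]
  omega

end StackProg

/-! ### Trees of instances -/

namespace StackProg

open TreeCode

variable {α β : Type} [TreeCode α] [TreeCode β]

instance : TreeCode (α ⊕ β) :=
  ⟨Sum.elim (fun a => toTree [toTree [false], toTree a])
    fun b => toTree [toTree [true], toTree b]⟩

instance [InjTreeCode α] [InjTreeCode β] : InjTreeCode (α ⊕ β) :=
  ⟨by
    have entries_eq {ds es : List (BinaryTree Unit)} (h : toTree ds = toTree es) : ds = es :=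
      InjTreeCode.injective h
    rintro (a | b) (a' | b') h
    · rw [InjTreeCode.injective (List.cons.inj (List.cons.inj (entries_eq h)).2).1]
    · cases (InjTreeCode.injective (List.cons.inj (entries_eq h)).1 : [false] = [true])
    · cases (InjTreeCode.injective (List.cons.inj (entries_eq h)).1 : [true] = [false])
    · rw [InjTreeCode.injective (List.cons.inj (List.cons.inj (entries_eq h)).2).1]⟩

end StackProg

namespace Atch

open StackProg TreeCode

section Words

instance : Finite Sym :=
  .of_surjective ![Sym.lpar, .rpar, .zero, .one] fun s =>
    match s with
    | .lpar => ⟨0, rfl⟩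
    | .rpar => ⟨1, rfl⟩
    | .zero => ⟨2, rfl⟩
    | .one => ⟨3, rfl⟩

/-- The bits that a symbol of an input word contributes to the code of the tree of the word. -/
def symBits : Sym → List Bool
  | .lpar => [true]
  | .rpar => [false]
  | .zero => [true, false]
  | .one => [true, true, false, false]

/-- The word `w` contributes the entry `d` to the list of a pair of brackets that contains it. -/
def Encodes (w : List Sym) (d : BinaryTree Unit) : Prop := w.flatMap symBits = true :: treeBits d

namespace Encodes

variable {α β : Type} [TreeCode β]

theorem group {ws : List (List Sym)} {ds : List (BinaryTree Unit)}
    (h : List.Forall₂ Encodes ws ds) : Encodes (group ws) (toTree ds) := by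
  have entries : (ws.flatten ++ [Sym.rpar]).flatMap symBits = treeBits (toTree ds) := by
    induction h with
    | nil => rfl
    | @cons w d ws ds h _ ih =>
      rw [toTree_cons, treeBits, ← ih, ← List.cons_append, toTree_tree, ← h, List.flatten_cons,
        List.append_assoc, List.flatMap_append]
  exact congrArg (true :: ·) entries

theorem bits (l : List Bool) : Encodes (encBits l) (toTree l) := by
  have entries : ((l.map fun b => if b then Sym.one else Sym.zero) ++ [Sym.rpar]).flatMap symBits =
      treeBits (toTree l) := by
    induction l with
    | nil => rfl
    | cons b l ih =>
      rw [toTree_cons, treeBits, ← ih]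
      cases b <;> rfl
  rw [Encodes, ← entries, encBits, Atch.group, List.flatten_singleton]
  rfl

theorem list_map {f : α → List Sym} {g : α → β} (h : ∀ a, Encodes (f a) (toTree (g a)))
    (l : List α) : Encodes (encList f l) (toTree (l.map g)) := by
  have tree_eq : toTree (l.map g) = toTree (l.map fun a => toTree (g a)) := by
    induction l with
    | nil => rfl
    | cons a l ih => exact congrArg (toTree (g a) △ ·) ih
  rw [tree_eq]
  refine group ?_
  rw [List.forall₂_map_left_iff, List.forall₂_map_right_iff]
  exact List.forall₂_same.mpr fun a _ => h a

theorem list {f : β → List Sym} (h : ∀ a, Encodes (f a) (toTree a)) (l : List β) :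
    Encodes (encList f l) (toTree l) := by
  simpa using list_map (g := id) h l

theorem fun_comp {n : ℕ} {f : α → List Sym} {g : α → β} (h : ∀ a, Encodes (f a) (toTree (g a)))
    (k : Fin n → α) : Encodes (encFun f k) (toTree (List.ofFn fun i => g (k i))) := by
  have encodes := list_map h (List.ofFn k)
  rwa [List.map_ofFn] at encodes

theorem ofFn {n : ℕ} {f : β → List Sym} (h : ∀ a, Encodes (f a) (toTree a)) (k : Fin n → β) :
    Encodes (encFun f k) (toTree (List.ofFn k)) :=
  fun_comp (g := id) h k

theorem nat (n : ℕ) : Encodes (encNat n) (toTree n) := bits n.bits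

theorem rat (q : ℚ) : Encodes (encRat q) (toTree q) :=
  group (.cons (bits _) (.cons (nat _) (.cons (nat _) .nil)))

end Encodes

end Words

/-- The tree of a property, that is, of the list of its key and its value. -/
def propertyTree (p : Property) : BinaryTree Unit := toTree [toTree p.1, toTree p.2]

theorem propertyTree_injective : Function.Injective propertyTree := fun p q h => by
  have entries_eq := InjTreeCode.injective (α := List (BinaryTree Unit)) h
  simp only [List.cons.injEq, and_true] at entries_eq
  exact Prod.ext (InjTreeCode.injective entries_eq.1) (InjTreeCode.injective entries_eq.2)

theorem Encodes.property (p : Property) : Encodes (encProperty p) (propertyTree p) :=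
  group (.cons (bits _) (.cons (bits _) .nil))

theorem Encodes.obj : ∀ o : Obj, Encodes (encObj o) (toTree o)
  | .inl _ => group (.cons (bits _) (.cons (nat _) .nil))
  | .inr _ => group (.cons (bits _) (.cons (nat _) .nil))

/-- Terms as a disjoint union. -/
def termSum : Term → ℕ ⊕ Obj
  | .var x => .inl x
  | .const o => .inr o

theorem termSum_injective : Function.Injective termSum := by
  rintro (x | o) (y | o') h <;> cases h <;> rfl

instance : DecidableEq Term := termSum_injective.decidableEq
instance : TreeCode Term := ⟨fun t => toTree (termSum t)⟩
instance : InjTreeCode Term := ⟨fun _ _ h =>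
  termSum_injective (InjTreeCode.injective h)⟩

theorem Encodes.term : ∀ t : Term, Encodes (encTerm t) (toTree t)
  | .var _ => group (.cons (bits _) (.cons (nat _) .nil))
  | .const _ => group (.cons (bits _) (.cons (obj _) .nil))

instance : TreeCode Interval := ⟨fun I => toTree [toTree I.lower.toList, toTree I.upper.toList]⟩

theorem Encodes.interval (I : Interval) : Encodes (encInterval I) (toTree I) :=
  group (.cons (list rat _) (.cons (list rat _) .nil))

section Hypergraph

/-- The participants of a hyperedge, by name. -/
def participantNames (H : Hypergraph) (e : Fin H.numE) : List Obj := (H.nodes e).map H.name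

/-- The properties of a vertex, as trees. -/
def vertexProperties (H : Hypergraph) (v : Fin H.numV) : List (BinaryTree Unit) :=
  (H.vertexAttr v).map propertyTree

/-- The properties of a hyperedge, as trees. -/
def edgeProperties (H : Hypergraph) (e : Fin H.numE) : List (BinaryTree Unit) :=
  (H.edgeAttr e).map propertyTree

/-- The row of a hyperedge in the matrix of the causal order. -/
def precRow (H : Hypergraph) (e : Fin H.numE) : List Bool := List.ofFn (H.prec e)

instance : TreeCode Hypergraph :=
  ⟨fun H => toTree [toTree (List.ofFn (vertexProperties H)),
    toTree (List.ofFn (participantNames H)), toTree (List.ofFn (edgeProperties H)),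
    toTree (List.ofFn H.validTime), toTree (List.ofFn H.transTime), toTree (List.ofFn H.conf),
    toTree (List.ofFn (precRow H))]⟩

theorem Encodes.hypergraph (H : Hypergraph) : Encodes (encHypergraph H) (toTree H) := by
  have vertexProperties_enc := fun_comp (list_map (g := propertyTree) property) H.vertexAttr
  have edgeProperties_enc := fun_comp (list_map (g := propertyTree) property) H.edgeAttr
  have participants_enc := fun_comp (list_map fun o => obj (H.name o)) H.nodes
  have prec_enc := fun_comp (g := List.ofFn) (fun row => bits (List.ofFn row)) H.prec
  exact group (.cons vertexProperties_enc (.cons participants_enc (.cons edgeProperties_enc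
    (.cons (ofFn interval _) (.cons (ofFn interval _) (.cons (ofFn rat _)
    (.cons prec_enc .nil)))))))

end Hypergraph

/-- The number that encodes a range predicate. -/
def relCode : RangePred → ℕ
  | .within => 0
  | .covers => 1
  | .overlaps => 2

instance : TreeCode RangePred := ⟨fun r => toTree (relCode r)⟩

theorem Encodes.rangePred : ∀ r : RangePred, Encodes (encRangePred r) (toTree r)
  | .within => nat 0
  | .covers => nat 1
  | .overlaps => nat 2

instance : TreeCode Atom :=
  ⟨fun
    | .hyperedge z ts => toTree [toTree 0, toTree z, toTree ts]
    | .participant t z => toTree [toTree 1, toTree t, toTree z]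
    | .vertexAttr t p => toTree [toTree 2, toTree t, propertyTree p]
    | .edgeAttr z p => toTree [toTree 3, toTree z, propertyTree p]
    | .window z r W =>
        toTree [toTree 4, toTree z, toTree r, toTree W.lo, toTree W.hi]
    | .confGe z θ => toTree [toTree 5, toTree z, toTree θ]
    | .confGt z θ => toTree [toTree 6, toTree z, toTree θ]⟩

theorem Encodes.atom : ∀ a : Atom, Encodes (encAtom a) (toTree a)
  | .hyperedge _ _ => group (.cons (nat _) (.cons (term _) (.cons (list term _) .nil)))
  | .participant _ _ => group (.cons (nat _) (.cons (term _) (.cons (term _) .nil)))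
  | .vertexAttr _ _ => group (.cons (nat _) (.cons (term _) (.cons (property _) .nil)))
  | .edgeAttr _ _ => group (.cons (nat _) (.cons (term _) (.cons (property _) .nil)))
  | .window _ _ _ => group (.cons (nat _) (.cons (term _) (.cons (rangePred _)
      (.cons (rat _) (.cons (rat _) .nil)))))
  | .confGe _ _ => group (.cons (nat _) (.cons (term _) (.cons (rat _) .nil)))
  | .confGt _ _ => group (.cons (nat _) (.cons (term _) (.cons (rat _) .nil)))

instance : TreeCode Query := ⟨fun Q => toTree [toTree Q.atoms, toTree Q.chains, toTree Q.output]⟩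

theorem Encodes.query (Q : Query) : Encodes (encQuery Q) (toTree Q) :=
  group (.cons (list atom _) (.cons (list (list term) _) (.cons (list nat _) .nil)))

instance : TreeCode Instance := ⟨fun x => toTree [toTree x.db, toTree x.query, toTree x.tuple]⟩

theorem Encodes.instance (x : Instance) : Encodes (encInstance x) (toTree x) :=
  group (.cons (hypergraph _) (.cons (query _) (.cons (list obj _) .nil)))

end Atch

/-! ### Selections from lists -/

namespace StackProg

open TreeCode

variable {α β γ : Type}

section Selections

/-- The ways to single out an entry of a list: the entry and the list of all other entries. -/
def selections (l : List β) : List (β × List β) :=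
  l.zipIdx.map fun p => (p.1, (l.zipIdx.filter fun q => !decide (q.2 = p.2)).map Prod.fst)

theorem perm_cons_filter_of_nodup_map [DecidableEq γ] (key : β → γ) {l : List β}
    (hl : (l.map key).Nodup) {b : β} (hb : b ∈ l) :
    l.Perm (b :: l.filter fun c => !decide (key c = key b)) := by
  induction l with
  | nil => cases hb
  | cons a l ih =>
    obtain ⟨ha, hl⟩ := List.nodup_cons.1 hl
    have key_ne {c : β} (hc : c ∈ l) : key c ≠ key a := fun h => ha (h ▸ List.mem_map_of_mem hc)
    obtain rfl | hb := List.mem_cons.1 hb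
    · have filter_eq : (l.filter fun c => !decide (key c = key b)) = l :=
        List.filter_eq_self.2 fun c hc => by simpa using key_ne hc
      rw [List.filter_cons_of_neg (by simp), filter_eq]
    · rw [List.filter_cons_of_pos (by simpa using (key_ne hb).symm)]
      exact ((ih hl hb).cons a).trans (.swap _ _ _)

theorem perm_of_mem_selections {l : List β} {p : β × List β} (h : p ∈ selections l) :
    l.Perm (p.1 :: p.2) := by
  obtain ⟨q, hq, rfl⟩ := List.mem_map.1 h
  have nodup : (l.zipIdx.map Prod.snd).Nodup := by
    rw [List.zipIdx_map_snd]
    exact List.nodup_range'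
  have perm := (perm_cons_filter_of_nodup_map Prod.snd nodup hq).map Prod.fst
  rwa [List.zipIdx_map_fst] at perm

theorem exists_mem_selections {l : List β} {b : β} (h : b ∈ l) : ∃ k, (b, k) ∈ selections l := by
  rw [← List.zipIdx_map_fst 0 l] at h
  obtain ⟨p, hp, rfl⟩ := List.mem_map.1 h
  exact ⟨_, List.mem_map_of_mem hp⟩

theorem sublist_of_mem_selections {l : List β} {p : β × List β} (h : p ∈ selections l) :
    p.2.Sublist l := by
  obtain ⟨q, -, rfl⟩ := List.mem_map.1 h
  simpa only [List.zipIdx_map_fst] using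
    List.filter_sublist.map (l₂ := l.zipIdx) Prod.fst

/-- The ways to split a list into at most `c` entries and the list of all other entries. -/
def splits : ℕ → List β → List (List β × List β)
  | 0, l => [([], l)]
  | c + 1, l => splits c l ++ (splits c l).flatMap fun p =>
      (selections p.2).map fun q => (q.1 :: p.1, q.2)

/-- The lists of at most `k` entries of a list. -/
def listsUpTo (l : List β) : ℕ → List (List β)
  | 0 => [[]]
  | k + 1 => [] :: (listsUpTo l k).flatMap fun m => l.map fun b => b :: m

end Selections

namespace PolyTime

variable [TreeCode α] [TreeCode β] [TreeCode γ]

@[fun_prop]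
theorem inl {f : α → β} (hf : PolyTime f) : PolyTime fun x => (Sum.inl (f x) : β ⊕ γ) :=
  (cons (const (TreeCode.toTree [false])) (cons hf.toTree (const []))).of_toTree_eq fun _ => rfl

@[fun_prop]
theorem inr {f : α → γ} (hf : PolyTime f) : PolyTime fun x => (Sum.inr (f x) : β ⊕ γ) :=
  (cons (const (TreeCode.toTree [true])) (cons hf.toTree (const []))).of_toTree_eq fun _ => rfl

@[fun_prop]
theorem zipIdx {l : α → List β} (hl : PolyTime l) : PolyTime fun x => (l x).zipIdx := by
  have := range_length hl
  simp only [List.zipIdx_eq_zip_range', ← List.range_eq_range']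
  fun_prop

@[fun_prop]
theorem selections {l : α → List β} (hl : PolyTime l) : PolyTime fun x => selections (l x) := by
  unfold StackProg.selections
  fun_prop

@[fun_prop]
theorem splits (c : ℕ) {l : α → List β} (hl : PolyTime l) : PolyTime fun x => splits c (l x) := by
  induction c with
  | zero => unfold StackProg.splits; fun_prop
  | succ c ih => unfold StackProg.splits; fun_prop

@[fun_prop]
theorem listsUpTo {l : α → List β} (hl : PolyTime l) (k : ℕ) :
    PolyTime fun x => listsUpTo (l x) k := by
  induction k with
  | zero => unfold StackProg.listsUpTo; fun_prop
  | succ k ih => unfold StackProg.listsUpTo; fun_prop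

end PolyTime

end StackProg

/-! ### Acyclicity by the removal of ears -/

namespace Atch

section Ears

variable {α : Type} [DecidableEq α]

/-- The points that `e` shares with the members of `F` all lie in `f`. -/
def SharedIn (f e : Finset α) (F : Multiset (Finset α)) : Prop := ∀ g ∈ F, e ∩ g ⊆ f

/-- A set is an ear of a family if the points that it shares with the members of the family all
lie in a single member. -/
def IsEar (e : Finset α) (F : Multiset (Finset α)) : Prop := F = 0 ∨ ∃ f ∈ F, SharedIn f e F

/-- The families that the successive removal of ears makes empty. -/
inductive EarReducible : Multiset (Finset α) → Prop
  | zero : EarReducible 0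
  | cons {e F} : IsEar e F → EarReducible F → EarReducible (e ::ₘ F)

variable {e f g i k : Finset α} {F G : Multiset (Finset α)}

theorem SharedIn.mono (h : SharedIn f e F) (hGF : G ⊆ F) : SharedIn f e G :=
  fun g hg => h g (hGF hg)

theorem SharedIn.trans (hef : SharedIn f e F) (hfg : SharedIn g f F) : SharedIn g e F :=
  fun m hm _ hx => hfg m hm (Finset.mem_inter.2 ⟨hef m hm hx, (Finset.mem_inter.1 hx).2⟩)

theorem IsEar.of_inter_eq (he : IsEar i F) (hik : ∀ m ∈ F, i ∩ m = k ∩ m) : IsEar k F :=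
  he.imp_right fun ⟨f, hf, shared⟩ => ⟨f, hf, fun m hm => hik m hm ▸ shared m hm⟩

theorem IsEar.replace (he : IsEar e (i ::ₘ G)) (hik : ∀ m ∈ e ::ₘ G, i ∩ m = k ∩ m) :
    IsEar e (k ::ₘ G) := by
  obtain h | ⟨f, hf, shared⟩ := he
  · cases Multiset.cons_ne_zero h
  have inter_eq : e ∩ i = e ∩ k := by
    rw [Finset.inter_comm, hik e (Multiset.mem_cons_self _ _), Finset.inter_comm]
  have shared' : SharedIn f e (k ::ₘ G) := Multiset.forall_mem_cons.2
    ⟨inter_eq ▸ shared i (Multiset.mem_cons_self _ _),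
      shared.mono (Multiset.subset_cons _ _)⟩
  obtain rfl | hf := Multiset.mem_cons.1 hf
  · refine .inr ⟨k, Multiset.mem_cons_self _ _, fun g hg x hx => ?_⟩
    have hx' := Finset.mem_inter.2 ⟨(Finset.mem_inter.1 hx).1, shared' g hg hx⟩
    exact (Finset.mem_inter.1 (inter_eq ▸ hx')).2
  · exact .inr ⟨f, Multiset.mem_cons_of_mem hf, shared'⟩

theorem IsEar.inter_eq_or_isEar (hk : IsEar k (e ::ₘ G)) (he : IsEar e (k ::ₘ G)) :
    (∀ m ∈ G, e ∩ m = k ∩ m) ∨ IsEar k G ∧ IsEar e G := by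
  obtain hk | ⟨l, hl, hk⟩ := hk
  · cases Multiset.cons_ne_zero hk
  obtain he | ⟨j, hj, he⟩ := he
  · cases Multiset.cons_ne_zero he
  replace hk := hk.mono (Multiset.subset_cons _ _)
  replace he := he.mono (Multiset.subset_cons _ _)
  obtain rfl | hj := Multiset.mem_cons.1 hj <;> obtain rfl | hl := Multiset.mem_cons.1 hl
  · exact .inl fun m hm => Finset.Subset.antisymm
      (Finset.subset_inter (he m hm) Finset.inter_subset_right)
      (Finset.subset_inter (hk m hm) Finset.inter_subset_right)
  · exact .inr ⟨.inr ⟨l, hl, hk⟩, .inr ⟨l, hl, he.trans hk⟩⟩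
  · exact .inr ⟨.inr ⟨j, hj, hk.trans he⟩, .inr ⟨j, hj, he⟩⟩
  · exact .inr ⟨.inr ⟨l, hl, hk⟩, .inr ⟨j, hj, he⟩⟩

theorem EarReducible.replace (h : EarReducible (i ::ₘ G)) (hik : ∀ m ∈ G, i ∩ m = k ∩ m) :
    EarReducible (k ::ₘ G) := by
  generalize hM : i ::ₘ G = M at h
  induction h generalizing i k G with
  | zero => cases Multiset.cons_ne_zero hM
  | @cons e F he hF ih =>
    obtain ⟨rfl, rfl⟩ | ⟨-, C, rfl, rfl⟩ := Multiset.cons_eq_cons.1 hM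
    · exact .cons (he.of_inter_eq hik) hF
    · rw [Multiset.cons_swap]
      exact .cons (he.replace hik) (ih (fun m hm => hik m (Multiset.mem_cons_of_mem hm)) rfl)

theorem EarReducible.of_cons (h : EarReducible (e ::ₘ F)) (he : IsEar e F) : EarReducible F := by
  generalize hM : e ::ₘ F = M at h
  induction h generalizing e F with
  | zero => cases Multiset.cons_ne_zero hM
  | @cons k F' hk hF' ih =>
    obtain ⟨rfl, rfl⟩ | ⟨-, G, rfl, rfl⟩ := Multiset.cons_eq_cons.1 hM
    · exact hF'
    · obtain inter_eq | ⟨hk, he⟩ := hk.inter_eq_or_isEar he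
      · exact hF'.replace inter_eq
      · exact .cons hk (ih he rfl)

theorem EarReducible.exists_ear (h : EarReducible F) (hne : F ≠ 0) :
    ∃ e G, F = e ::ₘ G ∧ IsEar e G := by
  cases h with
  | zero => exact absurd rfl hne
  | cons he _ => exact ⟨_, _, rfl, he⟩

end Ears

section JoinForests

variable {α ι : Type} {f : ι → Finset α} {s : Finset ι} {T : SimpleGraph ι} {u w : ι}

/-- A forest on the index set of a family of sets in which, for every point, the members with index
in `s` that contain the point are connected. -/
structure IsJoinForest (T : SimpleGraph ι) (f : ι → Finset α) (s : Finset ι) : Prop where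
  isAcyclic : T.IsAcyclic
  preconnected : ∀ x, (T.induce {i | i ∈ s ∧ x ∈ f i}).Preconnected

theorem exists_neighborSet_subsingleton [Finite ι] [Nonempty ι] (hT : T.IsAcyclic) :
    ∃ u, (T.neighborSet u).Subsingleton := by
  obtain ⟨u, v, p, hp, hmax⟩ := SimpleGraph.Walk.exists_isPath_forall_isPath_length_le_length T
  have mem_support : ∀ w, T.Adj u w → w ∈ p.support := by
    intro w hw
    by_contra hmem
    have := hmax _ _ (p.cons hw.symm) (hp.cons hmem)
    rw [SimpleGraph.Walk.length_cons] at this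
    omega
  exact ⟨u, fun a ha b hb => (hT.eq_snd_of_adj_start hp ha (mem_support a ha)).trans
    (hT.eq_snd_of_adj_start hp hb (mem_support b hb)).symm⟩

theorem exists_leaf_of_isAcyclic (hT : T.IsAcyclic) (hs : s.Nonempty) :
    ∃ u ∈ s, {i ∈ T.neighborSet u | i ∈ s}.Subsingleton := by
  have : Nonempty {i | i ∈ s} := hs.to_subtype
  obtain ⟨u, hu⟩ := exists_neighborSet_subsingleton (hT.induce {i | i ∈ s})
  exact ⟨u, u.2, fun a ha b hb =>
    congrArg Subtype.val (hu (x := ⟨a, ha.2⟩) ha.1 (y := ⟨b, hb.2⟩) hb.1)⟩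

theorem IsJoinForest.of_subsingleton (hs : (s : Set ι).Subsingleton) :
    IsJoinForest (⊥ : SimpleGraph ι) f s :=
  ⟨SimpleGraph.isAcyclic_bot, fun _ a b => by rw [Subtype.ext (hs a.2.1 b.2.1)]⟩

section Erase

variable [DecidableEq ι]

theorem map_val_eq_cons_erase (f : ι → Finset α) (hu : u ∈ s) :
    s.val.map f = f u ::ₘ (s.erase u).val.map f := by
  rw [← Multiset.map_cons, Finset.erase_val, Multiset.cons_erase hu]

namespace IsJoinForest

theorem erase_leaf (h : IsJoinForest T f s) (leaf : {i ∈ T.neighborSet u | i ∈ s}.Subsingleton) :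
    IsJoinForest T f (s.erase u) where
  isAcyclic := h.isAcyclic
  preconnected x := by
    have connected := (h.preconnected x).induce_of_degree_eq_one (s := {i | i.1 ≠ u}) (by
      rintro ⟨i, hi⟩ hiu a ha b hb
      obtain rfl : i = u := not_not.1 hiu
      exact Subtype.ext (leaf ⟨ha, a.2.1⟩ ⟨hb, b.2.1⟩))
    refine connected.map
      ⟨fun z => ⟨z.1.1, Finset.mem_erase.2 ⟨z.2, z.1.2.1⟩, z.1.2.2⟩, fun h => h⟩ ?_
    rintro ⟨i, hi, hxi⟩
    exact ⟨⟨⟨i, Finset.mem_of_mem_erase hi, hxi⟩, (Finset.mem_erase.1 hi).1⟩, rfl⟩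

variable [DecidableEq α]

theorem exists_adj (h : IsJoinForest T f s) (hu : u ∈ s) {i : ι} (hi : i ∈ s.erase u) {x : α}
    (hx : x ∈ f u ∩ f i) : ∃ w ∈ s.erase u, T.Adj u w ∧ x ∈ f w := by
  obtain ⟨hxu, hxi⟩ := Finset.mem_inter.1 hx
  obtain ⟨hiu, his⟩ := Finset.mem_erase.1 hi
  obtain ⟨p⟩ := h.preconnected x ⟨u, hu, hxu⟩ ⟨i, his, hxi⟩
  have adj : T.Adj u p.snd := p.adj_snd <| SimpleGraph.Walk.not_nil_of_ne
    fun h => hiu (congrArg Subtype.val h).symm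
  exact ⟨p.snd, Finset.mem_erase.2 ⟨adj.ne', p.snd.2.1⟩, adj, p.snd.2.2⟩

theorem isEar_leaf (h : IsJoinForest T f s) (hu : u ∈ s)
    (leaf : {i ∈ T.neighborSet u | i ∈ s}.Subsingleton) :
    IsEar (f u) ((s.erase u).val.map f) := by
  obtain hempty | ⟨j, hj⟩ := (s.erase u).eq_empty_or_nonempty
  · exact .inl (by rw [hempty]; rfl)
  obtain ⟨w, hw, unique⟩ : ∃ w ∈ s.erase u, ∀ w' ∈ s.erase u, T.Adj u w' → w' = w := by
    by_cases hadj : ∃ w ∈ s.erase u, T.Adj u w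
    · obtain ⟨w, hw, huw⟩ := hadj
      exact ⟨w, hw, fun w' hw' huw' => leaf ⟨huw', Finset.mem_of_mem_erase hw'⟩
        ⟨huw, Finset.mem_of_mem_erase hw⟩⟩
    · exact ⟨j, hj, fun w' hw' huw' => absurd ⟨w', hw', huw'⟩ hadj⟩
  refine .inr ⟨f w, Multiset.mem_map_of_mem f hw, fun g hg x hx => ?_⟩
  obtain ⟨i, hi, rfl⟩ := Multiset.mem_map.1 hg
  obtain ⟨w', hw', huw', hx'⟩ := h.exists_adj hu hi hx
  exact unique w' hw' huw' ▸ hx'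

theorem sup_edge (h : IsJoinForest T f (s.erase u)) (hw : w ∈ s.erase u)
    (isolated : ∀ i, ¬T.Adj u i) (shared : ∀ i ∈ s.erase u, f u ∩ f i ⊆ f w) :
    IsJoinForest (T ⊔ SimpleGraph.edge u w) f s where
  isAcyclic := by
    refine h.isAcyclic.sup_edge_of_not_reachable ?_
    rintro ⟨p⟩
    exact isolated _ (p.adj_snd (SimpleGraph.Walk.not_nil_of_ne (Finset.ne_of_mem_erase hw).symm))
  preconnected x := by
    set A : Set ι := {i | i ∈ s ∧ x ∈ f i}
    set T' := (T ⊔ SimpleGraph.edge u w).induce A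
    let inclusion : T.induce {i | i ∈ s.erase u ∧ x ∈ f i} →g T' :=
      ⟨fun z => ⟨z.1, Finset.mem_of_mem_erase z.2.1, z.2.2⟩, fun h => Or.inl h⟩
    have reachable_old {a b : A} (ha : a.1 ≠ u) (hb : b.1 ≠ u) : T'.Reachable a b :=
      (h.preconnected x ⟨a, Finset.mem_erase.2 ⟨ha, a.2.1⟩, a.2.2⟩
        ⟨b, Finset.mem_erase.2 ⟨hb, b.2.1⟩, b.2.2⟩).map inclusion
    have reachable_new {a b : A} (ha : a.1 = u) (hb : b.1 ≠ u) : T'.Reachable a b := by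
      have hxw : x ∈ f w := shared b (Finset.mem_erase.2 ⟨hb, b.2.1⟩)
        (Finset.mem_inter.2 ⟨ha ▸ a.2.2, b.2.2⟩)
      obtain ⟨hwa, hws⟩ := Finset.mem_erase.1 hw
      refine .trans (v := ⟨w, hws, hxw⟩) (SimpleGraph.Adj.reachable (Or.inr ?_))
        (reachable_old hwa hb)
      exact (SimpleGraph.edge_adj _ _ _ _).2 ⟨.inl ⟨ha, rfl⟩, fun h => hwa (Eq.trans h.symm ha)⟩
    intro a b
    by_cases ha : a.1 = u <;> by_cases hb : b.1 = u
    · rw [Subtype.ext (ha.trans hb.symm)]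
    · exact reachable_new ha hb
    · exact (reachable_new hb ha).symm
    · exact reachable_old ha hb

end IsJoinForest

end Erase

variable [DecidableEq α]

theorem IsJoinForest.earReducible (h : IsJoinForest T f s) : EarReducible (s.val.map f) := by
  classical
  induction s using Finset.strongInduction with
  | H s ih =>
    obtain rfl | hs := s.eq_empty_or_nonempty
    · exact .zero
    obtain ⟨u, hu, leaf⟩ := exists_leaf_of_isAcyclic h.isAcyclic hs
    rw [map_val_eq_cons_erase f hu]
    exact .cons (h.isEar_leaf hu leaf) (ih _ (Finset.erase_ssubset hu) (h.erase_leaf leaf))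

theorem EarReducible.exists_joinForest {F : Multiset (Finset α)} (hF : EarReducible F)
    (hs : s.val.map f = F) :
    ∃ T : SimpleGraph ι, IsJoinForest T f s ∧ ∀ i j, T.Adj i j → i ∈ s := by
  classical
  induction hF generalizing s with
  | zero =>
    obtain rfl : s = ∅ := by simpa using hs
    exact ⟨⊥, .of_subsingleton (by simp), fun _ _ h => h.elim⟩
  | @cons e F he _ ih =>
    obtain ⟨u, hu, rfl, hF⟩ := (Multiset.map_eq_cons f s.val F e).2 hs
    replace hF : (s.erase u).val.map f = F := by rw [Finset.erase_val]; exact hF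
    obtain ⟨T, forest, support⟩ := ih hF
    obtain rfl | ⟨g, hg, shared⟩ := he
    · have erase_eq : s.erase u = ∅ :=
        Finset.val_eq_zero.1 (Multiset.map_eq_zero.1 hF)
      obtain hs | hs := (Finset.erase_eq_empty_iff _ _).1 erase_eq
      all_goals exact ⟨⊥, .of_subsingleton (by simp [hs]), fun _ _ h => h.elim⟩
    obtain ⟨w, hw, rfl⟩ := Multiset.mem_map.1 (hF.symm ▸ hg)
    refine ⟨T ⊔ SimpleGraph.edge u w, forest.sup_edge hw
      (fun i h => Finset.notMem_erase u s (support u i h))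
      (fun i hi => shared _ (hF ▸ Multiset.mem_map_of_mem f hi)), fun i j h => ?_⟩
    obtain h | h := (SimpleGraph.sup_adj _ _ _ _).1 h
    · exact Finset.mem_of_mem_erase (support i j h)
    · obtain ⟨⟨rfl, rfl⟩ | ⟨rfl, rfl⟩, -⟩ := (SimpleGraph.edge_adj _ _ _ _).1 h
      · exact hu
      · exact Finset.mem_of_mem_erase hw

end JoinForests

theorem alphaAcyclic_iff (es : List (Finset ℕ)) :
    AlphaAcyclic es ↔ EarReducible (es : Multiset (Finset ℕ)) := by
  have map_get : (Finset.univ : Finset (Fin es.length)).val.map es.get = es := by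
    rw [Fin.univ_val_map, List.ofFn_get]
  have mem_univ_iff (x : ℕ) : {i | i ∈ Finset.univ ∧ x ∈ es.get i} = {i | x ∈ es.get i} := by simp
  constructor
  · rintro ⟨T, hT, preconnected⟩
    rw [← map_get]
    exact IsJoinForest.earReducible ⟨hT, fun x => (mem_univ_iff x).symm ▸ preconnected x⟩
  · intro h
    obtain ⟨T, forest, -⟩ := h.exists_joinForest map_get
    exact ⟨T, forest.isAcyclic, fun x => mem_univ_iff x ▸ forest.preconnected x⟩

open StackProg TreeCode

section EarTests

variable {β : Type} [DecidableEq β]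

/-- A test for ears in families of sets that are given by lists. -/
def earTest (e : List β) (F : List (List β)) : Bool :=
  F.isEmpty || F.any fun f => F.all fun g => e.all fun t => !decide (t ∈ g) || decide (t ∈ f)

/-- Removes the first ear of a family of sets, and nothing if there is none. -/
def removeEar (F : List (List β)) : List (List β) :=
  listCase ((selections F).filter fun p => earTest p.1 p.2) F fun p _ => p.2

/-- A test for the acyclicity of families of sets that are given by lists. -/
def acyclicTest (F : List (List β)) : Bool := (removeEar^[F.length] F).isEmpty

theorem removeEar_spec (F : List (List β)) :
    (removeEar F = F ∧ ∀ p ∈ selections F, ¬earTest p.1 p.2) ∨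
      ∃ p ∈ selections F, earTest p.1 p.2 ∧ removeEar F = p.2 := by
  cases h : (selections F).filter fun p => earTest p.1 p.2 with
  | nil => exact .inl ⟨by rw [removeEar, h]; rfl, List.filter_eq_nil_iff.1 h⟩
  | cons p l =>
    have mem : p ∈ (selections F).filter fun p => earTest p.1 p.2 := h ▸ List.mem_cons_self
    obtain ⟨hp, ear⟩ := List.mem_filter.1 mem
    exact .inr ⟨p, hp, ear, by rw [removeEar, h]; rfl⟩

theorem removeEar_sublist (F : List (List β)) : (removeEar F).Sublist F := by
  obtain ⟨h, -⟩ | ⟨p, hp, -, h⟩ := removeEar_spec F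
  · rw [h]
  · rw [h]
    exact sublist_of_mem_selections hp

theorem earTest_iff (e : List β) (F : List (List β)) :
    earTest e F = true ↔ IsEar e.toFinset (F.map List.toFinset : Multiset (Finset β)) := by
  have shared (f g : List β) : (e.all fun t => !decide (t ∈ g) || decide (t ∈ f)) = true ↔
      e.toFinset ∩ g.toFinset ⊆ f.toFinset := by
    simp [Finset.subset_iff, imp_iff_not_or, or_assoc]
  simp [earTest, IsEar, SharedIn, shared]

theorem coe_map_toFinset_eq_cons {F : List (List β)} {p : List β × List (List β)}
    (hp : p ∈ selections F) : ((F.map List.toFinset : List (Finset β)) : Multiset (Finset β)) =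
      p.1.toFinset ::ₘ (p.2.map List.toFinset : List (Finset β)) :=
  Multiset.coe_eq_coe.2 ((perm_of_mem_selections hp).map List.toFinset)

theorem not_earReducible_of_forall_not_earTest {F : List (List β)} (hne : F ≠ [])
    (hF : ∀ p ∈ selections F, ¬earTest p.1 p.2) :
    ¬EarReducible (F.map List.toFinset : Multiset (Finset β)) := by
  intro reducible
  obtain ⟨e, G, hG, he⟩ := reducible.exists_ear (by simpa using hne)
  have mem : e ∈ F.map List.toFinset := Multiset.mem_coe.1 (hG ▸ Multiset.mem_cons_self e G)
  obtain ⟨t, ht, rfl⟩ := List.mem_map.1 mem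
  obtain ⟨k, hk⟩ := exists_mem_selections ht
  have eq_rest := (Multiset.cons_inj_right _).1 (hG.symm.trans (coe_map_toFinset_eq_cons hk))
  exact hF _ hk ((earTest_iff _ _).2 (eq_rest ▸ he))

theorem isEmpty_iterate_removeEar_iff {n : ℕ} {F : List (List β)} (hF : F.length = n) :
    (removeEar^[n] F).isEmpty = true ↔
      EarReducible (F.map List.toFinset : Multiset (Finset β)) := by
  induction n generalizing F with
  | zero =>
    obtain rfl := List.length_eq_zero_iff.1 hF
    exact iff_of_true rfl .zero
  | succ n ih =>
    have hne : F ≠ [] := List.ne_nil_of_length_eq_add_one hF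
    obtain ⟨h, no_ear⟩ | ⟨p, hp, ear, h⟩ := removeEar_spec F
    · rw [Function.iterate_fixed h]
      exact iff_of_false (by simpa using hne) (not_earReducible_of_forall_not_earTest hne no_ear)
    · have length_eq : p.2.length = n := by
        have := (perm_of_mem_selections hp).length_eq
        rw [List.length_cons] at this
        omega
      replace ear := (earTest_iff _ _).1 ear
      rw [Function.iterate_succ_apply, h, ih length_eq, coe_map_toFinset_eq_cons hp]
      exact ⟨.cons ear, fun h => h.of_cons ear⟩

theorem acyclicTest_iff (F : List (List β)) :
    acyclicTest F = true ↔ EarReducible (F.map List.toFinset : Multiset (Finset β)) :=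
  isEmpty_iterate_removeEar_iff rfl

variable {α : Type} [TreeCode α] [TreeCode β] [InjTreeCode β]

@[fun_prop]
theorem polyTime_earTest {e : α → List β} {F : α → List (List β)} (he : PolyTime e)
    (hF : PolyTime F) : PolyTime fun x => earTest (e x) (F x) := by
  unfold earTest
  fun_prop

@[fun_prop]
theorem polyTime_acyclicTest {F : α → List (List β)} (hF : PolyTime F) :
    PolyTime fun x => acyclicTest (F x) := by
  have removal : PolyTime fun p : α × List (List β) => removeEar p.2 := by
    unfold removeEar
    fun_prop
  exact (PolyTime.iterate hF hF removal
    fun _ F => size_le_of_sublist (removeEar_sublist F)).isEmpty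

end EarTests

end Atch

/-! ### Access to the parts of an instance -/

namespace Atch

open StackProg TreeCode

variable {α : Type} [TreeCode α]

section Terms

/-- The variable of a term, if it has one, as a list. -/
def varList : Term → List ℕ
  | .var x => [x]
  | .const _ => []

@[fun_prop]
theorem polyTime_var {f : α → ℕ} (hf : PolyTime f) : PolyTime fun x => Term.var (f x) :=
  (PolyTime.inl (γ := Obj) hf).of_toTree_eq fun _ => rfl

@[fun_prop]
theorem polyTime_const {f : α → Obj} (hf : PolyTime f) : PolyTime fun x => Term.const (f x) :=
  (PolyTime.inr (β := ℕ) hf).of_toTree_eq fun _ => rfl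

@[fun_prop]
theorem polyTime_varList {f : α → Term} (hf : PolyTime f) : PolyTime fun x => varList (f x) := by
  have := hf.toTree
  exact (by fun_prop : PolyTime fun x => bif decide ((toTree (f x)).left = toTree [false]) then
    (toTree (f x)).right else .nil).of_toTree_eq fun x => by cases f x <;> rfl

end Terms

section Atoms

/-- The number that encodes the kind of an atom. -/
def atomKind : Atom → ℕ
  | .hyperedge _ _ => 0
  | .participant _ _ => 1
  | .vertexAttr _ _ => 2
  | .edgeAttr _ _ => 3
  | .window _ _ _ => 4
  | .confGe _ _ => 5
  | .confGt _ _ => 6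

/-- The first term of an atom. -/
def atomTerm : Atom → Term
  | .hyperedge z _ => z
  | .participant t _ => t
  | .vertexAttr t _ => t
  | .edgeAttr z _ => z
  | .window z _ _ => z
  | .confGe z _ => z
  | .confGt z _ => z

/-- The terms of an atom except for the first. -/
def atomTerms : Atom → List Term
  | .hyperedge _ ts => ts
  | .participant _ z => [z]
  | _ => []

/-- The property that an atom asks for, as a tree; `nil` if there is none. -/
def atomProperty : Atom → BinaryTree Unit
  | .vertexAttr _ p => propertyTree p
  | .edgeAttr _ p => propertyTree p
  | _ => .nil

/-- The range predicate of an atom; `within` if there is none. -/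
def atomRangePred : Atom → RangePred
  | .window _ r _ => r
  | _ => .within

/-- The threshold of an atom or the lower end of its window; `0` if there is none. -/
def atomLower : Atom → ℚ
  | .window _ _ W => W.lo
  | .confGe _ θ => θ
  | .confGt _ θ => θ
  | _ => 0

/-- The upper end of the window of an atom; `0` if there is none. -/
def atomUpper : Atom → ℚ
  | .window _ _ W => W.hi
  | _ => 0

variable {f : α → Atom}

@[fun_prop]
theorem polyTime_atomKind (hf : PolyTime f) : PolyTime fun x => atomKind (f x) :=
  hf.toTree.left.of_toTree_eq fun x => by cases f x <;> rfl

@[fun_prop]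
theorem polyTime_atomTerm (hf : PolyTime f) : PolyTime fun x => atomTerm (f x) :=
  hf.toTree.right.left.of_toTree_eq fun x => by cases f x <;> rfl

@[fun_prop]
theorem polyTime_atomTerms (hf : PolyTime f) : PolyTime fun x => atomTerms (f x) := by
  have := hf.toTree
  exact (by fun_prop : PolyTime fun x => bif decide (atomKind (f x) = 0) then
    (toTree (f x)).right.right.left else bif decide (atomKind (f x) = 1) then
    (toTree (f x)).right.right else .nil).of_toTree_eq fun x => by cases f x <;> rfl

@[fun_prop]
theorem polyTime_atomProperty (hf : PolyTime f) : PolyTime fun x => atomProperty (f x) := by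
  have := hf.toTree
  exact (by fun_prop : PolyTime fun x =>
    bif decide (atomKind (f x) = 2) || decide (atomKind (f x) = 3) then
    (toTree (f x)).right.right.left else .nil).of_toTree_eq fun x => by cases f x <;> rfl

@[fun_prop]
theorem polyTime_atomRangePred (hf : PolyTime f) : PolyTime fun x => atomRangePred (f x) := by
  have := hf.toTree
  exact (by fun_prop : PolyTime fun x => bif decide (atomKind (f x) = 4) then
    (toTree (f x)).right.right.left else .nil).of_toTree_eq fun x => by cases f x <;> rfl

@[fun_prop]
theorem polyTime_atomLower (hf : PolyTime f) : PolyTime fun x => atomLower (f x) := by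
  have := hf.toTree
  exact (by fun_prop : PolyTime fun x => bif decide (atomKind (f x) = 4) then
    (toTree (f x)).right.right.right.left else
    bif decide (atomKind (f x) = 5) || decide (atomKind (f x) = 6) then
    (toTree (f x)).right.right.left else toTree (0 : ℚ)).of_toTree_eq fun x => by cases f x <;> rfl

@[fun_prop]
theorem polyTime_atomUpper (hf : PolyTime f) : PolyTime fun x => atomUpper (f x) := by
  have := hf.toTree
  exact (by fun_prop : PolyTime fun x => bif decide (atomKind (f x) = 4) then
    (toTree (f x)).right.right.right.right.left else
    toTree (0 : ℚ)).of_toTree_eq fun x => by cases f x <;> rfl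

@[fun_prop]
theorem polyTime_relCode {r : α → RangePred} (hr : PolyTime r) :
    PolyTime fun x => relCode (r x) :=
  hr.of_toTree_eq fun _ => rfl

end Atoms

section Queries

@[fun_prop]
theorem polyTime_atoms {f : α → Query} (hf : PolyTime f) : PolyTime fun x => (f x).atoms :=
  hf.toTree.left.of_toTree_eq fun _ => rfl

@[fun_prop]
theorem polyTime_chains {f : α → Query} (hf : PolyTime f) : PolyTime fun x => (f x).chains :=
  hf.toTree.right.left.of_toTree_eq fun _ => rfl

@[fun_prop]
theorem polyTime_output {f : α → Query} (hf : PolyTime f) : PolyTime fun x => (f x).output :=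
  hf.toTree.right.right.left.of_toTree_eq fun _ => rfl

@[fun_prop]
theorem polyTime_db {f : α → Instance} (hf : PolyTime f) : PolyTime fun x => (f x).db :=
  hf.toTree.left.of_toTree_eq fun _ => rfl

@[fun_prop]
theorem polyTime_query {f : α → Instance} (hf : PolyTime f) : PolyTime fun x => (f x).query :=
  hf.toTree.right.left.of_toTree_eq fun _ => rfl

@[fun_prop]
theorem polyTime_tuple {f : α → Instance} (hf : PolyTime f) : PolyTime fun x => (f x).tuple :=
  hf.toTree.right.right.left.of_toTree_eq fun _ => rfl

end Queries

section Intervals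

variable {f : α → Interval}

@[fun_prop]
theorem polyTime_lower (hf : PolyTime f) : PolyTime fun x => (f x).lower.toList :=
  hf.toTree.left.of_toTree_eq fun _ => rfl

@[fun_prop]
theorem polyTime_upper (hf : PolyTime f) : PolyTime fun x => (f x).upper.toList :=
  hf.toTree.right.left.of_toTree_eq fun _ => rfl

end Intervals

section EdgeRecords

/-- A hyperedge with the data that the atoms of a query refer to. -/
structure EdgeRecord where
  name : Obj
  participants : List Obj
  properties : List (BinaryTree Unit)
  validTime : Interval
  conf : ℚ

instance : TreeCode EdgeRecord :=
  ⟨fun r => toTree (r.name, r.participants, r.properties, r.validTime, r.conf)⟩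

variable {f : α → EdgeRecord}

@[fun_prop]
theorem polyTime_name (hf : PolyTime f) : PolyTime fun x => (f x).name :=
  hf.toTree.left.of_toTree_eq fun _ => rfl

@[fun_prop]
theorem polyTime_participants (hf : PolyTime f) : PolyTime fun x => (f x).participants :=
  hf.toTree.right.left.of_toTree_eq fun _ => rfl

@[fun_prop]
theorem polyTime_properties (hf : PolyTime f) : PolyTime fun x => (f x).properties :=
  hf.toTree.right.right.left.of_toTree_eq fun _ => rfl

@[fun_prop]
theorem polyTime_validTime (hf : PolyTime f) : PolyTime fun x => (f x).validTime :=
  hf.toTree.right.right.right.left.of_toTree_eq fun _ => rfl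

@[fun_prop]
theorem polyTime_conf (hf : PolyTime f) : PolyTime fun x => (f x).conf :=
  hf.toTree.right.right.right.right.of_toTree_eq fun _ => rfl

end EdgeRecords

section Databases

/-- The name of a hyperedge. -/
def edgeName (H : Hypergraph) (e : Fin H.numE) : Obj := H.name (.inr e)

/-- The names of the hyperedges. -/
def edgeNames (H : Hypergraph) : List Obj := List.ofFn (edgeName H)

/-- The names of the vertices. -/
def vertexNames (H : Hypergraph) : List Obj := List.ofFn fun v => H.name (.inl v)

/-- The record of a hyperedge. -/
def edgeRecord (H : Hypergraph) (e : Fin H.numE) : EdgeRecord :=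
  ⟨edgeName H e, participantNames H e, edgeProperties H e, H.validTime e, H.conf e⟩

/-- The records of the hyperedges. -/
def edgeRecords (H : Hypergraph) : List EdgeRecord := List.ofFn (edgeRecord H)

/-- The names of the vertices with their properties. -/
def vertexRecords (H : Hypergraph) : List (Obj × List (BinaryTree Unit)) :=
  List.ofFn fun v => (H.name (.inl v), vertexProperties H v)

/-- The pairs of names in the causal order. -/
def precPairs (H : Hypergraph) : List (Obj × Obj) :=
  ((edgeNames H).zip (List.ofFn (precRow H))).flatMap fun p =>
    ((p.2.zip (edgeNames H)).filter fun q => q.1).map fun q => (p.1, q.2)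

theorem zip_ofFn {β γ : Type} {n : ℕ} (f : Fin n → β) (g : Fin n → γ) :
    (List.ofFn f).zip (List.ofFn g) = List.ofFn fun i => (f i, g i) :=
  List.ext_getElem (by simp) fun i _ _ => by simp

theorem mem_precPairs {H : Hypergraph} {e f : Fin H.numE} :
    (edgeName H e, edgeName H f) ∈ precPairs H ↔ H.prec e f = true := by
  simp [precPairs, edgeNames, precRow, zip_ofFn, List.mem_ofFn, edgeName, Hypergraph.name,
    Fin.val_inj]

variable {H : α → Hypergraph}

theorem polyTime_ofFn_vertexProperties (hH : PolyTime H) :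
    PolyTime fun x => List.ofFn (vertexProperties (H x)) :=
  hH.toTree.left.of_toTree_eq fun _ => rfl

theorem polyTime_ofFn_participantNames (hH : PolyTime H) :
    PolyTime fun x => List.ofFn (participantNames (H x)) :=
  hH.toTree.right.left.of_toTree_eq fun _ => rfl

theorem polyTime_ofFn_edgeProperties (hH : PolyTime H) :
    PolyTime fun x => List.ofFn (edgeProperties (H x)) :=
  hH.toTree.right.right.left.of_toTree_eq fun _ => rfl

theorem polyTime_ofFn_validTime (hH : PolyTime H) :
    PolyTime fun x => List.ofFn (H x).validTime :=
  hH.toTree.right.right.right.left.of_toTree_eq fun _ => rfl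

theorem polyTime_ofFn_conf (hH : PolyTime H) : PolyTime fun x => List.ofFn (H x).conf :=
  hH.toTree.right.right.right.right.right.left.of_toTree_eq fun _ => rfl

theorem polyTime_ofFn_precRow (hH : PolyTime H) : PolyTime fun x => List.ofFn (precRow (H x)) :=
  hH.toTree.right.right.right.right.right.right.left.of_toTree_eq fun _ => rfl

@[fun_prop]
theorem polyTime_edgeNames (hH : PolyTime H) : PolyTime fun x => edgeNames (H x) := by
  have names_eq (x : α) : edgeNames (H x) =
      (List.range (List.ofFn (participantNames (H x))).length).map Sum.inr :=
    List.ext_getElem (by simp [edgeNames]) fun i _ _ => by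
      simp [edgeNames, edgeName, Hypergraph.name]
  have := PolyTime.range_length (polyTime_ofFn_participantNames hH)
  simp only [names_eq]
  fun_prop

@[fun_prop]
theorem polyTime_vertexNames (hH : PolyTime H) : PolyTime fun x => vertexNames (H x) := by
  have names_eq (x : α) : vertexNames (H x) =
      (List.range (List.ofFn (vertexProperties (H x))).length).map Sum.inl :=
    List.ext_getElem (by simp [vertexNames]) fun i _ _ => by
      simp [vertexNames, Hypergraph.name]
  have := PolyTime.range_length (polyTime_ofFn_vertexProperties hH)
  simp only [names_eq]
  fun_prop

@[fun_prop]
theorem polyTime_edgeRecords (hH : PolyTime H) : PolyTime fun x => edgeRecords (H x) := by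
  have zip := (polyTime_edgeNames hH).zip <| (polyTime_ofFn_participantNames hH).zip <|
    (polyTime_ofFn_edgeProperties hH).zip <| (polyTime_ofFn_validTime hH).zip <|
    polyTime_ofFn_conf hH
  let ofTuple (p : Obj × List Obj × List (BinaryTree Unit) × Interval × ℚ) : EdgeRecord :=
    ⟨p.1, p.2.1, p.2.2.1, p.2.2.2.1, p.2.2.2.2⟩
  have ofTuple_polyTime : PolyTime ofTuple := PolyTime.id.of_toTree_eq fun _ => rfl
  have map := PolyTime.map (f := fun _ => ofTuple) zip (ofTuple_polyTime.comp PolyTime.id.snd)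
  simp only [edgeNames, zip_ofFn, List.map_ofFn] at map
  exact map

@[fun_prop]
theorem polyTime_vertexRecords (hH : PolyTime H) : PolyTime fun x => vertexRecords (H x) := by
  have zip := (polyTime_vertexNames hH).zip (polyTime_ofFn_vertexProperties hH)
  simpa only [vertexNames, zip_ofFn, vertexRecords] using zip

@[fun_prop]
theorem polyTime_precPairs (hH : PolyTime H) : PolyTime fun x => precPairs (H x) := by
  have := polyTime_ofFn_precRow hH
  unfold precPairs
  fun_prop

end Databases

end Atch

/-! ### The evaluation algorithm -/

namespace Atch

open StackProg TreeCode

/-- A system of equations between terms and objects, which determines the values of a match on the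
variables of an atom or a chain. -/
abbrev Equations := List (Term × Obj)

variable {α : Type} [TreeCode α]

section Atoms

/-- A test for a range predicate and the window from `lo` to `hi`. -/
def windowTest (I : Interval) (lo hi : ℚ) : RangePred → Bool
  | .within =>
    (I.lower.toList.any fun a => decide (lo ≤ a)) && I.upper.toList.any fun b => decide (b ≤ hi)
  | .covers =>
    (I.lower.toList.all fun a => decide (a ≤ lo)) && I.upper.toList.all fun b => decide (hi ≤ b)
  | .overlaps =>
    (I.lower.toList.all fun a => decide (a ≤ hi)) && I.upper.toList.all fun b => decide (lo ≤ b)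

/-- A test for the condition that an atom imposes on a single hyperedge, apart from its
participants. -/
def edgeTest (r : EdgeRecord) : Atom → Bool
  | .edgeAttr _ p => decide (propertyTree p ∈ r.properties)
  | .window _ R W => windowTest r.validTime W.lo W.hi R
  | .confGe _ θ => decide (θ ≤ r.conf)
  | .confGt _ θ => !decide (r.conf ≤ θ)
  | _ => true

/-- The systems of equations whose solutions are the maps that satisfy an atom. -/
def atomEquations (H : Hypergraph) : Atom → List Equations
  | .hyperedge z ts =>
    ((edgeRecords H).filter fun r => decide (ts.length = r.participants.length)).map fun r =>
      (z, r.name) :: ts.zip r.participants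
  | .participant t z =>
    (edgeRecords H).flatMap fun r => r.participants.map fun o => [(t, o), (z, r.name)]
  | .vertexAttr t p =>
    ((vertexRecords H).filter fun r => decide (propertyTree p ∈ r.2)).map fun r => [(t, r.1)]
  | a => ((edgeRecords H).filter fun r => edgeTest r a).map fun r => [(atomTerm a, r.name)]

@[fun_prop]
theorem polyTime_windowTest {I : α → Interval} {lo hi : α → ℚ} {r : α → RangePred}
    (hI : PolyTime I) (hlo : PolyTime lo) (hhi : PolyTime hi) (hr : PolyTime r) :
    PolyTime fun x => windowTest (I x) (lo x) (hi x) (r x) := by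
  have test_eq (x : α) : windowTest (I x) (lo x) (hi x) (r x) =
      bif decide (relCode (r x) = 0) then windowTest (I x) (lo x) (hi x) .within
      else bif decide (relCode (r x) = 1) then windowTest (I x) (lo x) (hi x) .covers
      else windowTest (I x) (lo x) (hi x) .overlaps := by
    cases r x <;> rfl
  simp only [test_eq]
  unfold windowTest
  fun_prop

@[fun_prop]
theorem polyTime_edgeTest {r : α → EdgeRecord} {f : α → Atom} (hr : PolyTime r)
    (hf : PolyTime f) : PolyTime fun x => edgeTest (r x) (f x) := by
  have test_eq (x : α) : edgeTest (r x) (f x) =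
      bif decide (atomKind (f x) = 3) then decide (atomProperty (f x) ∈ (r x).properties)
      else bif decide (atomKind (f x) = 4) then
        windowTest (r x).validTime (atomLower (f x)) (atomUpper (f x)) (atomRangePred (f x))
      else bif decide (atomKind (f x) = 5) then decide (atomLower (f x) ≤ (r x).conf)
      else bif decide (atomKind (f x) = 6) then !decide ((r x).conf ≤ atomLower (f x))
      else true := by
    cases f x <;> rfl
  simp only [test_eq]
  fun_prop

@[fun_prop]
theorem polyTime_atomEquations {H : α → Hypergraph} {f : α → Atom} (hH : PolyTime H)
    (hf : PolyTime f) : PolyTime fun x => atomEquations (H x) (f x) := by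
  have equations_eq (x : α) : atomEquations (H x) (f x) =
      bif decide (atomKind (f x) = 0) then
        ((edgeRecords (H x)).filter fun r =>
          decide ((atomTerms (f x)).length = r.participants.length)).map fun r =>
            (atomTerm (f x), r.name) :: (atomTerms (f x)).zip r.participants
      else bif decide (atomKind (f x) = 1) then
        (edgeRecords (H x)).flatMap fun r => r.participants.map fun o =>
          (atomTerm (f x), o) :: (atomTerms (f x)).map fun z => (z, r.name)
      else bif decide (atomKind (f x) = 2) then
        ((vertexRecords (H x)).filter fun r => decide (atomProperty (f x) ∈ r.2)).map fun r =>
          [(atomTerm (f x), r.1)]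
      else ((edgeRecords (H x)).filter fun r => edgeTest r (f x)).map fun r =>
        [(atomTerm (f x), r.name)] := by
    cases f x <;> rfl
  simp only [equations_eq]
  fun_prop

end Atoms

section Chains

/-- The systems of equations whose solutions are the maps that satisfy a chain of depth at most
`d`. -/
def chainEquations (d : ℕ) (H : Hypergraph) (zs : List Term) : List Equations :=
  ((listsUpTo (edgeNames H) (d + 1)).filter fun es => decide (zs.length = es.length) &&
    (es.zip es.tail).all fun p => (precPairs H).any fun q => decide (p = q)).map fun es => zs.zip es

@[fun_prop]
theorem polyTime_chainEquations (d : ℕ) {H : α → Hypergraph} {zs : α → List Term}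
    (hH : PolyTime H) (hzs : PolyTime zs) : PolyTime fun x => chainEquations d (H x) (zs x) := by
  unfold chainEquations
  fun_prop

end Chains

section Consistency

/-- Two systems of equations are compatible if they give the same values to their common terms. -/
def compatible (m k : Equations) : Bool :=
  m.all fun p => k.all fun q => !decide (p.1 = q.1) || decide (p.2 = q.2)

/-- A test for the solvability of a system of equations. -/
def solvable (m : Equations) : Bool :=
  compatible m m && m.all fun p => !(varList p.1).isEmpty || decide (p.1 = .const p.2)

/-- Removes the systems of equations that are compatible with no member of some other list. -/
def prune (Rs : List (List Equations)) : List (List Equations) :=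
  Rs.map fun R => R.filter fun m => Rs.all fun S => S.any fun k => compatible m k

/-- A test whether all lists stay non-empty if incompatible systems are removed exhaustively. -/
def consistent (Rs : List (List Equations)) : Bool :=
  (prune^[Rs.flatten.length] Rs).all fun R => !R.isEmpty

@[fun_prop]
theorem polyTime_compatible {m k : α → Equations} (hm : PolyTime m) (hk : PolyTime k) :
    PolyTime fun x => compatible (m x) (k x) := by
  unfold compatible
  fun_prop

@[fun_prop]
theorem polyTime_solvable {m : α → Equations} (hm : PolyTime m) :
    PolyTime fun x => solvable (m x) := by
  unfold solvable
  fun_prop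

@[fun_prop]
theorem polyTime_consistent {Rs : α → List (List Equations)} (hRs : PolyTime Rs) :
    PolyTime fun x => consistent (Rs x) := by
  have flatten_polyTime : PolyTime fun x => (Rs x).flatten := by
    simp only [List.flatten_eq_flatMap]
    fun_prop
  have prune_polyTime : PolyTime fun p : α × List (List Equations) => prune p.2 := by
    unfold prune
    fun_prop
  have := PolyTime.iterate (f := fun _ => prune) flatten_polyTime hRs prune_polyTime
    fun _ Rs => size_map_le (fun _ => size_le_of_sublist List.filter_sublist) Rs
  unfold consistent
  fun_prop

end Consistency

section Evaluation

/-- The variables of a list of terms, as a list. -/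
def varsList (ts : List Term) : List ℕ := ts.flatMap varList

/-- The variables of an atom, as a list. -/
def atomVarsList (a : Atom) : List ℕ := varsList (atomTerm a :: atomTerms a)

/-- The relations of the atoms and the chains: the lists of their systems of equations. -/
def relations (d : ℕ) (H : Hypergraph) (atoms : List Atom) (chains : List (List Term)) :
    List (List Equations) :=
  atoms.map (atomEquations H) ++ chains.map (chainEquations d H)

/-- The extensions of a system of equations by systems for the chains of a list, up to the first
`c` of them; the remaining chains are returned as well. -/
def choices (d : ℕ) (H : Hypergraph) (m : Equations) :
    ℕ → List (List Term) → List (Equations × List (List Term))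
  | 0, chains => [(m, chains)]
  | c + 1, chains => (choices d H m c chains).flatMap fun p => listCase p.2 [p] fun zs rest =>
      (chainEquations d H zs).map fun k => (k ++ p.1, rest)

/-- A test for answers to queries whose chains are split into at most `c` free chains and tied
chains that form an acyclic family with the atoms. -/
def splitTest (c d : ℕ) (x : Instance) (free tied : List (List Term)) : Bool :=
  acyclicTest (x.query.atoms.map atomVarsList ++ tied.map varsList) &&
    (choices d x.db ((x.query.output.map Term.var).zip x.tuple) c free).any fun p =>
      solvable p.1 && consistent ((relations d x.db x.query.atoms tied).map fun R =>
        R.filter fun m => solvable m && compatible p.1 m)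

/-- The evaluation algorithm. -/
def evaluate (c d : ℕ) (x : Instance) : Bool :=
  (x.query.chains.all fun zs => decide (zs.length ≤ d + 1)) &&
    (decide (x.query.output.length = x.tuple.length) &&
      x.tuple.all fun o => (vertexNames x.db ++ edgeNames x.db).any fun n => decide (o = n)) &&
    (splits c x.query.chains).any fun p => splitTest c d x p.1 p.2

@[fun_prop]
theorem polyTime_varsList {ts : α → List Term} (hts : PolyTime ts) :
    PolyTime fun x => varsList (ts x) := by
  unfold varsList
  fun_prop

@[fun_prop]
theorem polyTime_choices (d c : ℕ) {H : α → Hypergraph} {m : α → Equations}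
    {chains : α → List (List Term)} (hH : PolyTime H) (hm : PolyTime m)
    (hchains : PolyTime chains) :
    PolyTime fun x => choices d (H x) (m x) c (chains x) := by
  induction c with
  | zero => unfold choices; fun_prop
  | succ c ih => unfold choices; fun_prop

@[fun_prop]
theorem polyTime_splitTest (c d : ℕ) {f : α → Instance} {free tied : α → List (List Term)}
    (hf : PolyTime f) (hfree : PolyTime free) (htied : PolyTime tied) :
    PolyTime fun x => splitTest c d (f x) (free x) (tied x) := by
  unfold splitTest relations atomVarsList
  fun_prop

theorem polyTime_evaluate (c d : ℕ) : PolyTime (evaluate c d) := by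
  unfold evaluate
  fun_prop

end Evaluation

end Atch

/-! ### Correctness of the tests for atoms and chains -/

namespace Atch

open StackProg TreeCode

section Windows

variable {I : Interval}

theorem lower_mem_points {a : ℚ} (ha : a ∈ I.lower) : a ∈ I.points :=
  ⟨fun _ ha' => (Option.mem_unique ha' ha).le, I.ordered a ha⟩

theorem upper_mem_points {b : ℚ} (hb : b ∈ I.upper) : b ∈ I.points :=
  ⟨fun a ha => I.ordered a ha b hb, fun _ hb' => (Option.mem_unique hb hb').le⟩

theorem exists_mem_points_lt (hI : I.lower = none) (t : ℚ) : ∃ s ∈ I.points, s < t := by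
  cases hu : I.upper with
  | none => exact ⟨t - 1, by simp [Interval.points, hI, hu], by simp⟩
  | some b => exact ⟨min b (t - 1), by simp [Interval.points, hI, hu], by simp⟩

theorem exists_mem_points_gt (hI : I.upper = none) (t : ℚ) : ∃ s ∈ I.points, t < s := by
  cases hl : I.lower with
  | none => exact ⟨t + 1, by simp [Interval.points, hI, hl], by simp⟩
  | some a => exact ⟨max a (t + 1), by simp [Interval.points, hI, hl], by simp⟩

theorem points_subset_Icc_iff {lo hi : ℚ} :
    I.points ⊆ Set.Icc lo hi ↔ (∃ a ∈ I.lower, lo ≤ a) ∧ ∃ b ∈ I.upper, b ≤ hi := by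
  constructor
  · intro h
    constructor
    · cases hl : I.lower with
      | none =>
        obtain ⟨s, hs, hlt⟩ := exists_mem_points_lt hl lo
        exact absurd (h hs).1 hlt.not_ge
      | some a => exact ⟨a, rfl, (h (lower_mem_points hl)).1⟩
    · cases hu : I.upper with
      | none =>
        obtain ⟨s, hs, hlt⟩ := exists_mem_points_gt hu hi
        exact absurd (h hs).2 hlt.not_ge
      | some b => exact ⟨b, rfl, (h (upper_mem_points hu)).2⟩
  · rintro ⟨⟨a, ha, hlo⟩, b, hb, hhi⟩ t ht
    exact ⟨hlo.trans (ht.1 a ha), (ht.2 b hb).trans hhi⟩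

theorem Icc_subset_points_iff {lo hi : ℚ} (h : lo ≤ hi) :
    Set.Icc lo hi ⊆ I.points ↔ (∀ a ∈ I.lower, a ≤ lo) ∧ ∀ b ∈ I.upper, hi ≤ b :=
  ⟨fun hsub => ⟨(hsub ⟨le_rfl, h⟩).1, (hsub ⟨h, le_rfl⟩).2⟩, fun ⟨hlo, hhi⟩ _ ht =>
    ⟨fun a ha => (hlo a ha).trans ht.1, fun b hb => ht.2.trans (hhi b hb)⟩⟩

theorem points_inter_Icc_nonempty_iff {lo hi : ℚ} (h : lo ≤ hi) :
    (I.points ∩ Set.Icc lo hi).Nonempty ↔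
      (∀ a ∈ I.lower, a ≤ hi) ∧ ∀ b ∈ I.upper, lo ≤ b := by
  constructor
  · rintro ⟨t, ⟨hlower, hupper⟩, hlo, hhi⟩
    exact ⟨fun a ha => (hlower a ha).trans hhi, fun b hb => hlo.trans (hupper b hb)⟩
  · rintro ⟨hlower, hupper⟩
    by_cases hlo : lo ∈ I.points
    · exact ⟨lo, hlo, le_rfl, h⟩
    -- Since `lo` respects the upper end, it must violate the lower end, which then is a witness.
    obtain ⟨a, ha, hlt⟩ : ∃ a ∈ I.lower, lo < a := by
      by_contra! hle
      exact hlo ⟨hle, hupper⟩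
    exact ⟨a, lower_mem_points ha, hlt.le, hlower a ha⟩

theorem windowTest_iff (r : RangePred) (I : Interval) (W : Window) :
    windowTest I W.lo W.hi r = true ↔ r.Holds I W := by
  cases r
  · simp [windowTest, RangePred.Holds, points_subset_Icc_iff]
  · simp [windowTest, RangePred.Holds, Icc_subset_points_iff W.ordered]
  · simp [windowTest, RangePred.Holds, points_inter_Icc_nonempty_iff W.ordered]

end Windows

section Solutions

/-- A map of the variables solves a system of equations. -/
def Solves (ν : ℕ → Obj) (m : Equations) : Prop := ∀ p ∈ m, p.1.val ν = p.2

/-- The variables of a system of equations. -/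
def equationVars (m : Equations) : Finset ℕ := termVars (m.map Prod.fst)

variable {ν ν' : ℕ → Obj} {m k : Equations}

theorem mem_foldr_union {β : Type} {f : β → Finset ℕ} {l : List β} {x : ℕ} :
    x ∈ l.foldr (fun b s => f b ∪ s) ∅ ↔ ∃ b ∈ l, x ∈ f b := by
  induction l with
  | nil => simp
  | cons b l ih => simp [ih]

theorem mem_termVars {ts : List Term} {x : ℕ} : x ∈ termVars ts ↔ Term.var x ∈ ts := by
  have mem_vars (t : Term) : x ∈ t.vars ↔ t = .var x := by
    cases t <;> simp [Term.vars, eq_comm]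
  simp [termVars, mem_foldr_union, mem_vars]

theorem mem_equationVars {x : ℕ} : x ∈ equationVars m ↔ ∃ o, (Term.var x, o) ∈ m := by
  simp [equationVars, mem_termVars]

theorem solves_cons {p : Term × Obj} : Solves ν (p :: m) ↔ p.1.val ν = p.2 ∧ Solves ν m :=
  List.forall_mem_cons

theorem solves_append : Solves ν (m ++ k) ↔ Solves ν m ∧ Solves ν k :=
  List.forall_mem_append

theorem solves_singleton {p : Term × Obj} : Solves ν [p] ↔ p.1.val ν = p.2 :=
  List.forall_mem_singleton

theorem solves_zip : ∀ {ts : List Term} {os : List Obj}, ts.length = os.length →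
    (Solves ν (ts.zip os) ↔ ts.map (Term.val ν) = os)
  | [], [], _ => by simp [Solves]
  | t :: ts, o :: os, h => by
    rw [List.zip_cons_cons, solves_cons, solves_zip (by simpa using h), List.map_cons,
      List.cons.injEq]

theorem equationVars_zip {ts : List Term} {os : List Obj} (h : ts.length = os.length) :
    equationVars (ts.zip os) = termVars ts := by
  rw [equationVars, List.map_fst_zip h.le]

theorem Solves.congr (h : Solves ν m) (hν : ∀ x ∈ equationVars m, ν' x = ν x) :
    Solves ν' m := by
  rintro ⟨x | o, o'⟩ hp
  · exact (hν x (mem_equationVars.2 ⟨o', hp⟩)).trans (h _ hp)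
  · exact h _ hp

theorem compatible_iff :
    compatible m k = true ↔ ∀ p ∈ m, ∀ q ∈ k, p.1 = q.1 → p.2 = q.2 := by
  simp [compatible, imp_iff_not_or]

theorem Solves.compatible (hm : Solves ν m) (hk : Solves ν k) : compatible m k = true :=
  compatible_iff.2 fun p hp q hq h => by rw [← hm p hp, ← hk q hq, h]

theorem Solves.apply_eq (hm : Solves ν m) (hk : Solves ν' k)
    (h : Atch.compatible m k = true) {x : ℕ} (hxm : x ∈ equationVars m)
    (hxk : x ∈ equationVars k) : ν x = ν' x := by
  obtain ⟨o, ho⟩ := mem_equationVars.1 hxm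
  obtain ⟨o', ho'⟩ := mem_equationVars.1 hxk
  calc ν x = o := hm _ ho
    _ = o' := compatible_iff.1 h _ ho _ ho' rfl
    _ = ν' x := (hk _ ho').symm

theorem solvable_iff : solvable m = true ↔
    compatible m m = true ∧ ∀ o o', (Term.const o, o') ∈ m → o = o' := by
  rw [solvable, Bool.and_eq_true, List.all_eq_true]
  refine and_congr_right fun _ => ⟨fun h o o' ho => by simpa [varList] using h _ ho, fun h => ?_⟩
  rintro ⟨x | o, o'⟩ hp
  · simp [varList]
  · simpa [varList] using h o o' hp

theorem Solves.solvable (h : Solves ν m) : solvable m = true :=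
  solvable_iff.2 ⟨h.compatible h, fun _ _ ho => h _ ho⟩

theorem exists_solves_of_solvable (ν : ℕ → Obj) (hm : solvable m = true) :
    ∃ ν', Solves ν' m ∧ ∀ x ∉ equationVars m, ν' x = ν x := by
  classical
  obtain ⟨hcomp, hconst⟩ := solvable_iff.1 hm
  refine ⟨fun x => if h : ∃ o, (Term.var x, o) ∈ m then h.choose else ν x, ?_, ?_⟩
  · rintro ⟨x | o, o'⟩ hp
    · have h : ∃ o, (Term.var x, o) ∈ m := ⟨o', hp⟩
      simpa only [Term.val, h, dif_pos] using compatible_iff.1 hcomp _ h.choose_spec _ hp rfl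
    · exact hconst o o' hp
  · intro x hx
    rw [mem_equationVars] at hx
    simp only [hx, dif_neg, not_false_eq_true]

end Solutions

/-- A list of systems of equations, all with the variables `s` and with values in `H`, represents
a condition on the maps of the variables if the maps that satisfy the condition are those that
solve one of the systems. -/
structure Represents (H : Hypergraph) (R : List Equations) (s : Finset ℕ)
    (P : (ℕ → Obj) → Prop) : Prop where
  iff_exists_solves : ∀ ν, P ν ↔ ∃ m ∈ R, Solves ν m
  vars_eq : ∀ m ∈ R, equationVars m = s
  mem_objects : ∀ m ∈ R, ∀ p ∈ m, p.2 ∈ H.objects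

variable {H : Hypergraph} {R : List Equations} {s : Finset ℕ} {P : (ℕ → Obj) → Prop}

theorem Represents.apply_mem_objects (h : Represents H R s P) {ν : ℕ → Obj} (hν : P ν) {x : ℕ}
    (hx : x ∈ s) : ν x ∈ H.objects := by
  obtain ⟨m, hm, hs⟩ := (h.iff_exists_solves ν).1 hν
  rw [← h.vars_eq m hm] at hx
  obtain ⟨o, ho⟩ := mem_equationVars.1 hx
  have apply_eq : ν x = o := hs _ ho
  exact apply_eq ▸ h.mem_objects m hm _ ho

section Atoms

variable (H)

theorem name_mem_objects (o : Fin H.numV ⊕ Fin H.numE) : H.name o ∈ H.objects := ⟨o, rfl⟩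

theorem propertyTree_mem_map {p : Property} {l : List Property} :
    propertyTree p ∈ l.map propertyTree ↔ p ∈ l :=
  List.mem_map_of_injective propertyTree_injective

theorem represents_hyperedge (z : Term) (ts : List Term) :
    Represents H (atomEquations H (.hyperedge z ts)) (Atom.hyperedge z ts).vars
      ((Atom.hyperedge z ts).Holds H) := by
  have mem_iff (m : Equations) : m ∈ atomEquations H (.hyperedge z ts) ↔ ∃ e,
      ts.length = ((H.nodes e).map H.name).length ∧
        (z, H.name (.inr e)) :: ts.zip ((H.nodes e).map H.name) = m := by
    simp [atomEquations, edgeRecords, edgeRecord, edgeName, participantNames, List.mem_ofFn]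
  refine ⟨fun ν => ?_, fun m hm => ?_, fun m hm => ?_⟩
  · simp only [Atom.Holds, mem_iff]
    constructor
    · rintro ⟨e, hz, hts⟩
      have hlen : ts.length = ((H.nodes e).map H.name).length := by
        rw [← hts, List.length_map]
      exact ⟨_, ⟨e, hlen, rfl⟩, solves_cons.2 ⟨hz, (solves_zip hlen).2 hts⟩⟩
    · rintro ⟨_, ⟨e, hlen, rfl⟩, hm⟩
      obtain ⟨hz, hts⟩ := solves_cons.1 hm
      exact ⟨e, hz, (solves_zip hlen).1 hts⟩
  · obtain ⟨e, hlen, rfl⟩ := (mem_iff m).1 hm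
    exact congrArg (z.vars ∪ ·) (equationVars_zip hlen)
  · obtain ⟨e, -, rfl⟩ := (mem_iff m).1 hm
    refine List.forall_mem_cons.2 ⟨name_mem_objects H (.inr e), fun p hp => ?_⟩
    obtain ⟨o, -, ho⟩ := List.mem_map.1 (List.of_mem_zip hp).2
    exact ho ▸ name_mem_objects H o

theorem represents_participant (t z : Term) :
    Represents H (atomEquations H (.participant t z)) (Atom.participant t z).vars
      ((Atom.participant t z).Holds H) := by
  have mem_iff (m : Equations) : m ∈ atomEquations H (.participant t z) ↔ ∃ e,
      ∃ o ∈ H.nodes e, [(t, H.name o), (z, H.name (.inr e))] = m := by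
    simp only [atomEquations, edgeRecords, List.mem_flatMap, List.mem_ofFn, List.mem_map,
      exists_exists_eq_and, edgeRecord, edgeName, participantNames, exists_exists_and_eq_and]
  refine ⟨fun ν => ?_, fun m hm => ?_, fun m hm => ?_⟩
  · simp only [Atom.Holds, mem_iff]
    constructor
    · rintro ⟨e, hz, o, ho, ht⟩
      exact ⟨_, ⟨e, o, ho, rfl⟩, solves_cons.2 ⟨ht, solves_singleton.2 hz⟩⟩
    · rintro ⟨_, ⟨e, o, ho, rfl⟩, hm⟩
      obtain ⟨ht, hz⟩ := solves_cons.1 hm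
      exact ⟨e, solves_singleton.1 hz, o, ho, ht⟩
  · obtain ⟨e, o, -, rfl⟩ := (mem_iff m).1 hm
    simp [equationVars, termVars, Atom.vars]
  · obtain ⟨e, o, -, rfl⟩ := (mem_iff m).1 hm
    simp [name_mem_objects]

theorem represents_singletons {ι : Type} (f : ι → Fin H.numV ⊕ Fin H.numE) (C : ι → Prop)
    (t : Term) (hR : ∀ m, m ∈ R ↔ ∃ i, C i ∧ [(t, H.name (f i))] = m) :
    Represents H R t.vars fun ν => ∃ i, t.val ν = H.name (f i) ∧ C i := by
  refine ⟨fun ν => ?_, fun m hm => ?_, fun m hm => ?_⟩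
  · simp only [hR]
    constructor
    · rintro ⟨i, ht, hi⟩
      exact ⟨_, ⟨i, hi, rfl⟩, solves_singleton.2 ht⟩
    · rintro ⟨_, ⟨i, hi, rfl⟩, hm⟩
      exact ⟨i, solves_singleton.1 hm, hi⟩
  · obtain ⟨i, -, rfl⟩ := (hR m).1 hm
    simp [equationVars, termVars]
  · obtain ⟨i, -, rfl⟩ := (hR m).1 hm
    simp [name_mem_objects]

theorem represents_filter_edgeRecords (z : Term) {test : EdgeRecord → Bool}
    {C : Fin H.numE → Prop} (hC : ∀ e, test (edgeRecord H e) = true ↔ C e) :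
    Represents H (((edgeRecords H).filter test).map fun r => [(z, r.name)]) z.vars
      fun ν => ∃ e, z.val ν = H.name (.inr e) ∧ C e := by
  refine represents_singletons H Sum.inr C z fun m => ?_
  simp only [edgeRecords, List.mem_map, List.mem_filter, List.mem_ofFn, ← hC]
  constructor
  · rintro ⟨_, ⟨⟨e, rfl⟩, he⟩, hm⟩
    exact ⟨e, he, hm⟩
  · rintro ⟨e, he, hm⟩
    exact ⟨_, ⟨⟨e, rfl⟩, he⟩, hm⟩

theorem represents_atom (a : Atom) :
    Represents H (atomEquations H a) a.vars (a.Holds H) := by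
  cases a with
  | hyperedge z ts => exact represents_hyperedge H z ts
  | participant t z => exact represents_participant H t z
  | vertexAttr t p =>
    refine represents_singletons H Sum.inl _ t fun m => ?_
    simp only [atomEquations, vertexRecords, List.mem_map (f := fun r : Obj × _ => [(t, r.1)]),
      List.mem_filter, List.mem_ofFn, decide_eq_true_eq]
    constructor
    · rintro ⟨_, ⟨⟨v, rfl⟩, hv⟩, hm⟩
      exact ⟨v, propertyTree_mem_map.1 hv, hm⟩
    · rintro ⟨v, hv, hm⟩
      exact ⟨_, ⟨⟨v, rfl⟩, propertyTree_mem_map.2 hv⟩, hm⟩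
  | edgeAttr z p =>
    exact represents_filter_edgeRecords H z fun e => decide_eq_true_iff.trans propertyTree_mem_map
  | window z r W => exact represents_filter_edgeRecords H z fun e => windowTest_iff _ _ _
  | confGe z θ => exact represents_filter_edgeRecords H z fun e => decide_eq_true_iff
  | confGt z θ =>
    exact represents_filter_edgeRecords H z fun e => by
      rw [edgeTest, Bool.not_eq_true', decide_eq_false_iff_not]
      exact not_le

end Atoms

section Chains

theorem mem_listsUpTo {β : Type} {l m : List β} {k : ℕ} :
    m ∈ listsUpTo l k ↔ m.length ≤ k ∧ ∀ b ∈ m, b ∈ l := by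
  induction k generalizing m with
  | zero => simpa [listsUpTo] using fun h => by simp [h]
  | succ k ih => cases m <;> simp [listsUpTo, ih]; tauto

theorem isChain_iff_forall_mem_zip_tail {β : Type} {r : β → β → Prop} {l : List β} :
    l.IsChain r ↔ ∀ p ∈ l.zip l.tail, r p.1 p.2 := by
  induction l with
  | nil => simp
  | cons a l ih => cases l <;> simp_all

theorem isChain_prec_iff {es : List (Fin H.numE)} :
    es.IsChain (fun e f => H.prec e f = true) ↔
      ∀ p ∈ (es.map (edgeName H)).zip (es.map (edgeName H)).tail, p ∈ precPairs H := by
  simp only [isChain_iff_forall_mem_zip_tail, ← List.map_tail, List.zip_map, List.forall_mem_map,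
    Prod.map, mem_precPairs]

theorem mem_chainEquations {d : ℕ} {zs : List Term} (hd : zs.length ≤ d + 1) {m : Equations} :
    m ∈ chainEquations d H zs ↔ ∃ es : List (Fin H.numE),
      zs.length = (es.map (edgeName H)).length ∧
        es.IsChain (fun e f => H.prec e f = true) ∧ zs.zip (es.map (edgeName H)) = m := by
  have names_iff (os : List Obj) :
      (∀ o ∈ os, o ∈ edgeNames H) ↔ ∃ es : List (Fin H.numE), es.map (edgeName H) = os := by
    simp only [edgeNames, List.mem_ofFn]
    exact (Set.ext_iff.1 (Set.range_list_map (edgeName H)) os).symm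
  simp only [chainEquations, List.mem_map, List.mem_filter, mem_listsUpTo, names_iff,
    Bool.and_eq_true, List.all_eq_true, List.any_eq_true, decide_eq_true_eq, exists_eq_right',
    isChain_prec_iff]
  constructor
  · rintro ⟨_, ⟨⟨-, es, rfl⟩, hlen, hprec⟩, rfl⟩
    exact ⟨es, hlen, hprec, rfl⟩
  · rintro ⟨es, hlen, hprec, rfl⟩
    exact ⟨_, ⟨⟨hlen ▸ hd, es, rfl⟩, hlen, hprec⟩, rfl⟩

theorem represents_chain {d : ℕ} {zs : List Term} (hd : zs.length ≤ d + 1) :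
    Represents H (chainEquations d H zs) (termVars zs) fun ν => ChainHolds H ν zs := by
  refine ⟨fun ν => ?_, fun m hm => ?_, fun m hm p hp => ?_⟩
  · simp only [ChainHolds, mem_chainEquations hd]
    constructor
    · rintro ⟨es, hzs, hes⟩
      have hlen : zs.length = (es.map (edgeName H)).length := by
        simpa using congrArg List.length hzs
      exact ⟨_, ⟨es, hlen, hes, rfl⟩, (solves_zip hlen).2 hzs⟩
    · rintro ⟨_, ⟨es, hlen, hes, rfl⟩, hm⟩
      exact ⟨es, (solves_zip hlen).1 hm, hes⟩
  · obtain ⟨es, hlen, -, rfl⟩ := (mem_chainEquations hd).1 hm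
    exact equationVars_zip hlen
  · obtain ⟨es, -, -, rfl⟩ := (mem_chainEquations hd).1 hm
    obtain ⟨e, -, he⟩ := List.mem_map.1 (List.of_mem_zip hp).2
    exact he ▸ name_mem_objects H _

end Chains

end Atch

/-! ### Consistent relations over an acyclic family -/

namespace Atch

open StackProg TreeCode

section Prune

variable {Rs : List (List Equations)}

theorem prune_eq_self_or_lt (Rs : List (List Equations)) :
    prune Rs = Rs ∨ (prune Rs).flatten.length < Rs.flatten.length := by
  rw [or_iff_not_imp_right, not_lt]
  intro hle
  have flatten_prune : (prune Rs).flatten =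
      Rs.flatten.filter fun m => Rs.all fun S => S.any fun k => compatible m k :=
    (List.filter_flatten ..).symm
  have filter_eq : (prune Rs).flatten = Rs.flatten :=
    flatten_prune ▸ List.filter_sublist.eq_of_length_le (flatten_prune ▸ hle)
  rw [flatten_prune, List.filter_eq_self] at filter_eq
  calc prune Rs = Rs.map id := List.map_congr_left fun R hR =>
        List.filter_eq_self.2 fun m hm => filter_eq m (List.mem_flatten.2 ⟨R, hR, hm⟩)
    _ = Rs := List.map_id Rs

theorem prune_iterate_eq {n : ℕ} (hn : Rs.flatten.length ≤ n) :
    prune (prune^[n] Rs) = prune^[n] Rs := by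
  induction n generalizing Rs with
  | zero => exact (prune_eq_self_or_lt Rs).resolve_right fun h => by omega
  | succ n ih =>
    rw [Function.iterate_succ_apply]
    obtain h | h := prune_eq_self_or_lt Rs
    · rw [h, Function.iterate_fixed h, h]
    · exact ih (by omega)

theorem exists_solves_of_mem_iterate_prune {ν : ℕ → Obj} (h : ∀ R ∈ Rs, ∃ m ∈ R, Solves ν m)
    (n : ℕ) : ∀ R ∈ prune^[n] Rs, ∃ m ∈ R, Solves ν m := by
  induction n with
  | zero => exact h
  | succ n ih =>
    rw [Function.iterate_succ_apply']
    refine List.forall_mem_map.2 fun R hR => ?_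
    obtain ⟨m, hm, hs⟩ := ih R hR
    refine ⟨m, List.mem_filter.2 ⟨hm, List.all_eq_true.2 fun S hS => ?_⟩, hs⟩
    obtain ⟨k, hk, hsk⟩ := ih S hS
    exact List.any_eq_true.2 ⟨k, hk, hs.compatible hsk⟩

theorem consistent_of_solves {ν : ℕ → Obj} (h : ∀ R ∈ Rs, ∃ m ∈ R, Solves ν m) :
    consistent Rs = true := by
  refine List.all_eq_true.2 fun R hR => ?_
  obtain ⟨m, hm, -⟩ := exists_solves_of_mem_iterate_prune h _ R hR
  simpa using List.ne_nil_of_mem hm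

theorem exists_map_eq_iterate_prune {ι : Type} (L : List ι) (rel : ι → List Equations) (n : ℕ) :
    ∃ rel' : ι → List Equations, prune^[n] (L.map rel) = L.map rel' ∧
      ∀ i, ∀ m ∈ rel' i, m ∈ rel i := by
  induction n with
  | zero => exact ⟨rel, rfl, fun _ _ h => h⟩
  | succ n ih =>
    obtain ⟨rel', hrel', hsub⟩ := ih
    rw [Function.iterate_succ_apply', hrel', prune, List.map_map]
    exact ⟨_, rfl, fun i m hm => hsub i m (List.mem_filter.1 hm).1⟩

end Prune

section Join

variable {ι : Type} {vars : ι → Finset ℕ} {rel : ι → List Equations} {P Q : Multiset ι}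

/-- The relations indexed by `P` are non-empty lists of solvable systems of equations in the
variables `vars i`, and every system in one of them is compatible with some system in each. -/
structure PairwiseConsistent (vars : ι → Finset ℕ) (rel : ι → List Equations)
    (P : Multiset ι) : Prop where
  solvable : ∀ i ∈ P, ∀ m ∈ rel i, solvable m = true
  vars_eq : ∀ i ∈ P, ∀ m ∈ rel i, equationVars m = vars i
  nonempty : ∀ i ∈ P, ∃ m, m ∈ rel i
  exists_compatible : ∀ i ∈ P, ∀ j ∈ P, ∀ m ∈ rel i, ∃ k ∈ rel j, compatible m k = true

theorem PairwiseConsistent.mono (h : PairwiseConsistent vars rel P) (hQP : Q ⊆ P) :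
    PairwiseConsistent vars rel Q where
  solvable i hi := h.solvable i (hQP hi)
  vars_eq i hi := h.vars_eq i (hQP hi)
  nonempty i hi := h.nonempty i (hQP hi)
  exists_compatible i hi j hj := h.exists_compatible i (hQP hi) j (hQP hj)

theorem PairwiseConsistent.exists_solves_cons {a : ι} {ν : ℕ → Obj}
    (h : PairwiseConsistent vars rel (a ::ₘ P)) (ear : IsEar (vars a) (P.map vars))
    (hν : ∀ i ∈ P, ∃ m ∈ rel i, Solves ν m) :
    ∃ ν', ∀ i ∈ a ::ₘ P, ∃ m ∈ rel i, Solves ν' m := by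
  have ha := Multiset.mem_cons_self a P
  have hP {i} (hi : i ∈ P) : i ∈ a ::ₘ P := Multiset.mem_cons_of_mem hi
  -- Solving `m` changes `ν` only outside the variables of the other relations.
  suffices agree : ∃ m ∈ rel a, ∀ i ∈ P, ∀ k ∈ rel i, ∀ x ∈ equationVars k,
      x ∈ equationVars m → ∀ ν', Solves ν' m → ν' x = ν x by
    obtain ⟨m, hm, agree⟩ := agree
    obtain ⟨ν', hs, hν'⟩ := exists_solves_of_solvable ν (h.solvable a ha m hm)
    refine ⟨ν', Multiset.forall_mem_cons.2 ⟨⟨m, hm, hs⟩, fun i hi => ?_⟩⟩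
    obtain ⟨k, hk, hsk⟩ := hν i hi
    refine ⟨k, hk, hsk.congr fun x hx => ?_⟩
    by_cases hxm : x ∈ equationVars m
    · exact agree i hi k hk x hx hxm ν' hs
    · exact hν' x hxm
  obtain hempty | ⟨f, hf, shared⟩ := ear
  · obtain ⟨m, hm⟩ := h.nonempty a ha
    exact ⟨m, hm, by simp [Multiset.map_eq_zero.1 hempty]⟩
  · obtain ⟨j, hj, rfl⟩ := Multiset.mem_map.1 hf
    obtain ⟨l, hl, hsl⟩ := hν j hj
    obtain ⟨m, hm, hlm⟩ := h.exists_compatible j (hP hj) a ha l hl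
    refine ⟨m, hm, fun i hi k hk x hxk hxm ν' hs => (hsl.apply_eq hs hlm ?_ hxm).symm⟩
    rw [h.vars_eq i (hP hi) k hk] at hxk
    rw [h.vars_eq a ha m hm] at hxm
    rw [h.vars_eq j (hP hj) l hl]
    exact shared _ (Multiset.mem_map_of_mem vars hi) (Finset.mem_inter.2 ⟨hxm, hxk⟩)

theorem EarReducible.exists_solves {F : Multiset (Finset ℕ)} (hF : EarReducible F)
    (hPF : P.map vars = F) (h : PairwiseConsistent vars rel P) :
    ∃ ν, ∀ i ∈ P, ∃ m ∈ rel i, Solves ν m := by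
  classical
  induction hF generalizing P with
  | zero =>
    obtain rfl := Multiset.map_eq_zero.1 hPF
    exact ⟨fun _ => .inl 0, by simp⟩
  | @cons e F ear _ ih =>
    obtain ⟨a, ha, rfl, rfl⟩ := (Multiset.map_eq_cons vars P F e).2 hPF
    rw [← Multiset.cons_erase ha] at h ⊢
    obtain ⟨ν, hν⟩ := ih rfl (h.mono (Multiset.subset_cons _ _))
    exact h.exists_solves_cons ear hν

theorem exists_solves_of_consistent {L : List ι}
    (hL : EarReducible (L.map vars : Multiset (Finset ℕ)))
    (hsolvable : ∀ i ∈ L, ∀ m ∈ rel i, solvable m = true)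
    (hvars : ∀ i ∈ L, ∀ m ∈ rel i, equationVars m = vars i)
    (h : consistent (L.map rel) = true) : ∃ ν, ∀ i ∈ L, ∃ m ∈ rel i, Solves ν m := by
  obtain ⟨rel', hrel', hsub⟩ := exists_map_eq_iterate_prune L rel (L.map rel).flatten.length
  have fixed := prune_iterate_eq (Rs := L.map rel) le_rfl
  rw [consistent, hrel', List.all_eq_true] at h
  rw [hrel', prune, List.map_map, List.map_inj_left] at fixed
  have pairwise : PairwiseConsistent vars rel' L :=
    { solvable := fun i hi m hm => hsolvable i hi m (hsub i m hm)
      vars_eq := fun i hi m hm => hvars i hi m (hsub i m hm)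
      nonempty := fun i hi => List.exists_mem_of_ne_nil _ <| by
        simpa using h _ (List.mem_map_of_mem hi)
      exists_compatible := fun i hi j hj m hm => by
        have all_any := List.filter_eq_self.1 (fixed i hi) m hm
        exact List.any_eq_true.1 (List.all_eq_true.1 all_any _ (List.mem_map_of_mem hj)) }
  obtain ⟨ν, hν⟩ := hL.exists_solves (Multiset.map_coe vars L) pairwise
  exact ⟨ν, fun i hi => (hν i hi).imp fun m hm => ⟨hsub i m hm.1, hm.2⟩⟩

theorem consistent_filter_iff {L : List ι} {m₀ : Equations}
    (hL : EarReducible (L.map vars : Multiset (Finset ℕ)))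
    (hvars : ∀ i ∈ L, ∀ m ∈ rel i, equationVars m = vars i) :
    solvable m₀ = true ∧ consistent ((L.map rel).map fun R =>
        R.filter fun m => solvable m && compatible m₀ m) = true ↔
      ∃ ν, Solves ν m₀ ∧ ∀ i ∈ L, ∃ m ∈ rel i, Solves ν m := by
  constructor
  · rintro ⟨hm₀, hc⟩
    rw [List.map_map] at hc
    obtain ⟨ν, hν⟩ := exists_solves_of_consistent hL
      (fun i _ m hm => (Bool.and_eq_true_iff.1 (List.mem_filter.1 hm).2).1)
      (fun i hi m hm => hvars i hi m (List.mem_filter.1 hm).1) hc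
    obtain ⟨ν', hs, hν'⟩ := exists_solves_of_solvable ν hm₀
    refine ⟨ν', hs, fun i hi => ?_⟩
    obtain ⟨m, hm, hsm⟩ := hν i hi
    obtain ⟨hm, hkeep⟩ := List.mem_filter.1 hm
    refine ⟨m, hm, hsm.congr fun x hx => ?_⟩
    by_cases hx₀ : x ∈ equationVars m₀
    · exact hs.apply_eq hsm (Bool.and_eq_true_iff.1 hkeep).2 hx₀ hx
    · exact hν' x hx₀
  · rintro ⟨ν, hs, h⟩
    refine ⟨hs.solvable, consistent_of_solves (ν := ν) ?_⟩
    refine List.forall_mem_map.2 (List.forall_mem_map.2 fun i hi => ?_)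
    obtain ⟨m, hm, hsm⟩ := h i hi
    refine ⟨m, List.mem_filter.2 ⟨hm, ?_⟩, hsm⟩
    rw [hsm.solvable, hs.compatible hsm, Bool.and_true]

end Join

end Atch

/-! ### Correctness of the evaluation algorithm -/

namespace StackProg

section Splits

variable {β : Type} {c : ℕ} {l : List β} {p : List β × List β}

theorem perm_of_mem_splits (h : p ∈ splits c l) : l.Perm (p.1 ++ p.2) := by
  induction c generalizing p with
  | zero =>
    obtain rfl := List.mem_singleton.1 h
    exact .rfl
  | succ c ih =>
    simp only [splits, List.mem_append, List.mem_flatMap, List.mem_map] at h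
    obtain h | ⟨q, hq, r, hr, rfl⟩ := h
    · exact ih h
    · calc
        l.Perm (q.1 ++ q.2) := ih hq
        List.Perm _ (q.1 ++ r.1 :: r.2) := (perm_of_mem_selections hr).append_left q.1
        List.Perm _ (r.1 :: q.1 ++ r.2) := List.perm_middle

theorem length_fst_le_of_mem_splits (h : p ∈ splits c l) : p.1.length ≤ c := by
  induction c generalizing p with
  | zero =>
    obtain rfl := List.mem_singleton.1 h
    exact le_rfl
  | succ c ih =>
    simp only [splits, List.mem_append, List.mem_flatMap, List.mem_map] at h
    obtain h | ⟨q, hq, r, -, rfl⟩ := h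
    · exact (ih h).trans (Nat.le_succ c)
    · exact Nat.succ_le_succ (ih hq)

theorem exists_mem_splits {free tied : List β} (h : l.Perm (free ++ tied))
    (hc : free.length ≤ c) : ∃ p ∈ splits c l, p.2.Perm tied := by
  induction c generalizing free tied with
  | zero =>
    obtain rfl := List.length_eq_zero_iff.1 (Nat.le_zero.1 hc)
    exact ⟨_, List.mem_singleton.2 rfl, h⟩
  | succ c ih =>
    cases free with
    | nil =>
      obtain ⟨p, hp, perm⟩ := ih (free := []) h c.zero_le
      exact ⟨p, List.mem_append_left _ hp, perm⟩
    | cons b free =>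
      obtain ⟨p, hp, perm⟩ := ih (free := free) (tied := b :: tied)
        (h.trans List.perm_middle.symm) (Nat.le_of_succ_le_succ hc)
      obtain ⟨k, hk⟩ := exists_mem_selections (perm.mem_iff.2 List.mem_cons_self)
      refine ⟨(b :: p.1, k), List.mem_append_right _ ?_, ?_⟩
      · exact List.mem_flatMap.2 ⟨p, hp, List.mem_map.2 ⟨_, hk, rfl⟩⟩
      · exact ((perm_of_mem_selections hk).symm.trans perm).cons_inv

end Splits

end StackProg

namespace Atch

open StackProg TreeCode

section Choices

variable {d c : ℕ} {H : Hypergraph} {m : Equations} {chains : List (List Term)} {ν : ℕ → Obj}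

theorem snd_eq_drop_of_mem_choices {p : Equations × List (List Term)}
    (h : p ∈ choices d H m c chains) : p.2 = chains.drop c := by
  induction c generalizing p with
  | zero =>
    obtain rfl := List.mem_singleton.1 h
    rfl
  | succ c ih =>
    obtain ⟨q, hq, hp⟩ := List.mem_flatMap.1 h
    rw [← List.tail_drop, ← ih hq]
    obtain ⟨mq, _ | ⟨zs, rest⟩⟩ := q
    · rw [List.mem_singleton.1 hp, List.tail_nil]
    · obtain ⟨k, -, rfl⟩ := List.mem_map.1 hp
      rfl

theorem exists_mem_choices_succ_iff :
    (∃ p ∈ choices d H m (c + 1) chains, Solves ν p.1) ↔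
      (∃ p ∈ choices d H m c chains, Solves ν p.1) ∧
        ∀ zs ∈ chains[c]?, ∃ k ∈ chainEquations d H zs, Solves ν k := by
  have extension_iff (p : Equations × List (List Term)) :
      (∃ q ∈ listCase p.2 [p] fun zs rest => (chainEquations d H zs).map fun k =>
        (k ++ p.1, rest), Solves ν q.1) ↔
      Solves ν p.1 ∧ ∀ zs ∈ p.2.head?, ∃ k ∈ chainEquations d H zs, Solves ν k := by
    obtain ⟨mp, _ | ⟨zs, rest⟩⟩ := p
    · simp
    · simp only [listCase, List.mem_map, exists_exists_and_eq_and, solves_append, List.head?_cons,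
        Option.mem_some, forall_eq', and_comm (b := Solves ν mp), and_left_comm (b := Solves ν mp),
        exists_and_left]
  simp only [choices, List.mem_flatMap, ← List.head?_drop]
  constructor
  · rintro ⟨q, ⟨p, hp, hq⟩, hs⟩
    obtain ⟨hsp, hhead⟩ := (extension_iff p).1 ⟨q, hq, hs⟩
    exact ⟨⟨p, hp, hsp⟩, snd_eq_drop_of_mem_choices hp ▸ hhead⟩
  · rintro ⟨⟨p, hp, hsp⟩, hhead⟩
    rw [← snd_eq_drop_of_mem_choices hp] at hhead
    obtain ⟨q, hq, hs⟩ := (extension_iff p).2 ⟨hsp, hhead⟩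
    exact ⟨q, ⟨p, hp, hq⟩, hs⟩

theorem exists_mem_choices_iff :
    (∃ p ∈ choices d H m c chains, Solves ν p.1) ↔
      Solves ν m ∧ ∀ zs ∈ chains.take c, ∃ k ∈ chainEquations d H zs, Solves ν k := by
  induction c with
  | zero => simp [choices]
  | succ c ih =>
    simp only [exists_mem_choices_succ_iff, ih, and_assoc, List.take_add_one,
      List.forall_mem_append, Option.mem_toList, Option.mem_def]

end Choices

theorem Query.mem_vars {Q : Query} {x : ℕ} : x ∈ Q.vars ↔
    (∃ a ∈ Q.atoms, x ∈ a.vars) ∨ (∃ zs ∈ Q.chains, x ∈ termVars zs) ∨ x ∈ Q.output := by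
  simp only [Query.vars, Finset.mem_union, mem_foldr_union, List.mem_toFinset, or_assoc]

theorem mem_answers_iff {Q : Query} {H : Hypergraph} {t : List Obj}
    (hlen : Q.output.length = t.length) (ht : ∀ o ∈ t, o ∈ H.objects) :
    t ∈ Q.answers H ↔ ∃ ν, Solves ν ((Q.output.map Term.var).zip t) ∧
      (∀ a ∈ Q.atoms, a.Holds H ν) ∧ ∀ zs ∈ Q.chains, ChainHolds H ν zs := by
  refine exists_congr fun ν => ?_
  have output_iff : Solves ν ((Q.output.map Term.var).zip t) ↔ t = Q.output.map ν := by
    rw [solves_zip (by simpa using hlen), List.map_map, eq_comm]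
    rfl
  rw [output_iff]
  constructor
  · rintro ⟨⟨-, hatoms, hchains⟩, rfl⟩
    exact ⟨rfl, hatoms, hchains⟩
  · rintro ⟨rfl, hatoms, hchains⟩
    refine ⟨⟨fun x hx => ?_, hatoms, hchains⟩, rfl⟩
    obtain ⟨a, ha, hx⟩ | ⟨zs, hzs, hx⟩ | hx := Query.mem_vars.1 hx
    · exact (represents_atom H a).apply_mem_objects (hatoms a ha) hx
    · exact (represents_chain zs.length.le_succ).apply_mem_objects (hchains zs hzs) hx
    · exact ht _ (List.mem_map_of_mem hx)

theorem mem_answers_iff_exists_mem_choices {c d : ℕ} {Q : Query} {H : Hypergraph} {t : List Obj}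
    {free tied : List (List Term)} (perm : Q.chains.Perm (free ++ tied)) (hc : free.length ≤ c)
    (hd : ∀ zs ∈ free ++ tied, zs.length ≤ d + 1) (hlen : Q.output.length = t.length)
    (ht : ∀ o ∈ t, o ∈ H.objects) :
    t ∈ Q.answers H ↔ ∃ p ∈ choices d H ((Q.output.map Term.var).zip t) c free, ∃ ν,
      Solves ν p.1 ∧ (∀ a ∈ Q.atoms, ∃ m ∈ atomEquations H a, Solves ν m) ∧
        ∀ zs ∈ tied, ∃ m ∈ chainEquations d H zs, Solves ν m := by
  have chains_iff (ν : ℕ → Obj) : (∀ zs ∈ Q.chains, ChainHolds H ν zs) ↔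
      (∀ zs ∈ free, ∃ m ∈ chainEquations d H zs, Solves ν m) ∧
        ∀ zs ∈ tied, ∃ m ∈ chainEquations d H zs, Solves ν m := by
    simp only [perm.mem_iff, ← List.forall_mem_append]
    exact forall₂_congr fun zs hzs => (represents_chain (hd zs hzs)).iff_exists_solves ν
  have choices_iff (ν : ℕ → Obj) := exists_mem_choices_iff (d := d) (c := c) (H := H)
    (m := (Q.output.map Term.var).zip t) (chains := free) (ν := ν)
  rw [List.take_of_length_le hc] at choices_iff
  simp only [mem_answers_iff hlen ht, chains_iff, (represents_atom H _).iff_exists_solves]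
  constructor
  · rintro ⟨ν, hout, hatoms, hfree, htied⟩
    obtain ⟨p, hp, hs⟩ := (choices_iff ν).2 ⟨hout, hfree⟩
    exact ⟨p, hp, ν, hs, hatoms, htied⟩
  · rintro ⟨p, hp, ν, hs, hatoms, htied⟩
    obtain ⟨hout, hfree⟩ := (choices_iff ν).1 ⟨p, hp, hs⟩
    exact ⟨ν, hout, hatoms, hfree, htied⟩

theorem toFinset_varsList (ts : List Term) : (varsList ts).toFinset = termVars ts := by
  ext x
  have mem_varList (t : Term) : x ∈ varList t ↔ t = .var x := by
    cases t <;> simp [varList, eq_comm]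
  simp [varsList, mem_termVars, mem_varList]

theorem toFinset_atomVarsList (a : Atom) : (atomVarsList a).toFinset = a.vars := by
  rw [atomVarsList, toFinset_varsList]
  cases a <;> simp [atomTerm, atomTerms, termVars, Atom.vars]

theorem splitTest_iff {c d : ℕ} {x : Instance} {free tied : List (List Term)}
    (perm : x.query.chains.Perm (free ++ tied)) (hc : free.length ≤ c)
    (hd : ∀ zs ∈ x.query.chains, zs.length ≤ d + 1)
    (hlen : x.query.output.length = x.tuple.length) (ht : ∀ o ∈ x.tuple, o ∈ x.db.objects) :
    splitTest c d x free tied = true ↔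
      AlphaAcyclic (x.query.atoms.map Atom.vars ++ tied.map termVars) ∧
        x.tuple ∈ x.query.answers x.db := by
  let L : List (Atom ⊕ List Term) := x.query.atoms.map .inl ++ tied.map .inr
  let vars : Atom ⊕ List Term → Finset ℕ := Sum.elim Atom.vars termVars
  let rel := Sum.elim (atomEquations x.db) (chainEquations d x.db)
  replace hd : ∀ zs ∈ free ++ tied, zs.length ≤ d + 1 := fun zs hzs => hd zs (perm.mem_iff.2 hzs)
  have vars_eq : L.map vars = x.query.atoms.map Atom.vars ++ tied.map termVars := by
    simp [L, vars, Function.comp_def]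
  have lists_eq : (x.query.atoms.map atomVarsList ++ tied.map varsList).map List.toFinset =
      L.map vars := by
    simp [vars_eq, Function.comp_def, toFinset_varsList, toFinset_atomVarsList]
  have relations_eq : relations d x.db x.query.atoms tied = L.map rel := by
    simp [L, rel, relations, Function.comp_def]
  have equationVars_eq : ∀ i ∈ L, ∀ m ∈ rel i, equationVars m = vars i := by
    simp only [L, List.forall_mem_append, List.forall_mem_map]
    exact ⟨fun a _ => (represents_atom x.db a).vars_eq,
      fun zs hzs => (represents_chain (hd zs (List.mem_append_right _ hzs))).vars_eq⟩
  rw [splitTest, Bool.and_eq_true, acyclicTest_iff, lists_eq, ← vars_eq, alphaAcyclic_iff]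
  refine and_congr_right fun acyclic => ?_
  simp only [List.any_eq_true, Bool.and_eq_true, relations_eq,
    consistent_filter_iff acyclic equationVars_eq,
    mem_answers_iff_exists_mem_choices perm hc hd hlen ht, L, List.forall_mem_append,
    List.forall_mem_map, rel, Sum.elim_inl, Sum.elim_inr]

theorem mem_objects_iff {H : Hypergraph} {o : Obj} :
    o ∈ H.objects ↔ o ∈ vertexNames H ++ edgeNames H := by
  rw [List.mem_append, vertexNames, edgeNames, List.mem_ofFn', List.mem_ofFn']
  exact Sum.exists

theorem AlphaAcyclic.of_perm {F G : List (Finset ℕ)} (hF : AlphaAcyclic F) (h : F.Perm G) :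
    AlphaAcyclic G := by
  rw [alphaAcyclic_iff] at hF ⊢
  rwa [← Multiset.coe_eq_coe.2 h]

theorem evaluate_iff (c d : ℕ) (x : Instance) : evaluate c d x = true ↔
    x.query.Tractable c d ∧ x.tuple ∈ x.query.answers x.db := by
  simp only [evaluate, Bool.and_eq_true, List.all_eq_true, decide_eq_true_eq,
    List.any_eq_true (l := splits c x.query.chains), List.any_eq_true (l := _ ++ _),
    exists_eq_right', ← mem_objects_iff]
  constructor
  · rintro ⟨⟨hd, hlen, ht⟩, p, hps, hp⟩
    have perm := perm_of_mem_splits hps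
    have hc := length_fst_le_of_mem_splits hps
    obtain ⟨acyclic, answer⟩ := (splitTest_iff perm hc hd hlen ht).1 hp
    exact ⟨⟨hd, p.1, p.2, perm, hc, acyclic⟩, answer⟩
  · rintro ⟨⟨hd, free, tied, perm, hc, acyclic⟩, answer⟩
    obtain ⟨hlen, ht⟩ :
        x.query.output.length = x.tuple.length ∧ ∀ o ∈ x.tuple, o ∈ x.db.objects := by
      obtain ⟨ν, hν, htuple⟩ := answer
      rw [htuple, List.forall_mem_map, List.length_map]
      exact ⟨rfl, fun y hy => hν.objects y (Query.mem_vars.2 (.inr (.inr hy)))⟩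
    obtain ⟨p, hps, tied_perm⟩ := exists_mem_splits perm hc
    refine ⟨⟨hd, hlen, ht⟩, p, hps, (splitTest_iff (perm_of_mem_splits hps)
      (length_fst_le_of_mem_splits hps) hd hlen ht).2 ⟨acyclic.of_perm ?_, answer⟩⟩
    exact (tied_perm.symm.map _).append_left _

theorem evaluation_eq (c d : ℕ) : evaluation c d = evaluate c d := by
  funext x
  rw [Bool.eq_iff_iff, evaluate_iff]
  simp only [evaluation, decide_eq_true_eq]

end Atch

theorem mainTheorem4 (c d : ℕ) :
    Nonempty (Turing.TM2ComputableInPolyTime Atch.encInstance Computability.encodeBool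
      (Atch.evaluation c d)) := by
  rw [Atch.evaluation_eq]
  exact StackProg.PolyTime.computable Atch.Encodes.instance (Atch.polyTime_evaluate c d)
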